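/- Logarithms are natural. For a finite graph $G=(V,E)$ let $\alpha(G)$ be the maximum size of an independent set. For real $k$, let $\mathrm{LP}_k(G)$ be the maximum of $\sum_{i\in V} x_i$ over $x\in[0,1]^V$ with $x_i+x_j\le 1$ for every edge $ij$ and $\sum_{i\in C}x_i\le 1$ for every clique $C$ with $|C|\le k$. For an integer $t\ge 0$, let $\mathrm{SA}_{(t)}(G)$ be the value of the level-$t$ Sherali--Adams relaxation of the standard linear program for independent set, i.e. the maximum of $\sum_{i\in V} Y_{\{i\}}$ over all real vectors $(Y_S)_{S\subseteq V,\,|S|\le t+1}$ with $Y_\emptyset=1$ that satisfy, for all disjoint $S,T\subseteq V$ with $|S|+|T|\le t$, every edge $ij$ and every vertex $i$, $$\sum_{T'\subseteq T}(-1)^{|T'|}\bigl(Y_{S\cup T'\cup\{i\}}+Y_{S\cup T'\cup\{j\}}\bigr)\le\sum_{T'\subseteq T}(-1)^{|T'|}Y_{S\cup T'},\qquad 0\le\sum_{T'\subseteq T}(-1)^{|T'|}Y_{S\cup T'\cup\{i\}}\le\sum_{T'\subseteq T}(-1)^{|T'|}Y_{S\cup T'}.$$ For constants $C,c\in\mathbb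 N$ put $\rho_{C,c}(d)=C\,(\log\log d)^c\,\frac{d}{\log d}$. (1) The LP relaxation with clique constraints on cliques of size up to $\log d$ has integrality gap $\widetilde O(d/\log d)$: there are constants $C,c$ such that $\mathrm{LP}_{\log d}(G)\le\rho_{C,c}(d)\,\alpha(G)$ for every integer $d\ge 3$ and every finite graph $G$ of maximum degree at most $d$. (2) The same holds for the Sherali--Adams relaxation of level $\lfloor\log d\rfloor$: there are constants $C,c$ such that $\mathrm{SA}_{(\lfloor\log d\rfloor)}(G)\le\rho_{C,c}(d)\,\alpha(G)$ for all such $d$ and $G$. (3) There are a randomized algorithm and constants $C,c$ such that for every integer $d\ge3$ and every graph $G$ on $n$ vertices of maximum degree at most $d$, the algorithm, given the adjacency matrix of $G$, runs in expected time at most $C(n+1)^c2^{cd}=\mathrm{poly}(n)\cdot 2^{O(d)}$ and, whenever it halts, outputs an independent set $I$ of $G$ with $\mathrm{SA}_{(d)}(G)\le\rho_{C,c}(d)\,|I|$ and $\alpha(G)\le\rho_{C,c}(d)\,|I|$. (Algorithms are programs of a random access machine with addition, truncated subtraction, array access, tests for zero and fair random bits, each at unit cost.) -/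

import Mathlib

open scoped ENNReal

namespace IndepRelax

section Relaxations

variable {V : Type*} [Fintype V] [DecidableEq V]

/-- Feasible points of the standard linear relaxation of maximum independent set, strengthened by
the clique inequalities for all cliques with at most `k` vertices. -/
structure CliqueLPFeasible (G : SimpleGraph V) (k : ℝ) (x : V → ℝ) : Prop where
  nonneg : ∀ i, 0 ≤ x i
  le_one : ∀ i, x i ≤ 1
  edge : ∀ i j, G.Adj i j → x i + x j ≤ 1
  clique : ∀ C : Finset V, G.IsClique (C : Set V) → (C.card : ℝ) ≤ k → ∑ i ∈ C, x i ≤ 1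

/-- The optimum of the linear relaxation with clique constraints on cliques of size at most `k`. -/
noncomputable def cliqueLPValue (G : SimpleGraph V) (k : ℝ) : ℝ :=
  sSup {a | ∃ x : V → ℝ, CliqueLPFeasible G k x ∧ a = ∑ i, x i}

/-- The linearization of `x_R * ∏_{i ∈ S} x_i * ∏_{j ∈ T} (1 - x_j)`, in which each monomial
`∏_{i ∈ U} x_i` is replaced by `Y U`. -/
def lin (Y : Finset V → ℝ) (S T R : Finset V) : ℝ :=
  ∑ T' ∈ T.powerset, (-1 : ℝ) ^ T'.card * Y (S ∪ T' ∪ R)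

/-- Feasible points of the level-`t` Sherali-Adams relaxation of the standard linear relaxation of
maximum independent set: every constraint `x_i + x_j ≤ 1` (for an edge `ij`), `0 ≤ x_i` and
`x_i ≤ 1` is multiplied by every product `∏_{i ∈ S} x_i * ∏_{j ∈ T} (1 - x_j)` with
`|S| + |T| ≤ t` and linearized. Only the values of `Y` on sets with at most `t + 1` elements
are constrained. -/
structure SAFeasible (G : SimpleGraph V) (t : ℕ) (Y : Finset V → ℝ) : Prop where
  empty : Y ∅ = 1
  edge : ∀ S T : Finset V, Disjoint S T → S.card + T.card ≤ t → ∀ i j, G.Adj i j →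
    lin Y S T {i} + lin Y S T {j} ≤ lin Y S T ∅
  nonneg : ∀ S T : Finset V, Disjoint S T → S.card + T.card ≤ t → ∀ i, 0 ≤ lin Y S T {i}
  le_one : ∀ S T : Finset V, Disjoint S T → S.card + T.card ≤ t → ∀ i,
    lin Y S T {i} ≤ lin Y S T ∅

/-- The optimum of the level-`t` Sherali-Adams relaxation. -/
noncomputable def saValue (G : SimpleGraph V) (t : ℕ) : ℝ :=
  sSup {a | ∃ Y : Finset V → ℝ, SAFeasible G t Y ∧ a = ∑ i, Y {i}}

end Relaxations

/-- The quantity `C * (log log d) ^ c * d / log d`; a ratio is `Õ(d / log d)` if it is at most this,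
for some constants `C` and `c`. -/
noncomputable def softRatio (C c d : ℕ) : ℝ :=
  C * Real.log (Real.log d) ^ c * (d / Real.log d)

/-- A relaxation with value `val d G` on graphs of maximum degree at most `d` has integrality gap
`Õ(d / log d)`. -/
def HasSoftGap (val : ℕ → ∀ n : ℕ, SimpleGraph (Fin n) → ℝ) : Prop :=
  ∃ C c : ℕ, ∀ d : ℕ, 3 ≤ d → ∀ (n : ℕ) (G : SimpleGraph (Fin n)) [DecidableRel G.Adj],
    G.maxDegree ≤ d → val d n G ≤ softRatio C c d * G.indepNum

section Machine

/-- Programs of a randomized random access machine with registers `r_0, r_1, …` and arrays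
`A_0, A_1, …` of natural numbers. As unit cost is charged, the only arithmetic is addition and
truncated subtraction. -/
inductive Prog : Type
  /-- `r_i := k` -/
  | const (i k : ℕ)
  /-- `r_i := r_j + r_k` -/
  | add (i j k : ℕ)
  /-- `r_i := r_j - r_k` (truncated) -/
  | sub (i j k : ℕ)
  /-- `r_i := A_a[r_j]` -/
  | load (i a j : ℕ)
  /-- `A_a[r_i] := r_j` -/
  | store (a i j : ℕ)
  /-- `r_i :=` a fresh fair random bit -/
  | flip (i : ℕ)
  | seq (p q : Prog)
  /-- if `r_i ≠ 0` then `p` else `q` -/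
  | ite (i : ℕ) (p q : Prog)
  /-- while `r_i ≠ 0` do `p` -/
  | loop (i : ℕ) (p : Prog)

/-- Contents of the registers and arrays, and the random bits that have not been read yet. -/
structure State where
  reg : ℕ → ℕ
  arr : ℕ → ℕ → ℕ
  coins : ℕ → Bool

/-- `s` with register `i` set to `v`. -/
def State.setReg (s : State) (i v : ℕ) : State :=
  { s with reg := Function.update s.reg i v }

/-- `s` with entry `p` of array `a` set to `v`. -/
def State.setArr (s : State) (a p v : ℕ) : State :=
  { s with arr := Function.update s.arr a (Function.update (s.arr a) p v) }

/-- `s` with its first unread random bit discarded. -/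
def State.dropCoin (s : State) : State :=
  { s with coins := fun k => s.coins (k + 1) }

/-- `Exec p s t s'`: started in state `s`, the program `p` halts after exactly `t` steps in
state `s'`. Each basic instruction and each evaluation of a test is one step. -/
inductive Exec : Prog → State → ℕ → State → Prop
  | const (s : State) (i k : ℕ) : Exec (.const i k) s 1 (s.setReg i k)
  | add (s : State) (i j k : ℕ) : Exec (.add i j k) s 1 (s.setReg i (s.reg j + s.reg k))
  | sub (s : State) (i j k : ℕ) : Exec (.sub i j k) s 1 (s.setReg i (s.reg j - s.reg k))
  | load (s : State) (i a j : ℕ) : Exec (.load i a j) s 1 (s.setReg i (s.arr a (s.reg j)))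
  | store (s : State) (a i j : ℕ) : Exec (.store a i j) s 1 (s.setArr a (s.reg i) (s.reg j))
  | flip (s : State) (i : ℕ) : Exec (.flip i) s 1 (s.dropCoin.setReg i (s.coins 0).toNat)
  | seq {p q : Prog} {s s₁ s₂ : State} {t₁ t₂ : ℕ} (hp : Exec p s t₁ s₁)
      (hq : Exec q s₁ t₂ s₂) : Exec (.seq p q) s (t₁ + t₂) s₂
  | ite_true {i : ℕ} {p q : Prog} {s s₁ : State} {t : ℕ} (hi : s.reg i ≠ 0)
      (hp : Exec p s t s₁) : Exec (.ite i p q) s (1 + t) s₁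
  | ite_false {i : ℕ} {p q : Prog} {s s₁ : State} {t : ℕ} (hi : s.reg i = 0)
      (hq : Exec q s t s₁) : Exec (.ite i p q) s (1 + t) s₁
  | loop_done {i : ℕ} {p : Prog} {s : State} (hi : s.reg i = 0) : Exec (.loop i p) s 1 s
  | loop_step {i : ℕ} {p : Prog} {s s₁ s₂ : State} {t₁ t₂ : ℕ} (hi : s.reg i ≠ 0)
      (hp : Exec p s t₁ s₁) (hl : Exec (.loop i p) s₁ t₂ s₂) :
      Exec (.loop i p) s (1 + t₁ + t₂) s₂

open Classical in
/-- The initial state on input `G`: `r_0` holds the number `n` of vertices, `A_0` holds the adjacency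
matrix of `G` row by row, everything else is `0`, and `ω` is the sequence of random bits. -/
noncomputable def initState {n : ℕ} (G : SimpleGraph (Fin n)) (ω : ℕ → Bool) : State where
  reg := fun r => if r = 0 then n else 0
  arr := fun a p => if a = 0 ∧ ∃ i j : Fin n, G.Adj i j ∧ p = i * n + j then 1 else 0
  coins := ω

/-- The set of vertices that a final state represents: those `v` with `A_1[v] = 1`. -/
def State.output (s : State) (n : ℕ) : Finset (Fin n) :=
  Finset.univ.filter fun v : Fin n => s.arr 1 v = 1

/-- The number of steps after which `p` halts, started in state `s`; `∞` if it does not halt. -/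
noncomputable def runTime (p : Prog) (s : State) : ℝ≥0∞ :=
  ⨅ (t : ℕ) (_ : ∃ s', Exec p s t s'), (t : ℝ≥0∞)

/-- The law of a sequence of independent fair random bits. -/
noncomputable def coinLaw : MeasureTheory.Measure (ℕ → Bool) :=
  MeasureTheory.Measure.infinitePi fun _ : ℕ => (PMF.uniformOfFintype Bool).toMeasure

/-- The expected running time of `p` on input `G`. -/
noncomputable def expectedTime (p : Prog) {n : ℕ} (G : SimpleGraph (Fin n)) : ℝ≥0∞ :=
  ∫⁻ ω, runTime p (initState G ω) ∂coinLaw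

end Machine

end IndepRelax

/-! A single greedy clique partition bounds the relaxations from above and points to a large
independent set. Let D be the maximum of 16 and the maximum degree, l = ⌊log₂ D⌋ + 1 and K = ⌊log₂
l⌋. Remove disjoint cliques of size 2^(K-1), then of size 2^(K-2), and so on down to single
vertices, each time until none of that size is left. This splits the vertices into K layers; let b
be the largest number of cliques in a layer. Each of these cliques carries weight at most 1, so the
value is at most K b. The inequalities used concern cliques with at most log d vertices, and level t
of Sherali-Adams implies them up to size t + 1 (`SAFeasible.sum_clique_le`). For d < 16 they may be
unavailable, and x_v ≤ 1 replaces them. It remains to find an independent set with at least l b /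
(1024 D K) vertices.

Let U be a layer with b cliques, of size r. Either 4 r ≥ l, or U has no clique of size 2 r, since it
was left over from the previous round. A Shearer-type argument shows that U has large independent
sets. Fix a random independent set W of U outside the closed neighbourhood of v. Inside, either v is
chosen or an independent set of free neighbours. If these sets are few, v is likely; if they are
many, a Ramsey bound makes a typical one large. So D [v ∈ W] + |N(v) ∩ W| has average of order at
least l / (r K) (`free_block_average`). The sum of these counts over v is at most 2 D |W|, so a
uniform W has expected size of order at least |U| l / (D r K) = b l / (D K).

Sampling W uniformly is not necessary. Run Glauber dynamics from the empty set and stop at the first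
large set. Weighted by f² instead of uniformly, the local inequality still holds up to an error paid
by the Dirichlet form, because a function of low energy is almost constant on each local block. This
yields a gap of order 2^(-O(D)) for functions that vanish on large sets (`nsq_le_energy`). The chain
killed at large sets therefore dies out geometrically (`sum_survival_le`), although nothing is
claimed about mixing of the full chain.

A random access machine finds the layers by enumerating codes of subsets of neighbourhoods, which
costs 2^D per vertex, and then runs the chain. Every output carries its clique cover as a
certificate (`certify_spec`). Finite expected time forces some run to halt, so the two integrality
gaps follow from the algorithm as well. -/

namespace IndepRelax

/-! ### Ramsey bounds and the average size of independent sets among free neighbours -/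

section Counting

variable {V : Type*} [DecidableEq V]

open Classical in
/-- The independent sets of `G` that are contained in `U`. -/
noncomputable def indepIn (G : SimpleGraph V) (U : Finset V) : Finset (Finset V) :=
  U.powerset.filter fun S => G.IsIndepSet (S : Set V)

theorem mem_indepIn {G : SimpleGraph V} {U S : Finset V} :
    S ∈ indepIn G U ↔ S ⊆ U ∧ G.IsIndepSet (S : Set V) := by
  simp [indepIn]

theorem empty_mem_indepIn (G : SimpleGraph V) (U : Finset V) : ∅ ∈ indepIn G U := by
  simp [mem_indepIn, SimpleGraph.IsIndepSet]

theorem mem_indepIn_of_subset {G : SimpleGraph V} {U S T : Finset V} (hS : S ∈ indepIn G U)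
    (hT : T ⊆ S) : T ∈ indepIn G U := by
  rw [mem_indepIn] at *
  exact ⟨hT.trans hS.1, hS.2.mono (by exact_mod_cast hT)⟩

/-- A Ramsey bound: a graph without cliques of size `q + 1` and without independent sets of size
greater than `a` has fewer than `(a + 1) ^ q` vertices. -/
theorem card_lt_of_cliqueFreeOn (G : SimpleGraph V) (a : ℕ) (q : ℕ) (J : Finset V)
    (hJ : G.CliqueFreeOn J (q + 1)) (ha : ∀ S ∈ indepIn G J, S.card ≤ a) :
    J.card + 1 ≤ (a + 1) ^ q := by
  classical
  induction q generalizing J with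
  | zero =>
    have : J = ∅ := by
      by_contra h
      obtain ⟨v, hv⟩ := Finset.nonempty_iff_ne_empty.2 h
      exact hJ (t := {v}) (by simpa using hv) (by simp [SimpleGraph.isNClique_iff])
    simp [this]
  | succ q ih =>
    -- A maximum independent set dominates J, so at most a closed neighbourhoods cover J. Each open
    -- neighbourhood has smaller clique number; the `+ 1` in the bound pays for its centre.
    obtain ⟨S, hS, hmax⟩ := (indepIn G J).exists_max_image Finset.card
      ⟨∅, empty_mem_indepIn G J⟩
    have hSJ := mem_indepIn.1 hS
    have hcov : J ⊆ S.biUnion fun v => insert v (J.filter (G.Adj v)) := by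
      intro w hw
      by_contra hcon
      simp only [Finset.mem_biUnion, Finset.mem_insert, Finset.mem_filter, not_exists, not_and,
        not_or] at hcon
      have hwS : w ∉ S := fun h => (hcon w h).1 rfl
      have hins : insert w S ∈ indepIn G J := by
        rw [mem_indepIn]
        refine ⟨Finset.insert_subset hw hSJ.1, ?_⟩
        intro x hx y hy hxy
        simp only [Finset.coe_insert, Set.mem_insert_iff, Finset.mem_coe] at hx hy
        rcases hx with rfl | hx <;> rcases hy with rfl | hy
        · exact absurd rfl hxy
        · exact fun h => (hcon y hy).2 hw h.symm
        · exact fun h => (hcon x hx).2 hw h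
        · exact hSJ.2 hx hy hxy
      have := hmax _ hins
      rw [Finset.card_insert_of_notMem hwS] at this
      omega
    have hnb : ∀ v ∈ S, (insert v (J.filter (G.Adj v))).card ≤ (a + 1) ^ q := by
      intro v hv
      have h1 : (J.filter (G.Adj v)).card + 1 ≤ (a + 1) ^ q := by
        apply ih
        · intro t ht hcl
          refine hJ (t := insert v t) ?_ (hcl.insert ?_)
          · intro x hx
            simp only [Finset.coe_insert, Set.mem_insert_iff, Finset.mem_coe] at hx
            rcases hx with rfl | hx
            · exact hSJ.1 hv
            · exact (Finset.mem_filter.1 (by exact_mod_cast ht hx)).1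
          · intro b hb
            exact (Finset.mem_filter.1 (by exact_mod_cast ht hb)).2
        · intro T hT
          apply ha
          rw [mem_indepIn] at *
          exact ⟨hT.1.trans (Finset.filter_subset _ _), hT.2⟩
      exact (Finset.card_insert_le _ _).trans h1
    have h2 : J.card ≤ S.card * (a + 1) ^ q :=
      (Finset.card_le_card hcov).trans (Finset.card_biUnion_le_card_mul _ _ _ hnb)
    have h3 : S.card * (a + 1) ^ q ≤ a * (a + 1) ^ q := Nat.mul_le_mul_right _ (ha S hS)
    have h4 : 1 ≤ (a + 1) ^ q := Nat.one_le_pow _ _ (by omega)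
    calc J.card + 1 ≤ a * (a + 1) ^ q + (a + 1) ^ q := by omega
      _ = (a + 1) ^ (q + 1) := by ring

theorem card_small_subsets_le (J : Finset V) (s : ℕ) :
    (J.powerset.filter fun S => S.card ≤ s).card ≤ (J.card + 1) ^ s := by
  induction s with
  | zero =>
    have : (J.powerset.filter fun S => S.card ≤ 0) ⊆ {∅} := by
      intro S; simp
    simpa using Finset.card_le_card this
  | succ s ih =>
    have h1 : (J.powerset.filter fun S => S.card ≤ s + 1) ⊆
        (J.powerset.filter fun S => S.card ≤ s) ∪ J.powersetCard (s + 1) := by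
      intro S
      simp only [Finset.mem_filter, Finset.mem_powerset, Finset.mem_union, Finset.mem_powersetCard]
      intro h
      rcases Nat.lt_or_ge s S.card with h' | h'
      · exact Or.inr ⟨h.1, by omega⟩
      · exact Or.inl ⟨h.1, h'⟩
    have h2 := (Finset.card_le_card h1).trans (Finset.card_union_le _ _)
    rw [Finset.card_powersetCard] at h2
    have h3 : J.card.choose (s + 1) ≤ J.card ^ (s + 1) := Nat.choose_le_pow _ _
    have h4 : J.card ^ (s + 1) ≤ J.card * (J.card + 1) ^ s := by
      rw [pow_succ, mul_comm]
      exact Nat.mul_le_mul_left _ (Nat.pow_le_pow_left (by omega) _)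
    calc _ ≤ (J.card + 1) ^ s + J.card * (J.card + 1) ^ s := by omega
      _ = _ := by ring

/-- Only the empty set contributes nothing to the sum. -/
theorem card_le_sum_card_add_one (F : Finset (Finset V)) :
    F.card ≤ ∑ S ∈ F, S.card + 1 := by
  have h : ∀ S ∈ F.erase ∅, 1 ≤ S.card := fun S hS =>
    Finset.card_pos.2 (Finset.nonempty_iff_ne_empty.2 (Finset.mem_erase.1 hS).1)
  have h1 : (F.erase ∅).card • 1 ≤ ∑ S ∈ F.erase ∅, S.card := Finset.card_nsmul_le_sum _ _ _ h
  have h2 : ∑ S ∈ F.erase ∅, S.card ≤ ∑ S ∈ F, S.card :=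
    Finset.sum_le_sum_of_subset (Finset.erase_subset _ _)
  have h3 := Finset.pred_card_le_card_erase (s := F) (a := ∅)
  simp only [smul_eq_mul, mul_one] at h1
  omega

/-- A family with many members has members of large average size. -/
theorem mul_card_le_sum_card {J : Finset V} {F : Finset (Finset V)} (hF : F ⊆ J.powerset) (s : ℕ)
    (hs : 2 * (J.card + 1) ^ s ≤ F.card) : s * F.card ≤ 2 * ∑ S ∈ F, S.card := by
  have h1 : (F.filter fun S => S.card ≤ s).card ≤ (J.card + 1) ^ s :=
    (Finset.card_le_card (Finset.filter_subset_filter _ hF)).trans (card_small_subsets_le J s)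
  have h2 := Finset.card_filter_add_card_filter_not (s := F) (fun S => S.card ≤ s)
  have h3 : (F.filter fun S => ¬ S.card ≤ s).card * s ≤
      ∑ S ∈ F.filter fun S => ¬ S.card ≤ s, S.card := by
    apply Finset.card_nsmul_le_sum
    intro S hS
    have := (Finset.mem_filter.1 hS).2
    omega
  have h4 : ∑ S ∈ F.filter (fun S => ¬ S.card ≤ s), S.card ≤ ∑ S ∈ F, S.card :=
    Finset.sum_le_sum_of_subset (Finset.filter_subset _ _)
  have h5 : F.card ≤ 2 * (F.filter fun S => ¬ S.card ≤ s).card := by omega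
  calc s * F.card ≤ s * (2 * (F.filter fun S => ¬ S.card ≤ s).card) := Nat.mul_le_mul_left _ h5
    _ = 2 * ((F.filter fun S => ¬ S.card ≤ s).card * s) := by ring
    _ ≤ _ := by omega

/-- There are at most 2^(b s) subsets of J of size at most s. A family of 2^L sets must therefore
have typical size about L / b. -/
theorem log_mul_le_sum_card {J : Finset V} {F : Finset (Finset V)} (hF : F ⊆ J.powerset)
    {D b L : ℕ} (hD : 2 ≤ D) (hb : 0 < b) (hJ : J.card + 1 ≤ 2 ^ b) (hL : 2 ^ L ≤ F.card) :
    L * (1 + F.card) ≤ 5 * b * (D + ∑ S ∈ F, S.card) := by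
  have h0 := card_le_sum_card_add_one F
  have hF1 : 1 ≤ F.card := le_trans Nat.one_le_two_pow hL
  rcases Nat.eq_zero_or_pos L with rfl | hLp
  · simp
  -- The largest s with 2 * 2^(b s) ≤ 2^L, so that at most half of F consists of sets of size at
  -- most s.
  set s := (L - 1) / b with hs
  have h1 : b * s ≤ L - 1 := Nat.mul_div_le _ _
  have h2 : L - 1 < b * (s + 1) := by
    rw [hs]; exact Nat.lt_mul_div_succ _ hb
  have h3 : 2 * (J.card + 1) ^ s ≤ F.card := by
    calc 2 * (J.card + 1) ^ s ≤ 2 * (2 ^ b) ^ s :=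
          Nat.mul_le_mul_left _ (Nat.pow_le_pow_left hJ _)
      _ = 2 ^ (b * s + 1) := by rw [← pow_mul, pow_succ, mul_comm]
      _ ≤ 2 ^ L := Nat.pow_le_pow_right (by norm_num) (by omega)
      _ ≤ _ := hL
  have h4 := mul_card_le_sum_card hF s h3
  have h5 : (s + 1) * (1 + F.card) ≤ 5 * (D + ∑ S ∈ F, S.card) := by nlinarith
  calc L * (1 + F.card) ≤ (b * (s + 1)) * (1 + F.card) := Nat.mul_le_mul_right _ (by omega)
    _ = b * ((s + 1) * (1 + F.card)) := by ring
    _ ≤ b * (5 * (D + ∑ S ∈ F, S.card)) := Nat.mul_le_mul_left _ h5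
    _ = _ := by ring

/-- If `J` is the set of free neighbours of a vertex `v`, the left side compares the uniform average
of `D * [v ∈ W] + |N(v) ∩ W|` over the possible states near `v` with `log D / (r * log log D)`. -/
theorem free_block_average {G : SimpleGraph V} {J : Finset V} {D l K r : ℕ} (hD : 16 ≤ D)
    (hJD : J.card ≤ D) (hl : l = Nat.log 2 D + 1) (hK : K = Nat.log 2 l) (hr : 0 < r)
    (h : l ≤ 4 * r ∨ G.CliqueFreeOn J (2 * r)) :
    l * (1 + (indepIn G J).card) ≤ 64 * r * K * (D + ∑ S ∈ indepIn G J, S.card) := by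
  set F := indepIn G J with hFdef
  have hF : F ⊆ J.powerset := fun S hS => Finset.mem_powerset.2 (mem_indepIn.1 hS).1
  have hl5 : 5 ≤ l := by
    have := Nat.log_mono_right (b := 2) hD
    have h16 : Nat.log 2 16 = 4 := by decide
    omega
  have hK2 : 2 ≤ K := by
    have := Nat.log_mono_right (b := 2) hl5
    have h5 : Nat.log 2 5 = 2 := by decide
    omega
  have h0 := card_le_sum_card_add_one F
  have hF1 : 1 ≤ F.card := Finset.card_pos.2 ⟨∅, empty_mem_indepIn G J⟩
  have hDl : D < 2 ^ l := by rw [hl]; exact Nat.lt_pow_succ_log_self (by norm_num) _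
  have hlK : l < 2 ^ (K + 1) := by rw [hK]; exact Nat.lt_pow_succ_log_self (by norm_num) _
  have hDl' : 2 ^ (l - 1) ≤ D := by
    rw [hl]; exact Nat.pow_log_le_self 2 (by omega)
  have hrK : 1 ≤ r * K := Nat.mul_pos hr (by omega)
  have key : ∀ c, c ≤ 64 * r * K → l * (1 + F.card) ≤ c * (D + ∑ S ∈ F, S.card) →
      l * (1 + F.card) ≤ 64 * r * K * (D + ∑ S ∈ F, S.card) := fun c hc h =>
    h.trans (Nat.mul_le_mul_right _ hc)
  have h1 : 1 + F.card ≤ D + ∑ S ∈ F, S.card := by omega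
  -- If l ≤ 4 r, the factor 64 r K already exceeds l and the trivial count `h1` suffices. Otherwise
  -- the size of F decides.
  rcases h with h | h
  · exact key l (by nlinarith) (Nat.mul_le_mul_left _ h1)
  set L := Nat.log 2 F.card with hL
  have hL1 : 2 ^ L ≤ F.card := Nat.pow_log_le_self 2 (by omega)
  have hL2 : F.card < 2 ^ (L + 1) := Nat.lt_pow_succ_log_self (by norm_num) _
  -- Here |F| is of order at most √D, so the term D, which stands for the state containing v,
  -- suffices alone.
  rcases Nat.lt_or_ge (2 * L) l with hc | hc
  · refine key 6 (by nlinarith) ?_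
    have e1 : l - 1 - L < 2 ^ (l - 1 - L) := Nat.lt_two_pow_self
    have e2 : l ≤ 3 * 2 ^ (l - 1 - L) := by omega
    calc l * (1 + F.card) ≤ (3 * 2 ^ (l - 1 - L)) * 2 ^ (L + 1) := Nat.mul_le_mul e2 (by omega)
      _ = 6 * 2 ^ ((l - 1 - L) + L) := by rw [pow_succ, pow_add]; ring
      _ = 6 * 2 ^ (l - 1) := by congr 2; omega
      _ ≤ 6 * (D + ∑ S ∈ F, S.card) := by omega
  -- In the middle range no independent set exceeds L, since all its subsets lie in F. The Ramsey
  -- bound then makes log |J| of order at most r log L, hence r K.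
  rcases Nat.lt_or_ge L (l * l) with hc2 | hc2
  · have ha : ∀ S ∈ F, S.card ≤ L := by
      intro S hS
      have : S.powerset ⊆ F := fun T hT => mem_indepIn_of_subset hS (Finset.mem_powerset.1 hT)
      have := Finset.card_le_card this
      rw [Finset.card_powerset] at this
      exact Nat.le_log_of_pow_le (by norm_num) this
    have hm := card_lt_of_cliqueFreeOn G L (2 * r - 1) J
      (by rwa [Nat.sub_add_cancel (by omega)]) ha
    have hL3 : L + 1 ≤ 2 ^ (2 * K + 2) := by
      calc L + 1 ≤ l * l := hc2
        _ ≤ 2 ^ (K + 1) * 2 ^ (K + 1) := Nat.mul_le_mul hlK.le hlK.le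
        _ = _ := by rw [← pow_add]; congr 1; ring
    have hm2 : J.card + 1 ≤ 2 ^ ((2 * K + 2) * (2 * r)) := by
      refine hm.trans ((Nat.pow_le_pow_left hL3 _).trans ?_)
      rw [← pow_mul]
      exact Nat.pow_le_pow_right (by norm_num) (Nat.mul_le_mul_left _ (by omega))
    have h5 := log_mul_le_sum_card hF (D := D) (by omega) (by positivity) hm2 hL1
    refine key (10 * ((2 * K + 2) * (2 * r))) ?_ ?_
    · have : 2 * K + 2 ≤ 3 * K := by omega
      nlinarith
    · calc l * (1 + F.card) ≤ (2 * L) * (1 + F.card) := Nat.mul_le_mul_right _ hc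
        _ = 2 * (L * (1 + F.card)) := by ring
        _ ≤ 2 * (5 * ((2 * K + 2) * (2 * r)) * (D + ∑ S ∈ F, S.card)) :=
          Nat.mul_le_mul_left _ h5
        _ = _ := by ring
  -- When L ≥ l², the crude bound |J| + 1 ≤ 2^l loses only a factor l, and L has it to spare.
  · have h5 := log_mul_le_sum_card hF (D := D) (b := l) (by omega) (by omega) (by omega) hL1
    refine key 5 (by nlinarith) ?_
    have : l * (l * (1 + F.card)) ≤ l * (5 * (D + ∑ S ∈ F, S.card)) := by
      calc l * (l * (1 + F.card)) = (l * l) * (1 + F.card) := by ring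
        _ ≤ L * (1 + F.card) := Nat.mul_le_mul_right _ hc2
        _ ≤ _ := h5
        _ = _ := by ring
    exact Nat.le_of_mul_le_mul_left this (by omega)

end Counting

end IndepRelax

namespace IndepRelax

/-! ### Heat-bath updates as projections, and systematic scans -/

section Glauber

variable {V : Type*} [DecidableEq V]

/-- The squared `ℓ²` norm of `f` on the family `F`. -/
def nsq (F : Finset (Finset V)) (f : Finset V → ℝ) : ℝ := ∑ W ∈ F, f W ^ 2

/-- The part of the Dirichlet form that belongs to the vertex `v`. -/
def flipEnergy (F : Finset (Finset V)) (v : V) (f : Finset V → ℝ) : ℝ :=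
  ∑ W ∈ F with v ∈ W, (f W - f (W.erase v)) ^ 2

/-- The heat-bath update of a Glauber dynamics on `F` at the vertex `v`, acting on functions. -/
noncomputable def heatBath (F : Finset (Finset V)) (v : V) (f : Finset V → ℝ) (W : Finset V) : ℝ :=
  (f (W.erase v) + f (if insert v W ∈ F then insert v W else W.erase v)) / 2

/-- The heat-bath updates at the vertices of a list, one after the other. -/
noncomputable def scan (F : Finset (Finset V)) (l : List V) (f : Finset V → ℝ) : Finset V → ℝ :=
  l.foldr (heatBath F) f

theorem nsq_nonneg (F : Finset (Finset V)) (f : Finset V → ℝ) : 0 ≤ nsq F f :=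
  Finset.sum_nonneg fun _ _ => sq_nonneg _

theorem flipEnergy_nonneg (F : Finset (Finset V)) (v : V) (f : Finset V → ℝ) :
    0 ≤ flipEnergy F v f :=
  Finset.sum_nonneg fun _ _ => sq_nonneg _

variable {F : Finset (Finset V)}

/-- Erasing v is a bijection from the sets containing v to the sets to which v can be added. The
sets blocked at v are left over, and the update at v fixes them. -/
theorem sum_eq_sum_pairs (hF : ∀ W ∈ F, ∀ v, W.erase v ∈ F)
    (v : V) (g : Finset V → ℝ) :
    ∑ W ∈ F, g W = ∑ W ∈ F with v ∈ W, (g W + g (W.erase v)) +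
      ∑ W ∈ F with v ∉ W ∧ insert v W ∉ F, g W := by
  have h1 : ∑ W ∈ F with v ∈ W, g (W.erase v) =
      ∑ W ∈ F with v ∉ W ∧ insert v W ∈ F, g W := by
    refine Finset.sum_nbij' (fun W => W.erase v) (fun W => insert v W) ?_ ?_ ?_ ?_ ?_
    · intro W hW
      have := Finset.mem_filter.1 hW
      simp [hF W this.1 v, Finset.insert_erase this.2, this.1]
    · intro W hW
      have := Finset.mem_filter.1 hW
      simp [this.2.2]
    · intro W hW
      exact Finset.insert_erase (Finset.mem_filter.1 hW).2
    · intro W hW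
      exact Finset.erase_insert (Finset.mem_filter.1 hW).2.1
    · intro W hW; rfl
  rw [Finset.sum_add_distrib, h1, ← Finset.sum_filter_add_sum_filter_not F (fun W => v ∈ W) g,
    ← Finset.sum_filter_add_sum_filter_not (F.filter fun W => v ∉ W) (fun W => insert v W ∈ F) g,
    Finset.filter_filter, Finset.filter_filter]
  ring

theorem sum_heatBath_sub (hF : ∀ W ∈ F, ∀ v, W.erase v ∈ F)
    (v : V) (f : Finset V → ℝ) :
    nsq F (fun W => f W - heatBath F v f W) = flipEnergy F v f / 2 := by
  have h0 : ∑ W ∈ F with v ∉ W ∧ insert v W ∉ F, (f W - heatBath F v f W) ^ 2 = 0 := by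
    apply Finset.sum_eq_zero
    intro W hW
    have := (Finset.mem_filter.1 hW).2
    simp [heatBath, this.2, Finset.erase_eq_of_notMem this.1]
  rw [nsq, sum_eq_sum_pairs hF v, h0, add_zero, flipEnergy, Finset.sum_div]
  refine Finset.sum_congr rfl fun W hW => ?_
  have := Finset.mem_filter.1 hW
  simp only [heatBath, Finset.insert_eq_of_mem this.2, this.1, if_true, Finset.erase_idem,
    Finset.insert_erase this.2]
  ring

/-- Pythagoras: the update averages f over each pair {W, W \ v} and is thus an orthogonal projection
for the counting measure on F. -/
theorem nsq_sub_nsq_heatBath (hF : ∀ W ∈ F, ∀ v, W.erase v ∈ F)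
    (v : V) (f : Finset V → ℝ) :
    nsq F f - nsq F (heatBath F v f) = nsq F (fun W => f W - heatBath F v f W) := by
  rw [sum_heatBath_sub hF]
  have h0 : ∑ W ∈ F with v ∉ W ∧ insert v W ∉ F, heatBath F v f W ^ 2 =
      ∑ W ∈ F with v ∉ W ∧ insert v W ∉ F, f W ^ 2 := by
    refine Finset.sum_congr rfl fun W hW => ?_
    have := (Finset.mem_filter.1 hW).2
    simp [heatBath, this.2, Finset.erase_eq_of_notMem this.1]
  rw [nsq, nsq, sum_eq_sum_pairs hF v, sum_eq_sum_pairs hF v (fun W => heatBath F v f W ^ 2), h0,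
    add_sub_add_right_eq_sub, ← Finset.sum_sub_distrib, flipEnergy, Finset.sum_div]
  refine Finset.sum_congr rfl fun W hW => ?_
  have := Finset.mem_filter.1 hW
  simp only [heatBath, Finset.insert_eq_of_mem this.2, this.1, if_true, Finset.erase_idem,
    Finset.insert_erase this.2]
  ring

theorem flipEnergy_le_nsq (hF : ∀ W ∈ F, ∀ v, W.erase v ∈ F)
    (v : V) (f : Finset V → ℝ) : flipEnergy F v f ≤ 2 * nsq F f := by
  have h0 : 0 ≤ ∑ W ∈ F with v ∉ W ∧ insert v W ∉ F, f W ^ 2 :=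
    Finset.sum_nonneg fun _ _ => sq_nonneg _
  have h1 : flipEnergy F v f ≤ 2 * ∑ W ∈ F with v ∈ W, (f W ^ 2 + f (W.erase v) ^ 2) := by
    rw [flipEnergy, Finset.mul_sum]
    exact Finset.sum_le_sum fun W _ => by nlinarith [sq_nonneg (f W + f (W.erase v))]
  rw [nsq, sum_eq_sum_pairs hF v]
  linarith

theorem flipEnergy_le_add (v : V) (f g : Finset V → ℝ) :
    flipEnergy F v f ≤ 2 * flipEnergy F v g + 2 * flipEnergy F v fun W => f W - g W := by
  simp only [flipEnergy]
  rw [Finset.mul_sum, Finset.mul_sum, ← Finset.sum_add_distrib]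
  exact Finset.sum_le_sum fun W _ => by
    nlinarith [sq_nonneg (g W - g (W.erase v) - (f W - g W - (f (W.erase v) - g (W.erase v))))]

/-- The induction step of Cauchy-Schwarz for a telescoping sum: k increments with total square A and
one more with square B. For k = 0 the hypothesis forces f = g on F. -/
theorem nsq_sub_le {k : ℕ} {f g h : Finset V → ℝ} {A B : ℝ}
    (hx : nsq F (fun W => f W - g W) ≤ k * A) (hA : 0 ≤ A)
    (hy : nsq F (fun W => g W - h W) ≤ B) :
    nsq F (fun W => f W - h W) ≤ (k + 1) * (A + B) := by
  have hB : 0 ≤ B := (nsq_nonneg _ _).trans hy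
  rcases Nat.eq_zero_or_pos k with rfl | hk
  · have h0 : nsq F (fun W => f W - g W) = 0 := le_antisymm (by simpa using hx) (nsq_nonneg _ _)
    have h1 : nsq F (fun W => f W - h W) = nsq F (fun W => g W - h W) := by
      refine Finset.sum_congr rfl fun W hW => ?_
      have := (Finset.sum_eq_zero_iff_of_nonneg fun _ _ => sq_nonneg _).1 h0 W hW
      have : f W - g W = 0 := pow_eq_zero_iff (two_ne_zero) |>.1 this
      simp only [show f W - h W = g W - h W by linarith]
    rw [h1]; push_cast; linarith
  · have hk' : (0 : ℝ) < k := by exact_mod_cast hk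
    have h1 : nsq F (fun W => f W - h W) ≤
        (k + 1) * (nsq F (fun W => f W - g W) / k + nsq F (fun W => g W - h W)) := by
      simp only [nsq]
      rw [Finset.sum_div, ← Finset.sum_add_distrib, Finset.mul_sum]
      refine Finset.sum_le_sum fun W _ => ?_
      rw [div_add' _ _ _ hk'.ne', mul_div_assoc', le_div_iff₀ hk']
      nlinarith [sq_nonneg ((f W - g W) - k * (g W - h W))]
    refine h1.trans (mul_le_mul_of_nonneg_left ?_ (by positivity))
    have : nsq F (fun W => f W - g W) / k ≤ A := by
      rw [div_le_iff₀ hk']; linarith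
    linarith

/-- The loss of norm in a scan is the sum of the squared increments of its projections. If it is
small, f moves little throughout the scan, so the flip energy at v of f is close to that of the
intermediate function on which v acts. That one equals twice the loss at this step. -/
theorem scan_estimates (hF : ∀ W ∈ F, ∀ v, W.erase v ∈ F)
    (l : List V) (f : Finset V → ℝ) :
    nsq F (scan F l f) ≤ nsq F f ∧
    nsq F (fun W => f W - scan F l f W) ≤ l.length * (nsq F f - nsq F (scan F l f)) ∧
    ∀ v ∈ l, flipEnergy F v f ≤ 4 * l.length * (nsq F f - nsq F (scan F l f)) := by
  induction l with
  | nil => simp [scan, nsq]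
  | cons v l ih =>
    obtain ⟨h1, h2, h3⟩ := ih
    set h := scan F l f with hdef
    have hs : scan F (v :: l) f = heatBath F v h := rfl
    have e1 := nsq_sub_nsq_heatBath hF v h
    have e2 := sum_heatBath_sub hF v h
    have e3 := nsq_nonneg F (fun W => h W - heatBath F v h W)
    have e4 : (0 : ℝ) ≤ l.length := by positivity
    rw [hs]
    have e5 := nsq_sub_le (A := nsq F f - nsq F h) h2 (by linarith) (le_of_eq e1.symm)
    refine ⟨by linarith, ?_, ?_⟩
    · rw [List.length_cons]; push_cast; linarith
    · intro w hw
      rw [List.length_cons]; push_cast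
      rcases List.mem_cons.1 hw with rfl | hw
      · have e6 := flipEnergy_le_add (F := F) w f h
        have e7 := flipEnergy_le_nsq hF w (fun W => f W - h W)
        nlinarith
      · have := h3 w hw
        nlinarith

end Glauber

/-! ### Local blocks around a vertex and the restricted spectral gap -/

section Blocks

/-- If f were the constant g, the average of X f² would be at least a g². Replacing f² by g² and
back costs constant factors and the error e. -/
theorem weighted_sum_sq_ge {β : Type*} (B : Finset β) (f X : β → ℝ) {g e M a : ℝ} (ha : 0 ≤ a)
    (hX : ∀ W ∈ B, 0 ≤ X W) (hM : ∀ W ∈ B, X W ≤ M) (he : ∀ W ∈ B, (f W - g) ^ 2 ≤ e)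
    (he0 : 0 ≤ e) (hav : a * B.card ≤ ∑ W ∈ B, X W) :
    a / 4 * ∑ W ∈ B, f W ^ 2 ≤ ∑ W ∈ B, X W * f W ^ 2 + 2 * e * (M * B.card) := by
  have h1 : (∑ W ∈ B, X W) * (g ^ 2 / 2 - e) ≤ ∑ W ∈ B, X W * f W ^ 2 := by
    rw [Finset.sum_mul]
    refine Finset.sum_le_sum fun W hW => mul_le_mul_of_nonneg_left ?_ (hX W hW)
    nlinarith [he W hW, sq_nonneg (2 * f W - g)]
  have h2 : ∑ W ∈ B, f W ^ 2 ≤ B.card * (2 * g ^ 2 + 2 * e) := by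
    rw [← nsmul_eq_mul]
    refine Finset.sum_le_card_nsmul _ _ _ fun W hW => ?_
    nlinarith [he W hW, sq_nonneg (f W - 2 * g)]
  have h3 : ∑ W ∈ B, X W ≤ M * B.card := by
    rw [mul_comm, ← nsmul_eq_mul]
    exact Finset.sum_le_card_nsmul _ _ _ hM
  have h4 : a / 4 * ∑ W ∈ B, f W ^ 2 ≤ a / 4 * (B.card * (2 * g ^ 2 + 2 * e)) :=
    mul_le_mul_of_nonneg_left h2 (by positivity)
  have h5 : a * B.card * ((g ^ 2 + e) / 2) ≤ (∑ W ∈ B, X W) * ((g ^ 2 + e) / 2) :=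
    mul_le_mul_of_nonneg_right hav (by positivity)
  have h6 : (∑ W ∈ B, X W) * e ≤ M * B.card * e := mul_le_mul_of_nonneg_right h3 he0
  have h7 : 0 ≤ ∑ W ∈ B, X W := Finset.sum_nonneg hX
  nlinarith [mul_nonneg h7 he0]

variable {V : Type*} [Fintype V] [DecidableEq V]

open Classical in
/-- The neighbours of `v`. -/
noncomputable def nbrs (G : SimpleGraph V) (v : V) : Finset V := Finset.univ.filter (G.Adj v)

theorem mem_nbrs {G : SimpleGraph V} {v w : V} : w ∈ nbrs G v ↔ G.Adj v w := by
  simp [nbrs]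

/-- The independent sets in `U` that agree with `W₀` outside the closed neighbourhood of `v`. -/
noncomputable def block (G : SimpleGraph V) (U : Finset V) (v : V) (W₀ : Finset V) :
    Finset (Finset V) :=
  (indepIn G U).filter fun W => W \ insert v (nbrs G v) = W₀

open Classical in
/-- The neighbours of `v` in `U` that have no neighbour in `W₀`. -/
noncomputable def freeNbrs (G : SimpleGraph V) (U : Finset V) (v : V) (W₀ : Finset V) : Finset V :=
  (nbrs G v).filter fun u => u ∈ U ∧ ∀ w ∈ W₀, ¬ G.Adj u w

/-- Once the set is fixed outside the closed neighbourhood, either v is occupied and all its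
neighbours are empty, or v is empty and any independent set of free neighbours may occur. -/
theorem sum_block {G : SimpleGraph V} {U : Finset V} {v : V} (hv : v ∈ U) {W : Finset V}
    (hW : W ∈ indepIn G U) (g : Finset V → ℝ) :
    ∑ X ∈ block G U v (W \ insert v (nbrs G v)), g X =
      g (insert v (W \ insert v (nbrs G v))) +
      ∑ S ∈ indepIn G (freeNbrs G U v (W \ insert v (nbrs G v))),
        g (S ∪ (W \ insert v (nbrs G v))) := by
  classical
  set W₀ := W \ insert v (nbrs G v) with hW₀
  have hvW₀ : v ∉ W₀ := by simp [hW₀]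
  have hnW₀ : ∀ u ∈ nbrs G v, u ∉ W₀ := by
    intro u hu; simp [hW₀, hu]
  have hW₀F : W₀ ∈ indepIn G U := mem_indepIn_of_subset hW Finset.sdiff_subset
  have hW₀' := mem_indepIn.1 hW₀F
  rw [← Finset.sum_filter_add_sum_filter_not _ (fun X => v ∈ X)]
  congr 1
  · have : (block G U v W₀).filter (fun X => v ∈ X) = {insert v W₀} := by
      ext X
      simp only [block, Finset.mem_filter, Finset.mem_singleton]
      constructor
      · rintro ⟨⟨hX, hXW⟩, hvX⟩
        have hX' := mem_indepIn.1 hX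
        rw [← hXW]
        ext u
        simp only [Finset.mem_insert, Finset.mem_sdiff, not_or]
        constructor
        · intro hu
          by_cases huv : u = v
          · exact Or.inl huv
          · exact Or.inr ⟨hu, huv, fun h => hX'.2 hvX hu (Ne.symm huv) (mem_nbrs.1 h)⟩
        · rintro (rfl | h)
          · exact hvX
          · exact h.1
      · rintro rfl
        refine ⟨⟨?_, ?_⟩, Finset.mem_insert_self _ _⟩
        · rw [mem_indepIn]
          refine ⟨Finset.insert_subset hv hW₀'.1, ?_⟩
          intro x hx y hy hxy
          simp only [Finset.coe_insert, Set.mem_insert_iff, Finset.mem_coe] at hx hy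
          rcases hx with rfl | hx <;> rcases hy with rfl | hy
          · exact absurd rfl hxy
          · exact fun h => hnW₀ y (mem_nbrs.2 h) hy
          · exact fun h => hnW₀ x (mem_nbrs.2 h.symm) hx
          · exact hW₀'.2 hx hy hxy
        · ext u
          simp only [Finset.mem_sdiff, Finset.mem_insert, not_or]
          constructor
          · rintro ⟨rfl | h, h1, h2⟩
            · exact absurd rfl h1
            · exact h
          · intro h
            exact ⟨Or.inr h, fun e => hvW₀ (e ▸ h), fun e => hnW₀ u e h⟩
    rw [this, Finset.sum_singleton]
  · refine Finset.sum_nbij' (fun X => X ∩ nbrs G v) (fun S => S ∪ W₀) ?_ ?_ ?_ ?_ ?_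
    · intro X hX
      simp only [block, Finset.mem_filter] at hX
      obtain ⟨⟨hX, hXW⟩, hvX⟩ := hX
      have hX' := mem_indepIn.1 hX
      rw [mem_indepIn]
      refine ⟨?_, hX'.2.mono (by simp)⟩
      intro u hu
      rw [Finset.mem_inter] at hu
      simp only [freeNbrs, Finset.mem_filter]
      refine ⟨hu.2, hX'.1 hu.1, fun w hw h => ?_⟩
      rw [← hXW, Finset.mem_sdiff] at hw
      exact hX'.2 hu.1 hw.1 h.ne h
    · intro S hS
      have hS' := mem_indepIn.1 hS
      have hSJ : ∀ u ∈ S, u ∈ nbrs G v ∧ u ∈ U ∧ ∀ w ∈ W₀, ¬ G.Adj u w := by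
        intro u hu
        simpa [freeNbrs] using hS'.1 hu
      simp only [block, Finset.mem_filter]
      refine ⟨⟨?_, ?_⟩, ?_⟩
      · rw [mem_indepIn]
        refine ⟨Finset.union_subset (fun u hu => (hSJ u hu).2.1) hW₀'.1, ?_⟩
        intro x hx y hy hxy
        simp only [Finset.coe_union, Set.mem_union, Finset.mem_coe] at hx hy
        rcases hx with hx | hx <;> rcases hy with hy | hy
        · exact hS'.2 hx hy hxy
        · exact (hSJ x hx).2.2 y hy
        · exact fun h => (hSJ y hy).2.2 x hx h.symm
        · exact hW₀'.2 hx hy hxy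
      · ext u
        simp only [Finset.mem_sdiff, Finset.mem_insert, Finset.mem_union, not_or]
        constructor
        · rintro ⟨h | h, h1, h2⟩
          · exact absurd (hSJ u h).1 h2
          · exact h
        · intro h
          exact ⟨Or.inr h, fun e => hvW₀ (e ▸ h), fun e => hnW₀ u e h⟩
      · rw [Finset.mem_union, not_or]
        exact ⟨fun h => (mem_nbrs.1 (hSJ v h).1).ne rfl, hvW₀⟩
    · intro X hX
      simp only [block, Finset.mem_filter] at hX
      obtain ⟨⟨hX, hXW⟩, hvX⟩ := hX
      rw [← hXW]
      ext u
      simp only [Finset.mem_union, Finset.mem_inter, Finset.mem_sdiff, Finset.mem_insert, not_or]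
      constructor
      · rintro (h | h)
        · exact h.1
        · exact h.1
      · intro h
        by_cases hu : u ∈ nbrs G v
        · exact Or.inl ⟨h, hu⟩
        · exact Or.inr ⟨h, fun e => hvX (e ▸ h), hu⟩
    · intro S hS
      have hS' := mem_indepIn.1 hS
      ext u
      simp only [Finset.mem_union, Finset.mem_inter]
      constructor
      · rintro ⟨h | h, h1⟩
        · exact h
        · exact absurd h (hnW₀ u h1)
      · intro h
        have := hS'.1 h
        simp only [freeNbrs, Finset.mem_filter] at this
        exact ⟨Or.inl h, this.1⟩
    · intro X hX
      simp only [block, Finset.mem_filter] at hX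
      obtain ⟨⟨hX, hXW⟩, hvX⟩ := hX
      congr 1
      rw [← hXW]
      ext u
      simp only [Finset.mem_union, Finset.mem_inter, Finset.mem_sdiff, Finset.mem_insert, not_or]
      constructor
      · intro h
        by_cases hu : u ∈ nbrs G v
        · exact Or.inl ⟨h, hu⟩
        · exact Or.inr ⟨h, fun e => hvX (e ▸ h), hu⟩
      · rintro (h | h)
        · exact h.1
        · exact h.1

theorem erase_mem_indepIn {G : SimpleGraph V} {U : Finset V} :
    ∀ W ∈ indepIn G U, ∀ v, W.erase v ∈ indepIn G U :=
  fun _ hW _ => mem_indepIn_of_subset hW (Finset.erase_subset _ _)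

/-- Erase the vertices of T one at a time. The path stays in the block, each move is an edge of the
dynamics, and Cauchy-Schwarz gives the factor |T|. -/
theorem sub_sdiff_sq_le {G : SimpleGraph V} {U : Finset V} {v : V} {W₀ : Finset V}
    (f : Finset V → ℝ) {W : Finset V} (hW : W ∈ block G U v W₀) (T : Finset V)
    (hT : T ⊆ insert v (nbrs G v)) :
    (f W - f (W \ T)) ^ 2 ≤ T.card *
      ∑ u ∈ T, ∑ X ∈ block G U v W₀ with u ∈ X, (f X - f (X.erase u)) ^ 2 := by
  induction T using Finset.induction_on with
  | empty => simp
  | insert u T hu ih =>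
    have ih := ih ((Finset.subset_insert u T).trans hT)
    set A := ∑ u ∈ T, ∑ X ∈ block G U v W₀ with u ∈ X, (f X - f (X.erase u)) ^ 2 with hA
    have hA0 : 0 ≤ A := Finset.sum_nonneg fun _ _ => Finset.sum_nonneg fun _ _ => sq_nonneg _
    have hstep : (f (W \ T) - f (W \ insert u T)) ^ 2 ≤
        ∑ X ∈ block G U v W₀ with u ∈ X, (f X - f (X.erase u)) ^ 2 := by
      have he : W \ insert u T = (W \ T).erase u := by
        ext x; simp only [Finset.mem_sdiff, Finset.mem_insert, Finset.mem_erase]; tauto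
      rw [he]
      by_cases hmem : u ∈ W \ T
      · refine Finset.single_le_sum (f := fun X => (f X - f (X.erase u)) ^ 2)
          (fun _ _ => sq_nonneg _) (Finset.mem_filter.2 ⟨?_, hmem⟩)
        have hW' := Finset.mem_filter.1 hW
        refine Finset.mem_filter.2 ⟨mem_indepIn_of_subset hW'.1 Finset.sdiff_subset, ?_⟩
        rw [← hW'.2]
        ext x
        have := (Finset.subset_insert u T).trans hT
        simp only [Finset.mem_sdiff]
        constructor
        · exact fun h => ⟨h.1.1, h.2⟩
        · exact fun h => ⟨⟨h.1, fun h' => h.2 (this h')⟩, h.2⟩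
      · rw [Finset.erase_eq_of_notMem hmem]
        simpa using Finset.sum_nonneg fun _ _ => sq_nonneg _
    have := nsq_sub_le (F := {W}) (k := T.card) (f := fun _ => f W) (g := fun _ => f (W \ T))
      (h := fun _ => f (W \ insert u T)) (A := A) (by simpa [nsq] using ih) hA0
      (by simpa [nsq] using hstep)
    rw [Finset.card_insert_of_notMem hu, Finset.sum_insert hu]
    push_cast
    simp only [nsq, Finset.sum_singleton] at this
    linarith

/-- The total Dirichlet form of the Glauber dynamics on `F`. -/
noncomputable def energy (F : Finset (Finset V)) (f : Finset V → ℝ) : ℝ :=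
  ∑ v, flipEnergy F v f

/-- The contribution of `v` to the local occupancy count: `D * [v ∈ W] + |N(v) ∩ W|`. -/
noncomputable def localCount (G : SimpleGraph V) (D : ℕ) (v : V) (W : Finset V) : ℝ :=
  (if v ∈ W then (D : ℝ) else 0) + ((nbrs G v ∩ W).card : ℝ)

theorem localCount_nonneg (G : SimpleGraph V) (D : ℕ) (v : V) (W : Finset V) :
    0 ≤ localCount G D v W := by
  unfold localCount; positivity

theorem localCount_le {G : SimpleGraph V} {D : ℕ} {v : V} (hD : (nbrs G v).card ≤ D)
    (W : Finset V) : localCount G D v W ≤ 2 * D := by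
  unfold localCount
  have h1 : ((nbrs G v ∩ W).card : ℝ) ≤ D := by
    exact_mod_cast (Finset.card_le_card Finset.inter_subset_left).trans hD
  split_ifs
  · linarith
  · have : (0 : ℝ) ≤ D := by positivity
    linarith

/-- Double counting: an occupied vertex contributes D at itself and 1 at each of its at most D
neighbours. -/
theorem sum_localCount_le {G : SimpleGraph V} {D : ℕ} (hD : ∀ v, (nbrs G v).card ≤ D)
    (U W : Finset V) : ∑ v ∈ U, localCount G D v W ≤ 2 * D * W.card := by
  have h0 : ∑ v ∈ U, localCount G D v W ≤ ∑ v, localCount G D v W :=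
    Finset.sum_le_sum_of_subset_of_nonneg (Finset.subset_univ _)
      fun _ _ _ => localCount_nonneg _ _ _ _
  refine h0.trans ?_
  simp only [localCount]
  rw [Finset.sum_add_distrib]
  have h1 : ∑ v, (if v ∈ W then (D : ℝ) else 0) = D * W.card := by
    rw [← Finset.sum_filter, Finset.sum_const, nsmul_eq_mul, mul_comm]
    simp
  have h2 : ∑ v, (nbrs G v ∩ W).card = ∑ w ∈ W, (nbrs G w).card := by
    simp only [Finset.card_eq_sum_ones, ← Finset.filter_mem_eq_inter]
    simp only [nbrs, Finset.filter_filter, Finset.sum_filter, ite_and]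
    rw [Finset.sum_comm, ← Finset.sum_subset (Finset.subset_univ W)]
    · refine Finset.sum_congr rfl fun w hw => Finset.sum_congr rfl fun v _ => ?_
      by_cases h : G.Adj v w
      · simp [hw, h, h.symm]
      · have h' : ¬ G.Adj w v := fun h' => h h'.symm
        simp [h, h']
    · intro w _ hw
      simp [hw]
  have h3 : ∑ w ∈ W, (nbrs G w).card ≤ W.card * D := by
    simpa using Finset.sum_le_card_nsmul W _ D fun w _ => hD w
  have h4 : ∑ v, ((nbrs G v ∩ W).card : ℝ) ≤ W.card * D := by
    rw [← Nat.cast_sum, h2]; exact_mod_cast h3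
  rw [h1]; linarith

/-- The blocks of a fixed v partition the independent sets, so no transition is counted twice. -/
theorem sum_fiber_energy_le {G : SimpleGraph V} {U : Finset V} {v : V} (f : Finset V → ℝ) :
    ∑ W₀ ∈ (indepIn G U).image (fun W => W \ insert v (nbrs G v)),
      ∑ u ∈ insert v (nbrs G v), ∑ X ∈ block G U v W₀ with u ∈ X, (f X - f (X.erase u)) ^ 2 ≤
    energy (indepIn G U) f := by
  rw [Finset.sum_comm, energy]
  refine (Finset.sum_le_sum_of_subset_of_nonneg (Finset.subset_univ _) fun u _ _ =>
    Finset.sum_nonneg fun _ _ => Finset.sum_nonneg fun _ _ => sq_nonneg _).trans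
    (Finset.sum_le_sum fun u _ => le_of_eq ?_)
  rw [Finset.sum_congr rfl fun W₀ _ => Finset.sum_filter _ _]
  simp only [flipEnergy, block]
  rw [Finset.sum_fiberwise_of_maps_to (s := indepIn G U) (fun W hW => Finset.mem_image_of_mem _ hW)
    (fun X => if u ∈ X then (f X - f (X.erase u)) ^ 2 else 0), Finset.sum_filter]

/-- Apply `weighted_sum_sq_ge` on every block, with g the value of f at the set emptied near v. The
constants are D + 1 for the length of the path, 2 D for the largest local count and 2^(D+1) for the
size of a block. -/
theorem nsq_le_vertex {G : SimpleGraph V} {U : Finset V} {D : ℕ} {a : ℝ} (ha : 0 ≤ a) {v : V}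
    (hv : v ∈ U) (hD : (nbrs G v).card ≤ D)
    (hav : ∀ J ⊆ U ∩ nbrs G v, a * (1 + (indepIn G J).card) ≤
      D + ∑ S ∈ indepIn G J, (S.card : ℝ)) (f : Finset V → ℝ) :
    a / 4 * nsq (indepIn G U) f ≤ ∑ W ∈ indepIn G U, localCount G D v W * f W ^ 2 +
      2 * (D + 1) * (2 * D * 2 ^ (D + 1)) * energy (indepIn G U) f := by
  classical
  set F := indepIn G U with hFdef
  set π : Finset V → Finset V := fun W => W \ insert v (nbrs G v) with hπ
  have hfib : ∀ g : Finset V → ℝ, ∑ W ∈ F, g W = ∑ W₀ ∈ F.image π, ∑ W ∈ block G U v W₀, g W :=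
    fun g => (Finset.sum_fiberwise_of_maps_to (fun W hW => Finset.mem_image_of_mem _ hW) g).symm
  have hNcard : ((insert v (nbrs G v)).card : ℝ) ≤ D + 1 := by
    have := Finset.card_insert_le v (nbrs G v)
    exact_mod_cast this.trans (by omega)
  set e : Finset V → ℝ := fun W₀ => ∑ u ∈ insert v (nbrs G v),
    ∑ X ∈ block G U v W₀ with u ∈ X, (f X - f (X.erase u)) ^ 2 with he
  have he0 : ∀ W₀, 0 ≤ e W₀ := fun _ =>
    Finset.sum_nonneg fun _ _ => Finset.sum_nonneg fun _ _ => sq_nonneg _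
  have hblock : ∀ W₀ ∈ F.image π, a / 4 * ∑ W ∈ block G U v W₀, f W ^ 2 ≤
      ∑ W ∈ block G U v W₀, localCount G D v W * f W ^ 2 +
        2 * ((D + 1) * e W₀) * (2 * D * 2 ^ (D + 1)) := by
    intro W₀ hW₀
    obtain ⟨W', hW', rfl⟩ := Finset.mem_image.1 hW₀
    set J := freeNbrs G U v (π W') with hJ
    have hJN : J ⊆ nbrs G v := Finset.filter_subset _ _
    have hJU : J ⊆ U ∩ nbrs G v := by
      intro u hu
      have := Finset.mem_filter.1 hu
      exact Finset.mem_inter.2 ⟨this.2.1, this.1⟩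
    have hcard : ((block G U v (π W')).card : ℝ) = 1 + (indepIn G J).card := by
      have := sum_block hv hW' (fun _ => (1 : ℝ))
      simpa using this
    have hIJ : (indepIn G J).card ≤ 2 ^ D := by
      refine (Finset.card_filter_le _ _).trans ?_
      rw [Finset.card_powerset]
      exact Nat.pow_le_pow_right (by norm_num) ((Finset.card_le_card hJN).trans hD)
    have hsum : ∑ W ∈ block G U v (π W'), localCount G D v W =
        D + ∑ S ∈ indepIn G J, (S.card : ℝ) := by
      rw [sum_block hv hW']
      congr 1
      · have : nbrs G v ∩ insert v (W' \ insert v (nbrs G v)) = ∅ := by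
          refine Finset.eq_empty_of_forall_notMem fun u hu => ?_
          simp only [Finset.mem_inter, Finset.mem_insert, Finset.mem_sdiff, not_or] at hu
          obtain ⟨hu, rfl | h⟩ := hu
          · exact (mem_nbrs.1 hu).ne rfl
          · exact h.2.2 hu
        simp [localCount, this]
      · refine Finset.sum_congr rfl fun S hS => ?_
        have hSN : S ⊆ nbrs G v := (mem_indepIn.1 hS).1.trans hJN
        have h1 : nbrs G v ∩ (S ∪ W' \ insert v (nbrs G v)) = S := by
          ext u
          simp only [Finset.mem_inter, Finset.mem_union, Finset.mem_sdiff, Finset.mem_insert,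
            not_or]
          constructor
          · rintro ⟨hu, h | h⟩
            · exact h
            · exact absurd hu h.2.2
          · exact fun h => ⟨hSN h, Or.inl h⟩
        have h2 : v ∉ S ∪ W' \ insert v (nbrs G v) := by
          simp only [Finset.mem_union, Finset.mem_sdiff, Finset.mem_insert, true_or, not_true,
            and_false, or_false]
          exact fun h => (mem_nbrs.1 (hSN h)).ne rfl
        rw [localCount, h1, if_neg h2, zero_add]
    have hsq : ∀ W ∈ block G U v (π W'), (f W - f (π W')) ^ 2 ≤ (D + 1) * e (π W') := by
      intro W hW
      have h1 := sub_sdiff_sq_le f hW (insert v (nbrs G v)) subset_rfl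
      have h2 : W \ insert v (nbrs G v) = π W' := (Finset.mem_filter.1 hW).2
      rw [h2] at h1
      exact h1.trans (mul_le_mul_of_nonneg_right hNcard (he0 _))
    have := weighted_sum_sq_ge (block G U v (π W')) f (localCount G D v) (M := 2 * D) ha
      (fun W _ => localCount_nonneg _ _ _ _) (fun W _ => localCount_le hD W) hsq
      (mul_nonneg (by positivity) (he0 _)) (by rw [hcard, hsum]; exact hav J hJU)
    refine this.trans (add_le_add le_rfl (mul_le_mul_of_nonneg_left ?_
      (mul_nonneg (by norm_num) (mul_nonneg (by positivity) (he0 _)))))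
    refine mul_le_mul_of_nonneg_left ?_ (by positivity)
    rw [hcard]
    have h1 : ((indepIn G J).card : ℝ) ≤ 2 ^ D := by exact_mod_cast hIJ
    have h2 : (1 : ℝ) ≤ 2 ^ D := one_le_pow₀ (by norm_num)
    rw [pow_succ]; linarith
  have hsumm := Finset.sum_le_sum hblock
  rw [← Finset.mul_sum, ← hfib (fun W => f W ^ 2), Finset.sum_add_distrib,
    ← hfib (fun W => localCount G D v W * f W ^ 2), ← Finset.sum_mul, ← Finset.mul_sum,
    ← Finset.mul_sum] at hsumm
  refine hsumm.trans (add_le_add le_rfl ?_)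
  have := sum_fiber_energy_le (G := G) (U := U) (v := v) f
  calc 2 * ((D + 1) * ∑ W₀ ∈ F.image π, e W₀) * (2 * D * 2 ^ (D + 1))
      = 2 * (D + 1) * (2 * D * 2 ^ (D + 1)) * ∑ W₀ ∈ F.image π, e W₀ := by ring
    _ ≤ _ := mul_le_mul_of_nonneg_left this (by positivity)

/-- A spectral gap for functions that are supported on small independent sets. -/
theorem nsq_le_energy {G : SimpleGraph V} {U : Finset V} {D : ℕ} {a : ℝ} (ha : 1 ≤ a)
    (hU : U.Nonempty) (hD : ∀ v, (nbrs G v).card ≤ D)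
    (hav : ∀ v ∈ U, ∀ J ⊆ U ∩ nbrs G v, a * (1 + (indepIn G J).card) ≤
      D + ∑ S ∈ indepIn G J, (S.card : ℝ)) (f : Finset V → ℝ)
    (hf : ∀ W ∈ indepIn G U, f W ≠ 0 → 16 * D * (W.card : ℝ) ≤ a * U.card) :
    nsq (indepIn G U) f ≤ 2 ^ (D + 6) * (D * (D + 1)) * energy (indepIn G U) f := by
  set F := indepIn G U with hFdef
  have h1 : (U.card : ℝ) * (a / 4 * nsq F f) ≤
      ∑ v ∈ U, (∑ W ∈ F, localCount G D v W * f W ^ 2 +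
        2 * (D + 1) * (2 * D * 2 ^ (D + 1)) * energy F f) := by
    rw [← nsmul_eq_mul]
    exact Finset.card_nsmul_le_sum _ _ _ fun v hv =>
      nsq_le_vertex (by linarith) hv (hD v) (hav v hv) f
  rw [Finset.sum_add_distrib, Finset.sum_const, nsmul_eq_mul, Finset.sum_comm] at h1
  -- On the support of f the sets are so small that the occupancy term is at most half of the left
  -- side of `h1`. It is absorbed, and only the energy remains.
  have h2 : ∑ W ∈ F, ∑ v ∈ U, localCount G D v W * f W ^ 2 ≤ (a * U.card / 8) * nsq F f := by
    rw [nsq, Finset.mul_sum]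
    refine Finset.sum_le_sum fun W hW => ?_
    rw [← Finset.sum_mul]
    by_cases h0 : f W = 0
    · simp [h0]
    · have := sum_localCount_le hD U W
      have := hf W hW h0
      exact mul_le_mul_of_nonneg_right (by linarith) (sq_nonneg _)
  have hUc : (0 : ℝ) < U.card := by exact_mod_cast hU.card_pos
  have hn := nsq_nonneg F f
  have h3 : (U.card : ℝ) * (a / 8 * nsq F f) ≤
      U.card * (2 * (D + 1) * (2 * D * 2 ^ (D + 1)) * energy F f) := by
    nlinarith
  have h4 := le_of_mul_le_mul_left h3 hUc
  have h5 : nsq F f ≤ 8 * (a / 8 * nsq F f) := by nlinarith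
  calc nsq F f ≤ 8 * (2 * (D + 1) * (2 * D * 2 ^ (D + 1)) * energy F f) := by linarith
    _ = _ := by ring

end Blocks

end IndepRelax

namespace IndepRelax

/-! ### Survival probabilities of the chain killed at large sets -/

section KilledChain

variable {V : Type*} [Fintype V] [DecidableEq V]

open Classical in
/-- The probability that the chain that scans the vertices in the order `l` and is started in `W` has
avoided `Stop` at times `0, …, t`. -/
noncomputable def survival (F : Finset (Finset V)) (l : List V) (Stop : Finset V → Prop) :
    ℕ → Finset V → ℝ
  | 0, W => if Stop W then 0 else 1
  | t + 1, W => if Stop W then 0 else scan F l (survival F l Stop t) W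

theorem scan_mem_Icc (F : Finset (Finset V)) (l : List V) {f : Finset V → ℝ}
    (hf : ∀ W, 0 ≤ f W ∧ f W ≤ 1) (W : Finset V) : 0 ≤ scan F l f W ∧ scan F l f W ≤ 1 := by
  induction l generalizing W with
  | nil => exact hf W
  | cons v l ih =>
    have h1 := ih (W.erase v)
    have h2 := ih (if insert v W ∈ F then insert v W else W.erase v)
    change 0 ≤ heatBath F v (scan F l f) W ∧ heatBath F v (scan F l f) W ≤ 1
    unfold heatBath
    constructor <;> linarith

theorem survival_mem_Icc (F : Finset (Finset V)) (l : List V) (Stop : Finset V → Prop) (t : ℕ)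
    (W : Finset V) : 0 ≤ survival F l Stop t W ∧ survival F l Stop t W ≤ 1 := by
  induction t generalizing W with
  | zero => unfold survival; split_ifs <;> simp
  | succ t ih =>
    unfold survival
    split_ifs
    · simp
    · exact scan_mem_Icc F l ih W

variable {F : Finset (Finset V)} {l : List V} {Stop : Finset V → Prop} {κ M : ℕ}

/-- Each of the |V| flip energies is at most 4 |l| times the loss of norm in the scan, so the gap
bounds the norm by M times this loss. -/
theorem nsq_scan_le (hF : ∀ W ∈ F, ∀ v, W.erase v ∈ F) (hl : ∀ v, v ∈ l)
    {f : Finset V → ℝ} (hgap : nsq F f ≤ κ * energy F f)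
    (hM : M = κ * (4 * l.length * Fintype.card V)) (hM0 : 0 < M) :
    nsq F (scan F l f) ≤ (1 - 1 / M) * nsq F f := by
  obtain ⟨-, -, h⟩ := scan_estimates hF l f
  have h1 : energy F f ≤ Fintype.card V * (4 * l.length * (nsq F f - nsq F (scan F l f))) := by
    rw [energy, ← nsmul_eq_mul]
    exact Finset.sum_le_card_nsmul _ _ _ fun v _ => h v (hl v)
  have h2 : nsq F f ≤ M * (nsq F f - nsq F (scan F l f)) := by
    rw [hM]; push_cast
    calc nsq F f ≤ κ * energy F f := hgap
      _ ≤ κ * (Fintype.card V * (4 * l.length * (nsq F f - nsq F (scan F l f)))) :=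
        mul_le_mul_of_nonneg_left h1 (by positivity)
      _ = _ := by ring
  have hM' : (0 : ℝ) < M := by exact_mod_cast hM0
  have h3 : nsq F f / M ≤ nsq F f - nsq F (scan F l f) := by
    rw [div_le_iff₀ hM']; linarith
  have : (1 - 1 / (M : ℝ)) * nsq F f = nsq F f - nsq F f / M := by ring
  linarith

/-- The survival function vanishes on `Stop`, so the restricted gap applies at every time; killing
only decreases the norm. -/
theorem nsq_survival_le (hF : ∀ W ∈ F, ∀ v, W.erase v ∈ F) (hl : ∀ v, v ∈ l)
    (hgap : ∀ f : Finset V → ℝ, (∀ W ∈ F, f W ≠ 0 → ¬ Stop W) → nsq F f ≤ κ * energy F f)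
    (hM : M = κ * (4 * l.length * Fintype.card V)) (hM0 : 0 < M) (t : ℕ) :
    nsq F (survival F l Stop t) ≤ (1 - 1 / M) ^ t * 2 ^ Fintype.card V := by
  have hM1 : (0 : ℝ) ≤ 1 - 1 / M := by
    have : (1 : ℝ) ≤ M := by exact_mod_cast hM0
    have := (div_le_one (by linarith : (0 : ℝ) < M)).2 this
    linarith
  induction t with
  | zero =>
    have h1 : nsq F (survival F l Stop 0) ≤ F.card := by
      have : F.card = ∑ W ∈ F, 1 := by simp
      rw [this, nsq]; push_cast
      refine Finset.sum_le_sum fun W _ => ?_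
      have := survival_mem_Icc F l Stop 0 W
      nlinarith
    have h2 : F.card ≤ 2 ^ Fintype.card V := by
      rw [← Fintype.card_finset]; exact Finset.card_le_univ F
    have h3 : (F.card : ℝ) ≤ 2 ^ Fintype.card V := by exact_mod_cast h2
    simpa using h1.trans h3
  | succ t ih =>
    have h1 : nsq F (survival F l Stop (t + 1)) ≤ nsq F (scan F l (survival F l Stop t)) := by
      refine Finset.sum_le_sum fun W _ => ?_
      rw [survival]
      split_ifs
      · simpa using sq_nonneg _
      · exact le_rfl
    have h2 : nsq F (scan F l (survival F l Stop t)) ≤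
        (1 - 1 / M) * nsq F (survival F l Stop t) := by
      refine nsq_scan_le hF hl (hgap _ fun W _ hW hs => hW ?_) hM hM0
      cases t <;> simp [survival, hs]
    rw [pow_succ' (1 - 1 / (M : ℝ)), mul_assoc]
    exact h1.trans (h2.trans (mul_le_mul_of_nonneg_left ih hM1))

/-- The norm controls point values, but starts at up to 2^|V|. The first M |V| sweeps, bounded by 1
each, remove this factor; afterwards survival is dominated by a geometric sequence with sum 2 M. -/
theorem sum_survival_le (hF : ∀ W ∈ F, ∀ v, W.erase v ∈ F) (hl : ∀ v, v ∈ l)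
    (hgap : ∀ f : Finset V → ℝ, (∀ W ∈ F, f W ≠ 0 → ¬ Stop W) → nsq F f ≤ κ * energy F f)
    (hM : M = κ * (4 * l.length * Fintype.card V)) (hM0 : 0 < M) {W : Finset V} (hW : W ∈ F)
    (N : ℕ) : ∑ t ∈ Finset.range N, survival F l Stop t W ≤ M * Fintype.card V + 2 * M := by
  set n := Fintype.card V
  have hMR : (1 : ℝ) ≤ M := by exact_mod_cast hM0
  -- The squared norm decays at rate 1 - 1 / M ≤ q², so point values decay at rate q.
  set q : ℝ := 1 - 1 / (2 * M) with hq
  have hinv : (0 : ℝ) < 1 / (2 * M) := by positivity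
  have hinv1 : 1 / (2 * (M : ℝ)) ≤ 1 / 2 :=
    div_le_div_of_nonneg_left (by norm_num) (by norm_num) (by linarith)
  have hq0 : 0 ≤ q := by rw [hq]; linarith
  have hq1 : q < 1 := by rw [hq]; linarith
  have hsq : 1 - 1 / (M : ℝ) ≤ q ^ 2 := by
    have : 1 / (M : ℝ) = 2 * (1 / (2 * M)) := by field_simp
    rw [this, hq]; nlinarith
  have hM1 : (0 : ℝ) ≤ 1 - 1 / M := by
    have := (div_le_one (by linarith : (0 : ℝ) < M)).2 hMR
    linarith
  have hhalf : (1 - 1 / (M : ℝ)) ^ (M * n) * 2 ^ n ≤ 1 := by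
    have h1 : (1 - 1 / (M : ℝ)) ^ M ≤ 1 / 2 := by
      calc (1 - 1 / (M : ℝ)) ^ M ≤ Real.exp (-1) :=
            Real.one_sub_div_pow_le_exp_neg (by exact_mod_cast hMR)
        _ ≤ 1 / 2 := by
          rw [Real.exp_neg, ← one_div]
          exact div_le_div_of_nonneg_left (by norm_num) (by norm_num)
            (by linarith [Real.exp_one_gt_d9])
    rw [pow_mul, ← mul_pow]
    exact pow_le_one₀ (mul_nonneg (pow_nonneg hM1 _) (by norm_num)) (by linarith)
  have htail : ∀ j, survival F l Stop (M * n + j) W ≤ q ^ j := by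
    intro j
    have h0 := survival_mem_Icc F l Stop (M * n + j) W
    refine le_of_sq_le_sq ?_ (pow_nonneg hq0 j)
    calc survival F l Stop (M * n + j) W ^ 2 ≤ nsq F (survival F l Stop (M * n + j)) :=
          Finset.single_le_sum (f := fun W => survival F l Stop (M * n + j) W ^ 2)
            (fun _ _ => sq_nonneg _) hW
      _ ≤ (1 - 1 / M) ^ (M * n + j) * 2 ^ n := nsq_survival_le hF hl hgap hM hM0 _
      _ = (1 - 1 / (M : ℝ)) ^ j * ((1 - 1 / (M : ℝ)) ^ (M * n) * 2 ^ n) := by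
        rw [pow_add]; ring
      _ ≤ (1 - 1 / (M : ℝ)) ^ j * 1 := mul_le_mul_of_nonneg_left hhalf (pow_nonneg hM1 _)
      _ ≤ (q ^ 2) ^ j := by rw [mul_one]; exact pow_le_pow_left₀ hM1 hsq _
      _ = (q ^ j) ^ 2 := by rw [← pow_mul, ← pow_mul, mul_comm]
  have h1 : ∑ t ∈ Finset.range N, survival F l Stop t W ≤
      ∑ t ∈ Finset.range (M * n + N), survival F l Stop t W :=
    Finset.sum_le_sum_of_subset_of_nonneg (Finset.range_mono (by omega))
      fun t _ _ => (survival_mem_Icc F l Stop t W).1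
  rw [Finset.sum_range_add] at h1
  have h2 : ∑ t ∈ Finset.range (M * n), survival F l Stop t W ≤ M * n := by
    have := Finset.sum_le_card_nsmul (Finset.range (M * n)) _ _
      fun t _ => (survival_mem_Icc F l Stop t W).2
    simpa using this
  have h3 : ∑ j ∈ Finset.range N, survival F l Stop (M * n + j) W ≤ 2 * M := by
    calc _ ≤ ∑ j ∈ Finset.range N, q ^ j := Finset.sum_le_sum fun j _ => htail j
      _ ≤ ∑' j, q ^ j := (summable_geometric_of_lt_one hq0 hq1).sum_le_tsum _
          fun _ _ => pow_nonneg hq0 _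
      _ = 2 * M := by
        rw [tsum_geometric_of_lt_one hq0 hq1, hq]; field_simp; ring
  linarith

end KilledChain

/-! ### Random bits and the expected number of sweeps -/

section Coins

open MeasureTheory

instance : IsProbabilityMeasure coinLaw := by
  unfold coinLaw; infer_instance

/-- The sequence that starts with `b` and continues with `ω`. -/
def consCoin (p : Bool × (ℕ → Bool)) : ℕ → Bool
  | 0 => p.1
  | k + 1 => p.2 k

theorem measurable_consCoin : Measurable consCoin := by
  refine measurable_pi_iff.2 fun k => ?_
  cases k with
  | zero => exact measurable_fst
  | succ k => exact (measurable_pi_apply k).comp measurable_snd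

/-- Prepending an independent fair bit preserves the law, as is checked on finite cylinders. This
permits conditioning on the first bit. -/
theorem coinLaw_eq_map :
    coinLaw = ((PMF.uniformOfFintype Bool).toMeasure.prod coinLaw).map consCoin := by
  symm
  refine Measure.eq_infinitePi _ fun s t ht => ?_
  set μ := (PMF.uniformOfFintype Bool).toMeasure with hμ
  obtain ⟨N, hN⟩ : ∃ N, s ⊆ Finset.range (N + 1) :=
    ⟨s.sup id, fun i hi => Finset.mem_range.2 (Nat.lt_succ_of_le (Finset.le_sup (f := id) hi))⟩
  set t' : ℕ → Set Bool := fun i => if i ∈ s then t i else Set.univ with ht'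
  have h1 : Set.pi s t = Set.pi (Finset.range (N + 1)) t' := by
    ext ω
    simp only [Set.mem_pi, Finset.mem_coe, ht']
    constructor
    · intro h i _
      split_ifs with hi
      · exact h i hi
      · trivial
    · intro h i hi
      have := h i (hN hi)
      rwa [if_pos hi] at this
  have h2 : ∏ i ∈ s, μ (t i) = ∏ i ∈ Finset.range (N + 1), μ (t' i) := by
    rw [← Finset.prod_subset hN]
    · exact Finset.prod_congr rfl fun i hi => by simp [ht', hi]
    · intro i _ hi
      simp only [ht', if_neg hi]
      exact measure_univ
  have h3 : consCoin ⁻¹' Set.pi (Finset.range (N + 1)) t' =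
      t' 0 ×ˢ Set.pi (Finset.range N) fun k => t' (k + 1) := by
    ext ⟨b, ω⟩
    simp only [Set.mem_preimage, Set.mem_pi, Finset.coe_range, Set.mem_Iio, Set.mem_prod]
    constructor
    · exact fun h => ⟨h 0 (by omega), fun k hk => h (k + 1) (by omega)⟩
    · rintro ⟨h0, h⟩ i hi
      cases i with
      | zero => exact h0
      | succ k => exact h k (by omega)
  rw [h1, h2, Measure.map_apply measurable_consCoin, h3, Measure.prod_prod, coinLaw,
    Measure.infinitePi_pi, Finset.prod_range_succ' _ N, mul_comm]
  · intro i _; exact MeasurableSet.of_discrete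
  · exact MeasurableSet.pi (Finset.countable_toSet _) fun i _ => MeasurableSet.of_discrete

theorem lintegral_coinLaw_cons (Φ : Bool → (ℕ → Bool) → ℝ≥0∞) (hΦ : ∀ b, Measurable (Φ b)) :
    Measurable (fun ω : ℕ → Bool => Φ (ω 0) fun k => ω (k + 1)) ∧
    ∫⁻ ω, Φ (ω 0) (fun k => ω (k + 1)) ∂coinLaw =
      (∫⁻ ω, Φ false ω ∂coinLaw + ∫⁻ ω, Φ true ω ∂coinLaw) / 2 := by
  have hm : Measurable fun p : Bool × (ℕ → Bool) => Φ p.1 p.2 :=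
    measurable_from_prod_countable_right hΦ
  have hshift : Measurable fun ω : ℕ → Bool => (ω 0, fun k => ω (k + 1)) := by
    refine (measurable_pi_apply 0).prodMk (measurable_pi_iff.2 fun k => measurable_pi_apply _)
  have hmeas : Measurable (fun ω : ℕ → Bool => Φ (ω 0) fun k => ω (k + 1)) := hm.comp hshift
  refine ⟨hmeas, ?_⟩
  conv_lhs => rw [coinLaw_eq_map]
  rw [lintegral_map hmeas measurable_consCoin]
  have : ∀ p : Bool × (ℕ → Bool), Φ (consCoin p 0) (fun k => consCoin p (k + 1)) = Φ p.1 p.2 :=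
    fun p => rfl
  simp_rw [this]
  rw [lintegral_prod _ hm.aemeasurable, lintegral_fintype]
  have hb : ∀ b : Bool, (PMF.uniformOfFintype Bool).toMeasure {b} = 2⁻¹ := by
    intro b
    rw [PMF.toMeasure_apply_singleton _ _ (measurableSet_singleton b)]
    simp
  rw [Fintype.sum_bool, hb, hb, ← add_mul, add_comm, ENNReal.div_eq_inv_mul, mul_comm]

variable {V : Type*} [DecidableEq V]

open Classical in
/-- The heat-bath update of the independent set `W` in `U` at the vertex `v`, with the coin `b`. -/
noncomputable def coinStep (G : SimpleGraph V) (U : Finset V) (v : V) (b : Bool) (W : Finset V) :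
    Finset V :=
  if b = true ∧ v ∈ U ∧ ∀ u ∈ W, ¬ G.Adj v u then insert v W else W.erase v

/-- The updates at the vertices of a list, with fresh coins; returns the unread coins as well. -/
noncomputable def sweep (G : SimpleGraph V) (U : Finset V) :
    List V → Finset V → (ℕ → Bool) → Finset V × (ℕ → Bool)
  | [], W, ω => (W, ω)
  | v :: l, W, ω => sweep G U l (coinStep G U v (ω 0) W) fun k => ω (k + 1)

theorem insert_mem_indepIn {G : SimpleGraph V} {U W : Finset V} {v : V} (hW : W ∈ indepIn G U) :
    insert v W ∈ indepIn G U ↔ v ∈ U ∧ ∀ u ∈ W, ¬ G.Adj v u := by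
  rw [mem_indepIn] at *
  constructor
  · rintro ⟨h1, h2⟩
    refine ⟨h1 (Finset.mem_insert_self _ _), fun u hu h => ?_⟩
    exact h2 (by simp) (by simp [hu]) h.ne h
  · rintro ⟨h1, h2⟩
    refine ⟨Finset.insert_subset h1 hW.1, ?_⟩
    intro x hx y hy hxy
    simp only [Finset.coe_insert, Set.mem_insert_iff, Finset.mem_coe] at hx hy
    rcases hx with rfl | hx <;> rcases hy with rfl | hy
    · exact absurd rfl hxy
    · exact h2 y hy
    · exact fun h => h2 x hx h.symm
    · exact hW.2 hx hy hxy

theorem coinStep_mem {G : SimpleGraph V} {U W : Finset V} (hW : W ∈ indepIn G U) (v : V) (b : Bool) :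
    coinStep G U v b W ∈ indepIn G U := by
  unfold coinStep
  split_ifs with h
  · exact (insert_mem_indepIn hW).2 h.2
  · exact mem_indepIn_of_subset hW (Finset.erase_subset _ _)

theorem sweep_mem {G : SimpleGraph V} {U W : Finset V} (hW : W ∈ indepIn G U) (l : List V)
    (ω : ℕ → Bool) : (sweep G U l W ω).1 ∈ indepIn G U := by
  induction l generalizing W ω with
  | nil => exact hW
  | cons v l ih => exact ih (coinStep_mem hW _ _) _

open Classical in
/-- Indicator of the event that the chain started in `W` and driven by the coins `ω` avoids `Stop` at
the times `0, …, t`. -/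
noncomputable def survives (G : SimpleGraph V) (U : Finset V) (l : List V) (Stop : Finset V → Prop) :
    ℕ → Finset V → (ℕ → Bool) → ℝ≥0∞
  | 0, W, _ => if Stop W then 0 else 1
  | t + 1, W, ω => if Stop W then 0 else
      survives G U l Stop t (sweep G U l W ω).1 (sweep G U l W ω).2

/-- The Markov property for a sweep. As Φ sees only the new set and the unread bits, integrating out
the first bit turns an update into `heatBath`. -/
theorem lintegral_sweep (G : SimpleGraph V) (U : Finset V) {Φ : Finset V → (ℕ → Bool) → ℝ≥0∞}
    {h : Finset V → ℝ} (hh : ∀ W, 0 ≤ h W) (hΦ : ∀ W ∈ indepIn G U, Measurable (Φ W))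
    (hi : ∀ W ∈ indepIn G U, ∫⁻ ω, Φ W ω ∂coinLaw = ENNReal.ofReal (h W)) (l : List V) :
    (∀ W, 0 ≤ scan (indepIn G U) l h W) ∧ ∀ W ∈ indepIn G U,
      Measurable (fun ω => Φ (sweep G U l W ω).1 (sweep G U l W ω).2) ∧
      ∫⁻ ω, Φ (sweep G U l W ω).1 (sweep G U l W ω).2 ∂coinLaw =
        ENNReal.ofReal (scan (indepIn G U) l h W) := by
  induction l with
  | nil => exact ⟨hh, fun W hW => ⟨hΦ W hW, hi W hW⟩⟩
  | cons v l ih =>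
    obtain ⟨ih0, ih⟩ := ih
    have hs : scan (indepIn G U) (v :: l) h = heatBath (indepIn G U) v (scan (indepIn G U) l h) :=
      rfl
    refine ⟨fun W => ?_, fun W hW => ?_⟩
    · rw [hs, heatBath]
      have := ih0 (W.erase v)
      have := ih0 (if insert v W ∈ indepIn G U then insert v W else W.erase v)
      linarith
    · have hc := lintegral_coinLaw_cons
        (fun b ω => Φ (sweep G U l (coinStep G U v b W) ω).1 (sweep G U l (coinStep G U v b W) ω).2)
        (fun b => (ih _ (coinStep_mem hW v b)).1)
      refine ⟨hc.1, hc.2.trans ?_⟩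
      rw [(ih _ (coinStep_mem hW v false)).2, (ih _ (coinStep_mem hW v true)).2,
        ← ENNReal.ofReal_add (ih0 _) (ih0 _)]
      rw [show (2 : ℝ≥0∞) = ENNReal.ofReal 2 by simp, ← ENNReal.ofReal_div_of_pos (by norm_num), hs,
        heatBath]
      have e1 : coinStep G U v false W = W.erase v := by simp [coinStep]
      have e2 : coinStep G U v true W =
          if insert v W ∈ indepIn G U then insert v W else W.erase v := by
        unfold coinStep
        by_cases hc : insert v W ∈ indepIn G U
        · rw [if_pos hc, if_pos ⟨rfl, (insert_mem_indepIn hW).1 hc⟩]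
        · rw [if_neg hc, if_neg fun h => hc ((insert_mem_indepIn hW).2 h.2)]
      rw [e1, e2]

theorem lintegral_survives (G : SimpleGraph V) (U : Finset V) (l : List V)
    (Stop : Finset V → Prop) [Fintype V] (t : ℕ) : ∀ W ∈ indepIn G U,
      Measurable (survives G U l Stop t W) ∧ ∫⁻ ω, survives G U l Stop t W ω ∂coinLaw =
        ENNReal.ofReal (survival (indepIn G U) l Stop t W) := by
  induction t with
  | zero =>
    intro W _
    have e : survives G U l Stop 0 W = fun _ => ENNReal.ofReal (survival (indepIn G U) l Stop 0 W) := by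
      funext ω
      unfold survives survival
      split_ifs <;> simp
    rw [e]
    exact ⟨measurable_const, by simp⟩
  | succ t ih =>
    intro W hW
    have := (lintegral_sweep G U (h := survival (indepIn G U) l Stop t)
      (fun W => (survival_mem_Icc _ l Stop t W).1) (fun W hW => (ih W hW).1)
      (fun W hW => (ih W hW).2) l).2 W hW
    by_cases hs : Stop W
    · have e : survives G U l Stop (t + 1) W = fun _ => 0 := by
        funext ω; simp [survives, hs]
      rw [e, survival, if_pos hs]
      simp
    · have e : survives G U l Stop (t + 1) W = fun ω =>
          survives G U l Stop t (sweep G U l W ω).1 (sweep G U l W ω).2 := by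
        funext ω; simp [survives, hs]
      rw [e, survival, if_neg hs]
      exact this

/-- The sum of the survival indicators is the number of sweeps before the stopping rule holds. -/
theorem lintegral_tsum_survives_le {G : SimpleGraph V} {U : Finset V} {l : List V}
    {Stop : Finset V → Prop} [Fintype V] {κ M : ℕ} (hl : ∀ v, v ∈ l)
    (hgap : ∀ f : Finset V → ℝ, (∀ W ∈ indepIn G U, f W ≠ 0 → ¬ Stop W) →
      nsq (indepIn G U) f ≤ κ * energy (indepIn G U) f)
    (hM : M = κ * (4 * l.length * Fintype.card V)) (hM0 : 0 < M) {W : Finset V}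
    (hW : W ∈ indepIn G U) :
    ∫⁻ ω, ∑' t, survives G U l Stop t W ω ∂coinLaw ≤ ((M * Fintype.card V + 2 * M : ℕ) : ℝ≥0∞) := by
  rw [lintegral_tsum fun t => (lintegral_survives G U l Stop t W hW).1.aemeasurable]
  refine ENNReal.tsum_le_of_sum_range_le fun N => ?_
  rw [Finset.sum_congr rfl fun t _ => (lintegral_survives G U l Stop t W hW).2,
    ← ENNReal.ofReal_sum_of_nonneg fun t _ => (survival_mem_Icc _ l Stop t W).1,
    ← ENNReal.ofReal_natCast]
  refine ENNReal.ofReal_le_ofReal ?_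
  have := sum_survival_le erase_mem_indepIn hl hgap hM hM0 hW N
  push_cast
  exact this

end Coins

end IndepRelax

namespace IndepRelax

/-! ### Clique covers as upper bounds for the relaxations -/

section Certificates

variable {V : Type*} [Fintype V] [DecidableEq V]

/-- `U` is the union of `c` disjoint cliques of size `r`. -/
inductive CliqueCover (G : SimpleGraph V) (r : ℕ) : Finset V → ℕ → Prop
  | empty : CliqueCover G r ∅ 0
  | add {U M : Finset V} {c : ℕ} (h : CliqueCover G r U c) (hd : Disjoint U M)
      (hM : G.IsClique (M : Set V)) (hr : M.card = r) : CliqueCover G r (U ∪ M) (c + 1)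

theorem CliqueCover.card_eq {G : SimpleGraph V} {r c : ℕ} {U : Finset V}
    (h : CliqueCover G r U c) : U.card = r * c := by
  induction h with
  | empty => simp
  | add h hd hM hr ih => rw [Finset.card_union_of_disjoint hd, ih, hr]; ring

theorem CliqueCover.sum_le {G : SimpleGraph V} {r c : ℕ} {U : Finset V}
    (h : CliqueCover G r U c) {x : V → ℝ}
    (hx : ∀ M : Finset V, G.IsClique (M : Set V) → M.card = r → ∑ i ∈ M, x i ≤ 1) :
    ∑ i ∈ U, x i ≤ c := by
  induction h with
  | empty => simp
  | add h hd hM hr ih =>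
    rw [Finset.sum_union hd]
    have := hx _ hM hr
    push_cast
    linarith

/-- The number of dyadic clique sizes that are used for graphs of maximum degree at most `D`. -/
def layers (D : ℕ) : ℕ := Nat.log 2 (Nat.log 2 D + 1)

/-- The vertex set is partitioned into `layers D` classes, of which the class with label `k + 1` is
covered by `c k` cliques of size `2 ^ k`, and `b` bounds the numbers `c k`. -/
structure LayerCover (G : SimpleGraph V) (D : ℕ) (lab : V → ℕ) (c : ℕ → ℕ) (b : ℕ) : Prop where
  lab_pos : ∀ v, 0 < lab v
  lab_le : ∀ v, lab v ≤ layers D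
  cover : ∀ k < layers D, CliqueCover G (2 ^ k) (Finset.univ.filter fun v => lab v = k + 1) (c k)
  le : ∀ k < layers D, c k ≤ b

/-- An independent set whose size is within a factor of order `D (log log D) ^ 2 / log D` of a clique
cover of `G`. -/
def Certified (G : SimpleGraph V) (D : ℕ) (I : Finset V) : Prop :=
  G.IsIndepSet (I : Set V) ∧ ∃ lab c b, LayerCover G D lab c b ∧
    (Nat.log 2 D + 1) * b ≤ 1024 * D * layers D * I.card

theorem LayerCover.sum_eq {G : SimpleGraph V} {D b : ℕ} {lab : V → ℕ} {c : ℕ → ℕ}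
    (h : LayerCover G D lab c b) (x : V → ℝ) :
    ∑ v, x v = ∑ k ∈ Finset.range (layers D), ∑ v with lab v = k + 1, x v := by
  have : ∀ k, (Finset.univ.filter fun v => lab v = k + 1) =
      Finset.univ.filter fun v => lab v - 1 = k := by
    intro k; ext v
    have := h.lab_pos v
    simp only [Finset.mem_filter, Finset.mem_univ, true_and]
    omega
  simp_rw [this]
  rw [Finset.sum_fiberwise_of_maps_to]
  intro v _
  have := h.lab_pos v
  have := h.lab_le v
  rw [Finset.mem_range]
  omega

theorem LayerCover.sum_le {G : SimpleGraph V} {D b : ℕ} {lab : V → ℕ} {c : ℕ → ℕ}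
    (h : LayerCover G D lab c b) {x : V → ℝ}
    (hx : ∀ M : Finset V, G.IsClique (M : Set V) → M.card ≤ 2 ^ (layers D - 1) →
      ∑ i ∈ M, x i ≤ 1) : ∑ v, x v ≤ layers D * b := by
  rw [h.sum_eq]
  have : ∀ k ∈ Finset.range (layers D), ∑ v with lab v = k + 1, x v ≤ b := by
    intro k hk
    have hk' := Finset.mem_range.1 hk
    refine ((h.cover k hk').sum_le fun M hM hr => hx M hM ?_).trans (by exact_mod_cast h.le k hk')
    rw [hr]
    exact Nat.pow_le_pow_right (by norm_num) (by omega)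
  simpa using Finset.sum_le_card_nsmul _ _ _ this

/-- Serves for small d, where clique inequalities may be missing and the number of vertices bounds
the relaxation instead. -/
theorem LayerCover.card_le {G : SimpleGraph V} {D b : ℕ} {lab : V → ℕ} {c : ℕ → ℕ}
    (h : LayerCover G D lab c b) :
    (Fintype.card V : ℝ) ≤ layers D * (2 ^ (layers D - 1) * b) := by
  have h1 := h.sum_eq fun _ => 1
  have h2 : ∀ k ∈ Finset.range (layers D), ∑ v with lab v = k + 1, (1 : ℝ) ≤
      2 ^ (layers D - 1) * b := by
    intro k hk
    have hk' := Finset.mem_range.1 hk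
    have h3 := (h.cover k hk').card_eq
    have h4 : 2 ^ k * c k ≤ 2 ^ (layers D - 1) * b :=
      Nat.mul_le_mul (Nat.pow_le_pow_right (by norm_num) (by omega)) (h.le k hk')
    rw [← h3] at h4
    simp only [Finset.sum_const, nsmul_eq_mul, mul_one]
    exact_mod_cast h4
  have h3 := Finset.sum_le_card_nsmul _ _ _ h2
  simp only [Finset.sum_const, nsmul_eq_mul, mul_one, Finset.card_univ, Finset.card_range] at h1 h3
  rw [h1]; exact h3

/-- With S = U \ {j} and T empty, the edge constraint reads Y_S + Y_U ≤ Y_S, while Y_U ≥ 0. -/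
theorem SAFeasible.apply_eq_zero {G : SimpleGraph V} {t : ℕ} {Y : Finset V → ℝ}
    (h : SAFeasible G t Y) {U : Finset V} (hU : U.card ≤ t + 1) {i j : V} (hi : i ∈ U) (hj : j ∈ U)
    (hij : G.Adj i j) : Y U = 0 := by
  have hS : (U.erase j).card + (∅ : Finset V).card ≤ t := by
    rw [Finset.card_erase_of_mem hj]; simp; omega
  have h1 := h.edge (U.erase j) ∅ (Finset.disjoint_empty_right _) hS i j hij
  have h2 := h.nonneg (U.erase j) ∅ (Finset.disjoint_empty_right _) hS j
  have hii : U.erase j ∪ {i} = U.erase j := by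
    rw [Finset.union_eq_left, Finset.singleton_subset_iff, Finset.mem_erase]
    exact ⟨hij.ne, hi⟩
  have hjj : U.erase j ∪ {j} = U := by
    rw [Finset.union_comm, ← Finset.insert_eq, Finset.insert_erase hj]
  simp only [lin, Finset.powerset_empty, Finset.sum_singleton, Finset.card_empty, pow_zero, one_mul,
    Finset.union_empty, hii, hjj] at h1 h2
  linarith

/-- The Sherali-Adams relaxation of level `t` satisfies the clique constraints for cliques with up to
`t + 1` vertices. -/
theorem SAFeasible.sum_clique_le {G : SimpleGraph V} {t : ℕ} {Y : Finset V → ℝ}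
    (h : SAFeasible G t Y) {C : Finset V} (hC : G.IsClique (C : Set V)) (hct : C.card ≤ t + 1) :
    ∑ i ∈ C, Y {i} ≤ 1 := by
  rcases C.eq_empty_or_nonempty with rfl | ⟨i, hi⟩
  · simp
  have hcard := Finset.card_erase_of_mem hi
  have hzero : ∀ U ⊆ C, 2 ≤ U.card → Y U = 0 := by
    intro U hUC hU
    obtain ⟨a, ha, b, hb, hab⟩ := Finset.one_lt_card.1 (by omega : 1 < U.card)
    exact h.apply_eq_zero ((Finset.card_le_card hUC).trans hct) ha hb (hC (hUC ha) (hUC hb) hab)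
  -- The constraint x_i ≤ 1 multiplied by ∏ (1 - x_j) over the other vertices of C. All monomials of
  -- degree at least 2 vanish, so it linearizes to Y_i ≤ 1 - ∑ Y_j.
  have h1 := h.le_one ∅ (C.erase i) (Finset.disjoint_empty_left _) (by simp; omega) i
  have e1 : lin Y ∅ (C.erase i) {i} = Y {i} := by
    unfold lin
    rw [Finset.sum_eq_single ∅]
    · simp
    · intro T hT hT0
      have hT' := Finset.mem_powerset.1 hT
      rw [hzero, mul_zero]
      · rw [Finset.empty_union]
        exact Finset.union_subset (hT'.trans (Finset.erase_subset _ _))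
          (Finset.singleton_subset_iff.2 hi)
      · rw [Finset.empty_union, Finset.card_union_of_disjoint, Finset.card_singleton]
        · have := Finset.card_pos.2 (Finset.nonempty_iff_ne_empty.2 hT0)
          omega
        · rw [Finset.disjoint_singleton_right]
          exact fun h' => Finset.notMem_erase i C (hT' h')
    · simp
  have e2 : lin Y ∅ (C.erase i) ∅ = 1 - ∑ j ∈ C.erase i, Y {j} := by
    unfold lin
    have hsub : insert ∅ ((C.erase i).image fun j => ({j} : Finset V)) ⊆ (C.erase i).powerset := by
      intro T hT
      rcases Finset.mem_insert.1 hT with rfl | hT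
      · simp
      · obtain ⟨j, hj, rfl⟩ := Finset.mem_image.1 hT
        exact Finset.mem_powerset.2 (Finset.singleton_subset_iff.2 hj)
    rw [← Finset.sum_subset hsub, Finset.sum_insert, Finset.sum_image]
    · simp [h.empty, sub_eq_add_neg]
    · intro a _ b _ hab
      exact Finset.singleton_injective hab
    · simp
    · intro T hT hT'
      rw [Finset.empty_union, Finset.union_empty, hzero, mul_zero]
      · exact (Finset.mem_powerset.1 hT).trans (Finset.erase_subset _ _)
      · by_contra hcon
        have : T.card = 0 ∨ T.card = 1 := by omega
        apply hT'
        rcases this with h0 | h0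
        · simp [Finset.card_eq_zero.1 h0]
        · obtain ⟨j, rfl⟩ := Finset.card_eq_one.1 h0
          refine Finset.mem_insert_of_mem (Finset.mem_image_of_mem _ ?_)
          exact Finset.mem_powerset.1 hT (Finset.mem_singleton_self j)
  rw [e1, e2] at h1
  rw [← Finset.add_sum_erase C _ hi]
  linarith

theorem SAFeasible.apply_le_one {G : SimpleGraph V} {t : ℕ} {Y : Finset V → ℝ}
    (h : SAFeasible G t Y) (i : V) : Y {i} ≤ 1 := by
  have := h.sum_clique_le (C := {i}) (by simp) (by simp)
  simpa using this

theorem layers_sixteen : layers 16 = 2 := by decide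

theorem two_le_layers {D : ℕ} (hD : 16 ≤ D) : 2 ≤ layers D := by
  rw [← layers_sixteen]
  exact Nat.log_mono_right (Nat.add_le_add_right (Nat.log_mono_right hD) 1)

theorem two_pow_layers_le (D : ℕ) : 2 ^ layers D ≤ Nat.log 2 D + 1 :=
  Nat.pow_log_le_self 2 (by omega)

theorem log_two_mul_le {D : ℕ} (hD : D ≠ 0) : Nat.log 2 D * Real.log 2 ≤ Real.log D := by
  rw [← Real.log_pow]
  refine Real.log_le_log (by positivity) ?_
  exact_mod_cast Nat.pow_log_le_self 2 hD

/-- The largest cliques have at most (log₂ D + 1) / 2 vertices. Halving compensates for the passage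
from binary to natural logarithms. -/
theorem two_pow_pred_layers_le_log {D d : ℕ} (hD : 16 ≤ D) (hDd : D ≤ d) :
    ((2 ^ (layers D - 1) : ℕ) : ℝ) ≤ Real.log d := by
  have h1 := two_pow_layers_le D
  have h2 := two_le_layers hD
  have h3 : 2 * 2 ^ (layers D - 1) ≤ Nat.log 2 D + 1 := by
    rw [← pow_succ']; rwa [Nat.sub_add_cancel (by omega)]
  have h4 : 4 ≤ Nat.log 2 D := by
    have h16 : Nat.log 2 16 = 4 := by decide
    rw [← h16]; exact Nat.log_mono_right hD
  have h5 := log_two_mul_le (D := D) (by omega)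
  have h6 : Real.log D ≤ Real.log d :=
    Real.log_le_log (by exact_mod_cast (by omega : 0 < D)) (by exact_mod_cast hDd)
  have h7 := Real.log_two_gt_d9
  have h3' : (2 : ℝ) * ((2 ^ (layers D - 1) : ℕ) : ℝ) ≤ Nat.log 2 D + 1 := by exact_mod_cast h3
  have h4' : (4 : ℝ) ≤ Nat.log 2 D := by exact_mod_cast h4
  nlinarith

theorem log_log_three_pos : 0 < Real.log (Real.log 3) := by
  apply Real.log_pos
  rw [Real.lt_log_iff_exp_lt (by norm_num)]
  linarith [Real.exp_one_lt_d9]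

/-- Since x / log x increases beyond e, replacing D by d is harmless unless d < 16, when D = 16.
Additive constants are absorbed because log log d ≥ log log 3 > 0. -/
theorem exists_softRatio_bound : ∃ C : ℕ, ∀ d D : ℕ, 3 ≤ d → 16 ≤ D → D ≤ max 16 d →
    2048 * D * (layers D : ℝ) ^ 2 / ((Nat.log 2 D + 1 : ℕ) : ℝ) ≤ softRatio C 2 d := by
  set a := Real.log (Real.log 3) with ha
  have ha0 : 0 < a := log_log_three_pos
  set b := Real.log (Real.log 16) with hb
  set B := (2 + 4 / a) + (4 + 2 * b) / a with hB
  refine ⟨⌈2048 * 16 * B ^ 2⌉₊, fun d D hd hD hDd => ?_⟩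
  have hd3 : (3 : ℝ) ≤ d := by exact_mod_cast hd
  have hD16 : (16 : ℝ) ≤ D := by exact_mod_cast hD
  have hlog3 : 1 < Real.log 3 := by
    rw [Real.lt_log_iff_exp_lt (by norm_num)]
    linarith [Real.exp_one_lt_d9]
  have hlogd : 1 < Real.log d := hlog3.trans_le (Real.log_le_log (by norm_num) hd3)
  have had : a ≤ Real.log (Real.log d) :=
    Real.log_le_log (by linarith) (Real.log_le_log (by norm_num) hd3)
  have hdl : 1 ≤ d / Real.log d := by
    rw [le_div_iff₀ (by linarith)]
    linarith [Real.log_le_sub_one_of_pos (show (0 : ℝ) < d by linarith)]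
  have hlog16 : 1 < Real.log 16 := hlog3.trans_le (Real.log_le_log (by norm_num) (by norm_num))
  have hb0 : a ≤ b := Real.log_le_log (by linarith) (Real.log_le_log (by norm_num) (by norm_num))
  set l := Nat.log 2 D + 1 with hl
  have hl1 : (1 : ℝ) ≤ (l : ℕ) := by rw [hl]; push_cast; linarith [Nat.cast_nonneg (α := ℝ) (Nat.log 2 D)]
  have hlogD : 1 < Real.log D := hlog16.trans_le (Real.log_le_log (by norm_num) hD16)
  have hln2 := Real.log_two_gt_d9
  have hln2' := Real.log_two_lt_d9
  have hDl : Real.log D ≤ l := by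
    have h1 : (D : ℝ) ≤ 2 ^ l := by
      exact_mod_cast (Nat.lt_pow_succ_log_self (by norm_num : 1 < 2) D).le
    have h2 := Real.log_le_log (by linarith) h1
    rw [Real.log_pow] at h2
    nlinarith
  -- the ratio `D / l`
  have hratio : (D : ℝ) / l ≤ 16 * (d / Real.log d) := by
    have h1 : (D : ℝ) / l ≤ D / Real.log D :=
      div_le_div_of_nonneg_left (by linarith) (by linarith) hDl
    have hmono : ∀ x y : ℝ, 16 ≤ x → x ≤ y → x / Real.log x ≤ y / Real.log y := by
      intro x y hx hxy
      have he : Real.exp 1 ≤ x := by linarith [Real.exp_one_lt_d9]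
      have h := Real.log_div_self_antitoneOn he (he.trans hxy) hxy
      have hlx : 0 < Real.log x := Real.log_pos (by linarith)
      have hly : 0 < Real.log y := Real.log_pos (by linarith)
      rw [div_le_div_iff₀ (by linarith) (by linarith)] at h
      rw [div_le_div_iff₀ hlx hly]
      linarith
    refine h1.trans ?_
    rcases le_total 16 d with h | h
    · rw [max_eq_right h] at hDd
      exact (hmono D d hD16 (by exact_mod_cast hDd)).trans (by linarith)
    · rw [max_eq_left h] at hDd
      have : D = 16 := by omega
      rw [this]
      have : ((16 : ℕ) : ℝ) / Real.log ((16 : ℕ) : ℝ) ≤ 16 := by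
        push_cast
        exact div_le_self (by norm_num) hlog16.le
      linarith
  -- the number of layers
  have hK0 : (layers D : ℝ) ≤ 4 + 2 * Real.log (Real.log D) := by
    have h1 : ((2 : ℝ)) ^ layers D ≤ l := by exact_mod_cast two_pow_layers_le D
    have h2 : (l : ℝ) ≤ 4 * Real.log D := by
      have := log_two_mul_le (D := D) (by omega)
      have h4 : 1 ≤ Nat.log 2 D := by
        have h16 : Nat.log 2 16 = 4 := by decide
        have := Nat.log_mono_right (b := 2) hD
        omega
      have h4' : (1 : ℝ) ≤ Nat.log 2 D := by exact_mod_cast h4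
      rw [hl]; push_cast
      nlinarith
    have h3 := Real.log_le_log (by positivity) (h1.trans h2)
    rw [Real.log_pow, Real.log_mul (by norm_num) (by linarith)] at h3
    have h4 : Real.log 4 = 2 * Real.log 2 := by
      rw [show (4 : ℝ) = 2 ^ 2 by norm_num, Real.log_pow]; norm_num
    have h5 : 0 ≤ Real.log (Real.log D) := Real.log_nonneg hlogD.le
    have h6 : (0 : ℝ) ≤ layers D := by positivity
    nlinarith
  have hK : (layers D : ℝ) ≤ B * Real.log (Real.log d) := by
    have e1 : (2 + 4 / a) * Real.log (Real.log d) + (4 + 2 * b) / a * Real.log (Real.log d) =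
        B * Real.log (Real.log d) := by rw [hB]; ring
    have q1 : 4 ≤ 4 / a * Real.log (Real.log d) := by
      rw [div_mul_eq_mul_div, le_div_iff₀ ha0]; linarith
    have q2 : 4 + 2 * b ≤ (4 + 2 * b) / a * Real.log (Real.log d) := by
      rw [div_mul_eq_mul_div, le_div_iff₀ ha0]
      exact mul_le_mul_of_nonneg_left had (by linarith)
    rw [← e1]
    rcases le_total 16 d with h | h
    · rw [max_eq_right h] at hDd
      have : Real.log (Real.log D) ≤ Real.log (Real.log d) :=
        Real.log_le_log (by linarith) (Real.log_le_log (by linarith) (by exact_mod_cast hDd))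
      linarith
    · rw [max_eq_left h] at hDd
      have : D = 16 := by omega
      have : Real.log (Real.log D) = b := by rw [this, hb]; norm_num
      rw [this] at hK0
      linarith
  have hll : 0 < Real.log (Real.log d) := ha0.trans_le had
  have hsq : (layers D : ℝ) ^ 2 ≤ (B * Real.log (Real.log d)) ^ 2 :=
    pow_le_pow_left₀ (by positivity) hK 2
  calc 2048 * D * (layers D : ℝ) ^ 2 / (l : ℝ) = 2048 * (layers D : ℝ) ^ 2 * (D / l) := by ring
    _ ≤ 2048 * (B * Real.log (Real.log d)) ^ 2 * (16 * (d / Real.log d)) :=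
      mul_le_mul (mul_le_mul_of_nonneg_left hsq (by norm_num)) hratio (by positivity)
        (by positivity)
    _ = (2048 * 16 * B ^ 2) * (Real.log (Real.log d) ^ 2 * (d / Real.log d)) := by ring
    _ ≤ ⌈2048 * 16 * B ^ 2⌉₊ * (Real.log (Real.log d) ^ 2 * (d / Real.log d)) :=
      mul_le_mul_of_nonneg_right (Nat.le_ceil _) (by positivity)
    _ = _ := by rw [softRatio]; ring

theorem Certified.sum_le {G : SimpleGraph V} {D d C : ℕ} {I : Finset V} (h : Certified G D I)
    (hD : 16 ≤ D) (hDd : D ≤ max 16 d)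
    (hC : 2048 * D * (layers D : ℝ) ^ 2 / ((Nat.log 2 D + 1 : ℕ) : ℝ) ≤ softRatio C 2 d)
    {x : V → ℝ} (hx1 : ∀ v, x v ≤ 1)
    (hx : 16 ≤ d → ∀ M : Finset V, G.IsClique (M : Set V) → M.card ≤ 2 ^ (layers D - 1) →
      ∑ i ∈ M, x i ≤ 1) : ∑ v, x v ≤ softRatio C 2 d * I.card := by
  obtain ⟨-, lab, c, b, hcov, hb⟩ := h
  -- The factor 2 is needed only for d < 16: then D = 16, the layers consist of cliques with at most
  -- 2 vertices, and ∑ x_v is at most the number of vertices.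
  have hsum : ∑ v, x v ≤ 2 * (layers D * b) := by
    have hpos : (0 : ℝ) ≤ layers D * b := by positivity
    rcases le_total 16 d with h16 | h16
    · linarith [hcov.sum_le (hx h16)]
    · rw [max_eq_left h16] at hDd
      obtain rfl : D = 16 := by omega
      have h1 : ∑ v, x v ≤ Fintype.card V := by
        simpa using Finset.sum_le_card_nsmul Finset.univ x 1 fun v _ => hx1 v
      have h2 := hcov.card_le
      have h3 : layers 16 - 1 = 1 := by rw [layers_sixteen]
      rw [h3] at h2
      linarith
  have hl : (0 : ℝ) < ((Nat.log 2 D + 1 : ℕ) : ℝ) := by positivity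
  have hb' : ((Nat.log 2 D + 1 : ℕ) : ℝ) * b ≤ 1024 * D * layers D * I.card := by exact_mod_cast hb
  have h1 : 2 * (layers D * b) ≤
      2048 * D * (layers D : ℝ) ^ 2 / ((Nat.log 2 D + 1 : ℕ) : ℝ) * I.card := by
    rw [div_mul_eq_mul_div, le_div_iff₀ hl]
    have := mul_le_mul_of_nonneg_left hb' (show (0 : ℝ) ≤ 2 * layers D by positivity)
    linarith
  exact hsum.trans (h1.trans (mul_le_mul_of_nonneg_right hC (by positivity)))

theorem softRatio_nonneg (C : ℕ) {d : ℕ} (hd : 3 ≤ d) : 0 ≤ softRatio C 2 d := by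
  have : (3 : ℝ) ≤ d := by exact_mod_cast hd
  have := Real.log_nonneg (show (1 : ℝ) ≤ d by linarith)
  unfold softRatio
  positivity

theorem Certified.cliqueLPValue_le {G : SimpleGraph V} {D d C : ℕ} {I : Finset V}
    (h : Certified G D I) (hd : 3 ≤ d) (hD : 16 ≤ D) (hDd : D ≤ max 16 d)
    (hC : 2048 * D * (layers D : ℝ) ^ 2 / ((Nat.log 2 D + 1 : ℕ) : ℝ) ≤ softRatio C 2 d) :
    cliqueLPValue G (Real.log d) ≤ softRatio C 2 d * I.card := by
  refine Real.sSup_le ?_ (mul_nonneg (softRatio_nonneg C hd) (by positivity))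
  rintro _ ⟨x, hx, rfl⟩
  refine h.sum_le hD hDd hC hx.le_one fun h16 M hM hcard => hx.clique M hM ?_
  rw [max_eq_right h16] at hDd
  exact le_trans (by exact_mod_cast hcard) (two_pow_pred_layers_le_log hD hDd)

theorem Certified.saValue_le {G : SimpleGraph V} {D d C t : ℕ} {I : Finset V}
    (h : Certified G D I) (hd : 3 ≤ d) (hD : 16 ≤ D) (hDd : D ≤ max 16 d)
    (hC : 2048 * D * (layers D : ℝ) ^ 2 / ((Nat.log 2 D + 1 : ℕ) : ℝ) ≤ softRatio C 2 d)
    (ht : ⌊Real.log d⌋₊ ≤ t) :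
    saValue G t ≤ softRatio C 2 d * I.card := by
  refine Real.sSup_le ?_ (mul_nonneg (softRatio_nonneg C hd) (by positivity))
  rintro _ ⟨Y, hY, rfl⟩
  refine h.sum_le hD hDd hC hY.apply_le_one fun h16 M hM hcard => hY.sum_clique_le hM ?_
  rw [max_eq_right h16] at hDd
  have := Nat.le_floor (two_pow_pred_layers_le_log hD hDd)
  omega

theorem Certified.indepNum_le {G : SimpleGraph V} {D d C : ℕ} {I : Finset V}
    (h : Certified G D I) (hD : 16 ≤ D) (hDd : D ≤ max 16 d)
    (hC : 2048 * D * (layers D : ℝ) ^ 2 / ((Nat.log 2 D + 1 : ℕ) : ℝ) ≤ softRatio C 2 d) :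
    (G.indepNum : ℝ) ≤ softRatio C 2 d * I.card := by
  obtain ⟨S, hS⟩ := G.exists_isNIndepSet_indepNum
  have := h.sum_le hD hDd hC (x := fun v => if v ∈ S then 1 else 0)
    (fun v => by split_ifs <;> norm_num) (fun _ M hM _ => by
      rw [← Finset.sum_filter, Finset.sum_const, nsmul_eq_mul, mul_one]
      have : (M.filter fun v => v ∈ S).card ≤ 1 := by
        rw [Finset.card_le_one]
        intro a ha b hb
        by_contra hab
        rw [Finset.mem_filter] at ha hb
        exact hS.isIndepSet ha.2 hb.2 hab (hM ha.1 hb.1 hab)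
      exact_mod_cast this)
  rw [← Finset.sum_filter, Finset.sum_const, nsmul_eq_mul, mul_one, Finset.filter_mem_eq_inter,
    Finset.univ_inter, hS.card_eq] at this
  exact this

/-- The spectral gap for independent sets in a layer, below the size that the certificate needs. -/
theorem layer_gap {G : SimpleGraph V} {D r c : ℕ} {U : Finset V} (hD : 16 ≤ D)
    (hdeg : ∀ v, (nbrs G v).card ≤ D) (hr : 0 < r) (hU : U.card = r * c)
    (hfree : Nat.log 2 D + 1 ≤ 4 * r ∨ G.CliqueFreeOn U (2 * r)) (f : Finset V → ℝ)
    (hf : ∀ W ∈ indepIn G U, f W ≠ 0 →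
      ¬ (Nat.log 2 D + 1) * c ≤ 1024 * D * layers D * W.card) :
    nsq (indepIn G U) f ≤ ((2 ^ (D + 6) * (D * (D + 1)) : ℕ) : ℝ) * energy (indepIn G U) f := by
  rcases U.eq_empty_or_nonempty with rfl | hne
  -- On an empty layer the stopping rule holds everywhere, so f vanishes on the family.
  · have hc : c = 0 := by
      have : r * c = 0 := by simpa using hU.symm
      rcases Nat.mul_eq_zero.1 this with h | h
      · omega
      · exact h
    have h0 : nsq (indepIn G ∅) f = 0 := by
      refine Finset.sum_eq_zero fun W hW => ?_
      by_contra hcon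
      refine hf W hW (fun h => hcon (by simp [h])) (by simp [hc])
    rw [h0]
    exact mul_nonneg (by positivity) (Finset.sum_nonneg fun v _ => flipEnergy_nonneg _ _ _)
  set l := Nat.log 2 D + 1 with hl
  have hK := two_le_layers hD
  have hrK : (0 : ℝ) < 64 * r * layers D := by
    have : (0 : ℝ) < r := by exact_mod_cast hr
    have : (0 : ℝ) < layers D := by exact_mod_cast (by omega : 0 < layers D)
    positivity
  -- The value 1 is always admissible by the trivial count, and `nsq_le_energy` requires a ≥ 1. The
  -- constant 1024 of the stopping rule is 16 * 64.
  set a : ℝ := max 1 (l / (64 * r * layers D)) with ha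
  have key := nsq_le_energy (G := G) (U := U) (D := D) (a := a) (le_max_left _ _) hne hdeg ?_ f ?_
  · push_cast; exact key
  · intro v _ J hJ
    have h1 : 1 + (indepIn G J).card ≤ D + ∑ S ∈ indepIn G J, S.card := by
      have := card_le_sum_card_add_one (indepIn G J)
      omega
    have h2 := free_block_average (G := G) (J := J) (r := r) hD
      ((Finset.card_le_card (hJ.trans Finset.inter_subset_right)).trans (hdeg v)) hl rfl hr
      (hfree.imp id fun h => SimpleGraph.CliqueFreeOn.subset G
        (Finset.coe_subset.2 (hJ.trans Finset.inter_subset_left)) h)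
    have h1' : (1 : ℝ) + (indepIn G J).card ≤ D + ∑ S ∈ indepIn G J, (S.card : ℝ) := by
      exact_mod_cast h1
    have h2' : (l : ℝ) * (1 + (indepIn G J).card) ≤
        64 * r * layers D * (D + ∑ S ∈ indepIn G J, (S.card : ℝ)) := by exact_mod_cast h2
    rw [ha, max_mul_of_nonneg _ _ (by positivity)]
    refine max_le (by linarith) ?_
    rw [div_mul_eq_mul_div, div_le_iff₀ hrK]
    linarith
  · intro W hW hW0
    have h1 := hf W hW hW0
    have h2 : 1024 * D * layers D * W.card ≤ l * c := by omega
    have h2' : (1024 : ℝ) * D * layers D * W.card ≤ l * c := by exact_mod_cast h2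
    have hUc : (U.card : ℝ) = r * c := by exact_mod_cast hU
    have h3 : l / (64 * r * layers D) * (U.card : ℝ) ≤ a * U.card :=
      mul_le_mul_of_nonneg_right (le_max_right _ _) (by positivity)
    refine le_trans ?_ h3
    rw [hUc, div_mul_eq_mul_div, le_div_iff₀ hrK]
    have hr' : (0 : ℝ) ≤ r := by positivity
    have := mul_le_mul_of_nonneg_left h2' hr'
    linarith

end Certificates

end IndepRelax

namespace IndepRelax

/-! ### A program calculus with running times -/

section Semantics

theorem Exec.det {p : Prog} {s s₁ s₂ : State} {t₁ t₂ : ℕ} (h₁ : Exec p s t₁ s₁)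
    (h₂ : Exec p s t₂ s₂) : t₁ = t₂ ∧ s₁ = s₂ := by
  induction h₁ generalizing t₂ s₂ with
  | const | add | sub | load | store | flip => cases h₂; exact ⟨rfl, rfl⟩
  | seq _ _ ih1 ih2 =>
    cases h₂ with
    | seq hp hq =>
      obtain ⟨rfl, rfl⟩ := ih1 hp
      obtain ⟨rfl, rfl⟩ := ih2 hq
      exact ⟨rfl, rfl⟩
  | ite_true hi _ ih =>
    cases h₂ with
    | ite_true _ hp => obtain ⟨rfl, rfl⟩ := ih hp; exact ⟨rfl, rfl⟩
    | ite_false hi' _ => exact absurd hi' hi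
  | ite_false hi _ ih =>
    cases h₂ with
    | ite_true hi' _ => exact absurd hi hi'
    | ite_false _ hp => obtain ⟨rfl, rfl⟩ := ih hp; exact ⟨rfl, rfl⟩
  | loop_done hi =>
    cases h₂ with
    | loop_done => exact ⟨rfl, rfl⟩
    | loop_step hi' _ _ => exact absurd hi hi'
  | loop_step hi _ _ ih1 ih2 =>
    cases h₂ with
    | loop_done hi' => exact absurd hi' hi
    | loop_step _ hp hl =>
      obtain ⟨rfl, rfl⟩ := ih1 hp
      obtain ⟨rfl, rfl⟩ := ih2 hl
      exact ⟨rfl, rfl⟩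

/-- Started in `s`, the program `p` halts, and its running time and final state satisfy `Q`. -/
def WP (p : Prog) (s : State) (Q : ℕ → State → Prop) : Prop := ∃ t s', Exec p s t s' ∧ Q t s'

theorem WP.mono {p : Prog} {s : State} {Q R : ℕ → State → Prop} (h : WP p s Q)
    (hQR : ∀ t s', Q t s' → R t s') : WP p s R := by
  obtain ⟨t, s', he, hq⟩ := h
  exact ⟨t, s', he, hQR t s' hq⟩

@[simp]
theorem wp_const {i k : ℕ} {s : State} {Q : ℕ → State → Prop} :
    WP (.const i k) s Q ↔ Q 1 (s.setReg i k) :=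
  ⟨fun ⟨_, _, h, hq⟩ => by cases h; exact hq, fun h => ⟨_, _, .const s i k, h⟩⟩

@[simp]
theorem wp_add {i j k : ℕ} {s : State} {Q : ℕ → State → Prop} :
    WP (.add i j k) s Q ↔ Q 1 (s.setReg i (s.reg j + s.reg k)) :=
  ⟨fun ⟨_, _, h, hq⟩ => by cases h; exact hq, fun h => ⟨_, _, .add s i j k, h⟩⟩

@[simp]
theorem wp_sub {i j k : ℕ} {s : State} {Q : ℕ → State → Prop} :
    WP (.sub i j k) s Q ↔ Q 1 (s.setReg i (s.reg j - s.reg k)) :=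
  ⟨fun ⟨_, _, h, hq⟩ => by cases h; exact hq, fun h => ⟨_, _, .sub s i j k, h⟩⟩

@[simp]
theorem wp_load {i a j : ℕ} {s : State} {Q : ℕ → State → Prop} :
    WP (.load i a j) s Q ↔ Q 1 (s.setReg i (s.arr a (s.reg j))) :=
  ⟨fun ⟨_, _, h, hq⟩ => by cases h; exact hq, fun h => ⟨_, _, .load s i a j, h⟩⟩

@[simp]
theorem wp_store {a i j : ℕ} {s : State} {Q : ℕ → State → Prop} :
    WP (.store a i j) s Q ↔ Q 1 (s.setArr a (s.reg i) (s.reg j)) :=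
  ⟨fun ⟨_, _, h, hq⟩ => by cases h; exact hq, fun h => ⟨_, _, .store s a i j, h⟩⟩

@[simp]
theorem wp_flip {i : ℕ} {s : State} {Q : ℕ → State → Prop} :
    WP (.flip i) s Q ↔ Q 1 (s.dropCoin.setReg i (s.coins 0).toNat) :=
  ⟨fun ⟨_, _, h, hq⟩ => by cases h; exact hq, fun h => ⟨_, _, .flip s i, h⟩⟩

@[simp]
theorem wp_seq {p q : Prog} {s : State} {Q : ℕ → State → Prop} :
    WP (.seq p q) s Q ↔ WP p s fun t₁ s₁ => WP q s₁ fun t₂ s₂ => Q (t₁ + t₂) s₂ := by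
  constructor
  · rintro ⟨_, _, h, hq⟩
    cases h with
    | seq h1 h2 => exact ⟨_, _, h1, _, _, h2, hq⟩
  · rintro ⟨_, _, h1, _, _, h2, hq⟩
    exact ⟨_, _, .seq h1 h2, hq⟩

@[simp]
theorem wp_ite {i : ℕ} {p q : Prog} {s : State} {Q : ℕ → State → Prop} :
    WP (.ite i p q) s Q ↔ (s.reg i ≠ 0 → WP p s fun t s' => Q (1 + t) s') ∧
      (s.reg i = 0 → WP q s fun t s' => Q (1 + t) s') := by
  constructor
  · rintro ⟨_, _, h, hq⟩
    cases h with
    | ite_true hi hp => exact ⟨fun _ => ⟨_, _, hp, hq⟩, fun h => absurd h hi⟩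
    | ite_false hi hp => exact ⟨fun h => absurd hi h, fun _ => ⟨_, _, hp, hq⟩⟩
  · rintro ⟨h1, h2⟩
    by_cases hi : s.reg i = 0
    · obtain ⟨_, _, h, hq⟩ := h2 hi
      exact ⟨_, _, .ite_false hi h, hq⟩
    · obtain ⟨_, _, h, hq⟩ := h1 hi
      exact ⟨_, _, .ite_true hi h, hq⟩

@[simp]
theorem reg_setReg (s : State) (i v j : ℕ) :
    (s.setReg i v).reg j = if j = i then v else s.reg j := by
  simp [State.setReg, Function.update_apply]

@[simp]
theorem arr_setReg (s : State) (i v : ℕ) : (s.setReg i v).arr = s.arr := rfl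

@[simp]
theorem coins_setReg (s : State) (i v : ℕ) : (s.setReg i v).coins = s.coins := rfl

@[simp]
theorem reg_setArr (s : State) (a p v : ℕ) : (s.setArr a p v).reg = s.reg := rfl

@[simp]
theorem arr_setArr (s : State) (a p v b q : ℕ) :
    (s.setArr a p v).arr b q = if b = a ∧ q = p then v else s.arr b q := by
  by_cases hb : b = a
  · subst hb
    simp [State.setArr, Function.update_apply]
  · simp [State.setArr, hb]

/-- `s'` differs from `s` at most in registers with numbers at least `k` and in the arrays in `A`. -/
structure Frame (k : ℕ) (A : Set ℕ) (s s' : State) : Prop where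
  reg : ∀ r < k, s'.reg r = s.reg r
  arr : ∀ a, a ∉ A → s'.arr a = s.arr a
  coins : s'.coins = s.coins

theorem Frame.refl (k : ℕ) (A : Set ℕ) (s : State) : Frame k A s s :=
  ⟨fun _ _ => rfl, fun _ _ => rfl, rfl⟩

theorem Frame.trans {k : ℕ} {A : Set ℕ} {s s' s'' : State} (h : Frame k A s s')
    (h' : Frame k A s' s'') : Frame k A s s'' :=
  ⟨fun r hr => (h'.reg r hr).trans (h.reg r hr), fun a ha => (h'.arr a ha).trans (h.arr a ha),
    h'.coins.trans h.coins⟩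

theorem Frame.weaken {k k' : ℕ} {A A' : Set ℕ} {s s' : State} (h : Frame k A s s') (hk : k' ≤ k)
    (hA : A ⊆ A') : Frame k' A' s s' :=
  ⟨fun r hr => h.reg r (by omega), fun a ha => h.arr a fun h' => ha (hA h'), h.coins⟩

theorem Frame.setReg {k : ℕ} {A : Set ℕ} {s s' : State} {i v : ℕ} (h : Frame k A s s')
    (hi : k ≤ i) : Frame k A s (s'.setReg i v) :=
  ⟨fun r hr => by rw [reg_setReg, if_neg (by omega)]; exact h.reg r hr, h.arr, h.coins⟩

theorem Frame.setArr {k : ℕ} {A : Set ℕ} {s s' : State} {a p v : ℕ} (h : Frame k A s s')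
    (ha : a ∈ A) : Frame k A s (s'.setArr a p v) := by
  refine ⟨h.reg, fun b hb => ?_, h.coins⟩
  rw [← h.arr b hb]
  have : b ≠ a := fun e => hb (e ▸ ha)
  simp [State.setArr, this]

@[simp]
theorem frame_setReg {k : ℕ} {A : Set ℕ} {s s' : State} {i v : ℕ} (hi : k ≤ i) :
    Frame k A s (s'.setReg i v) ↔ Frame k A s s' := by
  refine ⟨fun h => ⟨fun r hr => ?_, h.arr, h.coins⟩, fun h => h.setReg hi⟩
  rw [← h.reg r hr, reg_setReg, if_neg (by omega)]

@[simp]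
theorem frame_setArr {k : ℕ} {A : Set ℕ} {s s' : State} {a p v : ℕ} (ha : a ∈ A) :
    Frame k A s (s'.setArr a p v) ↔ Frame k A s s' := by
  refine ⟨fun h => ⟨h.reg, fun b hb => ?_, h.coins⟩, fun h => h.setArr ha⟩
  have : b ≠ a := fun e => hb (e ▸ ha)
  simpa [State.setArr, this] using h.arr b hb

/-- `for r_i := 0, …, r_b - 1 do p`, where `r_f` is scratch and `r_1 = 1`. -/
def Prog.forLt (i f b : ℕ) (p : Prog) : Prog :=
  .seq (.const i 0) (.seq (.sub f b i) (.loop f (.seq p (.seq (.add i i 1) (.sub f b i)))))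

/-- The invariant is required after the counter and the scratch register have been updated. Each
pass adds a test, an addition and a subtraction to the body; the final 3 steps are the two initial
instructions and the last test. -/
theorem wp_forLt {i f b : ℕ} {p : Prog} {s : State} {N T : ℕ} (Inv : ℕ → State → Prop)
    (h1 : s.reg 1 = 1) (hN : s.reg b = N) (hib : i ≠ b) (hi1 : i ≠ 1) (hfb : f ≠ b) (hf1 : f ≠ 1)
    (hfi : f ≠ i) (hinit : Inv 0 ((s.setReg i 0).setReg f N))
    (hstep : ∀ m < N, ∀ s', Inv m s' → s'.reg i = m → s'.reg b = N → s'.reg 1 = 1 →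
      WP p s' fun t s'' => t ≤ T ∧ s''.reg i = m ∧ s''.reg b = N ∧ s''.reg 1 = 1 ∧
        Inv (m + 1) ((s''.setReg i (m + 1)).setReg f (N - (m + 1)))) :
    WP (.forLt i f b p) s fun t s' => t ≤ N * (T + 3) + 3 ∧ Inv N s' := by
  have hloop : ∀ k m s', m + k = N → Inv m s' → s'.reg i = m → s'.reg b = N → s'.reg 1 = 1 →
      s'.reg f = N - m →
      WP (.loop f (.seq p (.seq (.add i i 1) (.sub f b i)))) s' fun t s'' =>
        t ≤ k * (T + 3) + 1 ∧ Inv N s'' := by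
    intro k
    induction k with
    | zero =>
      intro m s' hm hI hi hb h1 hf
      obtain rfl : m = N := by omega
      exact ⟨1, s', .loop_done (by omega), by omega, hI⟩
    | succ k ih =>
      intro m s' hm hI hi hb h1 hf
      obtain ⟨t, s₁, he, ht, hi₁, hb₁, h1₁, hI₁⟩ := hstep m (by omega) s' hI hi hb h1
      set s₂ := (s₁.setReg i (m + 1)).setReg f (N - (m + 1)) with hs₂
      obtain ⟨t', s₃, he', ht', hI'⟩ := ih (m + 1) s₂ (by omega) hI₁
        (by simp [hs₂, reg_setReg, hfi.symm]) (by simp [hs₂, reg_setReg, hfb.symm, hib.symm, hb₁])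
        (by simp [hs₂, reg_setReg, hf1.symm, hi1.symm, h1₁]) (by simp [hs₂, reg_setReg])
      have hbody : Exec (.seq p (.seq (.add i i 1) (.sub f b i))) s' (t + (1 + 1)) s₂ := by
        refine .seq he (.seq (.add _ _ _ _) ?_)
        rw [hi₁, h1₁]
        have := Exec.sub (s₁.setReg i (m + 1)) f b i
        simpa [reg_setReg, hib.symm, hb₁, ← hs₂] using this
      refine ⟨_, s₃, .loop_step (by omega) hbody he', ?_, hI'⟩
      have : (k + 1) * (T + 3) = k * (T + 3) + (T + 3) := by ring
      omega
  rw [Prog.forLt, wp_seq, wp_const, wp_seq, wp_sub]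
  simp only [reg_setReg, if_true, if_neg hib.symm, hN, Nat.sub_zero]
  refine (hloop N 0 _ (by omega) hinit (by simp [reg_setReg, hfi.symm])
    (by simp [reg_setReg, hfb.symm, hib.symm, hN]) (by simp [reg_setReg, hf1.symm, hi1.symm, h1])
    (by simp [reg_setReg])).mono ?_
  rintro t s' ⟨ht, hI⟩
  exact ⟨by omega, hI⟩

end Semantics

end IndepRelax

namespace IndepRelax

/-! ### Basic subroutines: row offsets, degrees, powers, halves, logarithms -/

section Fragments

/-- An instruction that only overwrites a scratch register. -/
def Prog.skip : Prog := .const 35 0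

@[simp]
theorem wp_skip {s : State} {Q : ℕ → State → Prop} : WP .skip s Q ↔ Q 1 (s.setReg 35 0) := wp_const

/-- `r_30 := ∑ w < n, if A_a[w] ≠ 0 then A_0[A_2[r_u] + w] else 0` -/
def Prog.adjSum (a u : ℕ) : Prog :=
  .seq (.const 30 0) (.forLt 31 32 0
    (.seq (.load 33 a 31) (.ite 33
      (.seq (.load 33 2 u) (.seq (.add 33 33 31) (.seq (.load 33 0 33) (.add 30 30 33))))
      .skip)))

theorem wp_adjSum {a u : ℕ} {s : State} (hu : u < 30) (h1 : s.reg 1 = 1) :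
    WP (.adjSum a u) s fun t s' => t ≤ 9 * s.reg 0 + 4 ∧ Frame 30 ∅ s s' ∧
      s'.reg 30 = ∑ w ∈ Finset.range (s.reg 0),
        if s.arr a w = 0 then 0 else s.arr 0 (s.arr 2 (s.reg u) + w) := by
  rw [Prog.adjSum, wp_seq, wp_const]
  refine (wp_forLt (N := s.reg 0) (T := 6) (fun m s' => Frame 30 ∅ s s' ∧
    s'.reg 30 = ∑ w ∈ Finset.range m,
      if s.arr a w = 0 then 0 else s.arr 0 (s.arr 2 (s.reg u) + w)) ?_ ?_ (by norm_num)
      (by norm_num) (by norm_num) (by norm_num) (by norm_num) ?_ ?_).mono ?_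
  · simpa using h1
  · simp
  · simp [Frame.refl]
  · rintro m hm s' ⟨hF, hs⟩ hi hN h1'
    have e0 := hF.arr 0 (by simp)
    have ea := hF.arr a (by simp)
    have e2 := hF.arr 2 (by simp)
    have eu := hF.reg u hu
    have hu33 : u ≠ 33 := by omega
    simp +contextual [hi, ea, e0, e2, Finset.sum_range_succ, hs, hu33, eu, hF, h1', hN]
  · rintro t s' ⟨ht, hF, hs⟩
    exact ⟨by omega, hF, hs⟩

variable {n : ℕ}

open Classical in
/-- The state holds `n`, the constant `1`, the adjacency matrix of `G`, the offsets of its rows, and an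
array of ones. -/
structure Ready (G : SimpleGraph (Fin n)) (s : State) : Prop where
  size : s.reg 0 = n
  one : s.reg 1 = 1
  adj : ∀ v w : Fin n, s.arr 0 (v * n + w) = if G.Adj v w then 1 else 0
  row : ∀ v : Fin n, s.arr 2 v = v * n
  ones : ∀ v : Fin n, s.arr 7 v = 1

theorem Ready.frame {G : SimpleGraph (Fin n)} {s s' : State} (h : Ready G s) {k : ℕ} {A : Set ℕ}
    (hF : Frame k A s s') (hk : 2 ≤ k) (h0 : 0 ∉ A) (h2 : 2 ∉ A) (h7 : 7 ∉ A) : Ready G s' where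
  size := (hF.reg 0 (by omega)).trans h.size
  one := (hF.reg 1 (by omega)).trans h.one
  adj := by rw [hF.arr 0 h0]; exact h.adj
  row := by rw [hF.arr 2 h2]; exact h.row
  ones := by rw [hF.arr 7 h7]; exact h.ones

/-- Array `a` is the indicator function of `M`. -/
def Marks (a : ℕ) (M : Finset (Fin n)) (s : State) : Prop :=
  ∀ w : Fin n, s.arr a w = if w ∈ M then 1 else 0

@[simp]
theorem marks_setReg {a i v : ℕ} {M : Finset (Fin n)} {s : State} :
    Marks a M (s.setReg i v) ↔ Marks a M s := Iff.rfl

theorem marks_insert {a p q : ℕ} {M : Finset (Fin n)} {s : State} (h : Marks a M s) {v : Fin n}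
    (hp : p = v) (hq : q = 1) : Marks a (insert v M) (s.setArr a p q) := by
  intro w
  have := h w
  by_cases hw : w = v
  · simp [hw, hp, hq]
  · have hw' : (w : ℕ) ≠ v := fun h => hw (Fin.ext h)
    simp [hp, hw, hw', this]

theorem marks_erase {a p q : ℕ} {M : Finset (Fin n)} {s : State} (h : Marks a M s) {v : Fin n}
    (hp : p = v) (hq : q = 0) : Marks a (M.erase v) (s.setArr a p q) := by
  intro w
  have := h w
  by_cases hw : w = v
  · simp [hw, hp, hq]
  · have hw' : (w : ℕ) ≠ v := fun h => hw (Fin.ext h)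
    simp [hp, hw, hw', this]

theorem Marks.congr {a : ℕ} {M : Finset (Fin n)} {s s' : State} (h : Marks a M s)
    (he : s'.arr a = s.arr a) : Marks a M s' := by
  intro w; rw [he]; exact h w

theorem wp_adjSum_card {G : SimpleGraph (Fin n)} {a u : ℕ} {s : State} (hu : u < 30)
    (hR : Ready G s) {v : Fin n} (hv : s.reg u = v) {M : Finset (Fin n)} (hM : Marks a M s) :
    WP (.adjSum a u) s fun t s' => t ≤ 9 * n + 4 ∧ Frame 30 ∅ s s' ∧
      s'.reg 30 = (M ∩ nbrs G v).card := by
  refine (wp_adjSum (a := a) hu hR.one).mono fun t s' => ?_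
  rintro ⟨ht, hF, hs⟩
  rw [hR.size] at ht hs
  refine ⟨ht, hF, hs.trans ?_⟩
  rw [Finset.sum_range, hv, hR.row, Finset.card_eq_sum_ones, ← Finset.filter_mem_eq_inter,
    Finset.sum_filter, ← Finset.sum_subset (Finset.subset_univ M)]
  · refine Finset.sum_congr rfl fun w hw => ?_
    rw [hM w, if_pos hw, if_neg one_ne_zero, hR.adj]
    by_cases h : G.Adj v w
    · rw [if_pos h, if_pos (mem_nbrs.2 h)]
    · rw [if_neg h, if_neg fun h' => h (mem_nbrs.1 h')]
  · intro w _ hw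
    rw [hM w, if_neg hw, if_pos rfl]

/-- Sets `r_1 := 1`, and fills the arrays of row offsets and of ones. -/
def Prog.rows : Prog :=
  .seq (.const 1 1) (.seq (.const 9 0) (.forLt 10 11 0
    (.seq (.store 2 10 9) (.seq (.add 9 9 0) (.store 7 10 1)))))

theorem wp_rows (G : SimpleGraph (Fin n)) (ω : ℕ → Bool) :
    WP .rows (initState G ω) fun t s' => t ≤ 6 * n + 5 ∧ Ready G s' ∧
      (∀ a, a ≠ 0 → a ≠ 2 → a ≠ 7 → s'.arr a = fun _ => 0) ∧ s'.coins = ω := by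
  classical
  set s := initState G ω with hs
  have hn : s.reg 0 = n := by simp [hs, initState]
  rw [Prog.rows, wp_seq, wp_const, wp_seq, wp_const]
  refine (wp_forLt (N := n) (T := 3) (fun m s' => Frame 9 {2, 7} (s.setReg 1 1) s' ∧
    s'.reg 9 = m * n ∧ ∀ i < m, s'.arr 2 i = i * n ∧ s'.arr 7 i = 1) ?_ ?_ (by norm_num)
      (by norm_num) (by norm_num) (by norm_num) (by norm_num) ?_ ?_).mono ?_
  · simp
  · simp [hn]
  · simp [Frame.refl]
  · rintro m hm s' ⟨hF, h9, hi⟩ hm' hN h1'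
    simp [hm', hN, h1', hF, h9]
    refine ⟨by ring, fun i him => ?_⟩
    split_ifs with h
    · simp [h]
    · exact ⟨(hi i (by omega)).1, fun _ => (hi i (by omega)).2⟩
  · rintro t s' ⟨ht, hF, h9, hi⟩
    refine ⟨by omega, ⟨?_, ?_, ?_, fun v => (hi v v.2).1, fun v => (hi v v.2).2⟩, ?_, ?_⟩
    · rw [hF.reg 0 (by norm_num)]; simpa using hn
    · rw [hF.reg 1 (by norm_num)]; simp
    · intro v w
      rw [hF.arr 0 (by simp)]
      -- The position in the matrix determines the pair, by division with remainder by n.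
      have key : (∃ i j : Fin n, G.Adj i j ∧ (v : ℕ) * n + w = i * n + j) ↔ G.Adj v w := by
        constructor
        · rintro ⟨i, j, h, he⟩
          have h1 : (v : ℕ) = i := by
            have e1 : ((v : ℕ) * n + w) / n = v := by
              rw [mul_comm, Nat.mul_add_div (by omega), Nat.div_eq_of_lt w.2, add_zero]
            have e2 : ((i : ℕ) * n + j) / n = i := by
              rw [mul_comm, Nat.mul_add_div (by omega), Nat.div_eq_of_lt j.2, add_zero]
            rw [← e1, he, e2]
          have h2 : (w : ℕ) = j := by rw [h1] at he; omega
          rwa [Fin.ext h1, Fin.ext h2]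
        · exact fun h => ⟨v, w, h, rfl⟩
      simp only [hs, initState, arr_setReg, true_and, key]
    · intro a h0 h2 h7
      rw [hF.arr a (by simp [h2, h7])]
      funext p
      simp [hs, initState, h0]
    · rw [hF.coins]; rfl

/-- `r_2` becomes the maximum of `16` and the maximum degree. -/
def Prog.degree : Prog :=
  .seq (.const 2 16) (.forLt 14 15 0 (.seq (.adjSum 7 14) (.seq (.sub 30 30 2) (.add 2 2 30))))

theorem wp_degree {G : SimpleGraph (Fin n)} {s : State} (hR : Ready G s) :
    WP .degree s fun t s' => t ≤ n * (9 * n + 9) + 4 ∧ Frame 2 ∅ s s' ∧ 16 ≤ s'.reg 2 ∧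
      (∀ v, (nbrs G v).card ≤ s'.reg 2) ∧ (s'.reg 2 = 16 ∨ ∃ v, s'.reg 2 = (nbrs G v).card) := by
  rw [Prog.degree, wp_seq, wp_const]
  refine (wp_forLt (N := n) (T := 9 * n + 6) (fun m s' => Frame 2 ∅ s s' ∧ 16 ≤ s'.reg 2 ∧
      (∀ v : Fin n, v < m → (nbrs G v).card ≤ s'.reg 2) ∧
      (s'.reg 2 = 16 ∨ ∃ v, s'.reg 2 = (nbrs G v).card)) ?_ ?_ (by norm_num)
      (by norm_num) (by norm_num) (by norm_num) (by norm_num) ?_ ?_).mono ?_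
  · simpa using hR.one
  · simpa using hR.size
  · simp [Frame.refl]
  · rintro m hm s' ⟨hF, h16, hle, hex⟩ hm' hN h1'
    have hR' := hR.frame hF le_rfl (by simp) (by simp) (by simp)
    rw [wp_seq]
    refine (wp_adjSum_card (v := ⟨m, hm⟩) (M := Finset.univ) (by norm_num) hR' hm' ?_).mono ?_
    · intro w; simp [hR'.ones]
    · rintro t s₁ ⟨ht, hF₁, h30⟩
      rw [Finset.univ_inter] at h30
      have e14 := hF₁.reg 14 (by norm_num)
      have e0 := hF₁.reg 0 (by norm_num)
      have e1 := hF₁.reg 1 (by norm_num)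
      have e2 := hF₁.reg 2 (by norm_num)
      have hF2 : Frame 2 ∅ s s₁ := hF.trans (hF₁.weaken (by norm_num) subset_rfl)
      simp [e14, e0, e1, e2, hm', hN, h1', h30, hF2]
      refine ⟨by omega, by omega, fun v hv => ?_, ?_⟩
      · rcases Nat.lt_or_eq_of_le hv with h | h
        · have := hle v h
          omega
        · have : v = ⟨m, hm⟩ := Fin.ext h
          rw [this]; omega
      · rcases le_total (nbrs G ⟨m, hm⟩).card (s'.reg 2) with h | h
        · rw [Nat.sub_eq_zero_of_le h, add_zero]; exact hex
        · exact Or.inr ⟨⟨m, hm⟩, by omega⟩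
  · rintro t s' ⟨ht, hF, h16, hle, hex⟩
    have e : 9 * n + 6 + 3 = 9 * n + 9 := rfl
    rw [e] at ht
    exact ⟨by omega, hF, h16, fun v => hle v v.2, hex⟩

/-- Fills `A_3` with the powers `2 ^ i` for `i < D`, and sets `r_8 := 2 ^ D`. -/
def Prog.powers : Prog :=
  .seq (.const 8 1) (.forLt 10 11 2 (.seq (.store 3 10 8) (.add 8 8 8)))

theorem wp_powers {s : State} (h1 : s.reg 1 = 1) :
    WP .powers s fun t s' => t ≤ 5 * s.reg 2 + 4 ∧ Frame 8 {3} s s' ∧ s'.reg 8 = 2 ^ s.reg 2 ∧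
      ∀ i < s.reg 2, s'.arr 3 i = 2 ^ i := by
  rw [Prog.powers, wp_seq, wp_const]
  refine (wp_forLt (N := s.reg 2) (T := 2) (fun m s' => Frame 8 {3} s s' ∧ s'.reg 8 = 2 ^ m ∧
      ∀ i < m, s'.arr 3 i = 2 ^ i) ?_ ?_ (by norm_num)
      (by norm_num) (by norm_num) (by norm_num) (by norm_num) ?_ ?_).mono ?_
  · simpa using h1
  · simp
  · simp [Frame.refl]
  · rintro m hm s' ⟨hF, h8, hi⟩ hm' hN h1'
    simp [hm', hN, h1', h8, hF]
    refine ⟨by ring, fun i him => ?_⟩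
    split_ifs with h
    · rw [h]
    · exact hi i (by omega)
  · rintro t s' ⟨ht, h⟩
    exact ⟨by omega, h⟩

/-- Fills `A_6` with the values `i / 2` for `i < 2 * r_8`. -/
def Prog.halves : Prog :=
  .seq (.const 9 0) (.forLt 10 11 8
    (.seq (.store 6 9 10) (.seq (.add 9 9 1) (.seq (.store 6 9 10) (.add 9 9 1)))))

theorem wp_halves {s : State} (h1 : s.reg 1 = 1) :
    WP .halves s fun t s' => t ≤ 7 * s.reg 8 + 4 ∧ Frame 9 {6} s s' ∧
      ∀ i < 2 * s.reg 8, s'.arr 6 i = i / 2 := by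
  rw [Prog.halves, wp_seq, wp_const]
  refine (wp_forLt (N := s.reg 8) (T := 4) (fun m s' => Frame 9 {6} s s' ∧ s'.reg 9 = 2 * m ∧
      ∀ i < 2 * m, s'.arr 6 i = i / 2) ?_ ?_ (by norm_num)
      (by norm_num) (by norm_num) (by norm_num) (by norm_num) ?_ ?_).mono ?_
  · simpa using h1
  · simp
  · simp [Frame.refl]
  · rintro m hm s' ⟨hF, h8, hi⟩ hm' hN h1'
    simp [hm', hN, h1', h8, hF]
    refine ⟨by ring, fun i him => ?_⟩
    split_ifs with h h'
    · omega
    · omega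
    · exact hi i (by omega)
  · rintro t s' ⟨ht, hF, -, h⟩
    exact ⟨by omega, hF, h⟩

/-- `r_o` becomes the number of `i < D` with `2 ^ i ≤ r_x`. -/
def Prog.countPow (o x : ℕ) : Prog :=
  .seq (.const o 0) (.forLt 10 11 2 (.seq (.load 12 3 10) (.seq (.sub 12 12 x)
    (.ite 12 .skip (.add o o 1)))))

theorem wp_countPow {o x : ℕ} {s : State} (hxo : x < o) (ho : o < 10) (hx2 : 2 ≤ x)
    (h1 : s.reg 1 = 1) (h3 : ∀ i < s.reg 2, s.arr 3 i = 2 ^ i) (hx0 : 1 ≤ s.reg x)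
    (hxD : s.reg x < 2 ^ s.reg 2) :
    WP (.countPow o x) s fun t s' => t ≤ 7 * s.reg 2 + 4 ∧ Frame o ∅ s s' ∧
      s'.reg o = Nat.log 2 (s.reg x) + 1 := by
  -- The powers 2^i ≤ x are those with i ≤ log₂ x, and x < 2^D ensures that the table contains them
  -- all.
  have hcount : ∑ i ∈ Finset.range (s.reg 2), (if 2 ^ i ≤ s.reg x then 1 else 0) =
      Nat.log 2 (s.reg x) + 1 := by
    rw [← Finset.card_filter]
    have : (Finset.range (s.reg 2)).filter (fun i => 2 ^ i ≤ s.reg x) =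
        Finset.range (Nat.log 2 (s.reg x) + 1) := by
      ext i
      rw [Finset.mem_filter, Finset.mem_range, Finset.mem_range, Nat.lt_succ_iff,
        Nat.le_log_iff_pow_le (by norm_num) (by omega)]
      refine ⟨fun h => h.2, fun h => ⟨?_, h⟩⟩
      exact (Nat.pow_lt_pow_iff_right (by norm_num)).1 (h.trans_lt hxD)
    rw [this, Finset.card_range]
  rw [Prog.countPow, wp_seq, wp_const]
  refine (wp_forLt (N := s.reg 2) (T := 4) (fun m s' => Frame o ∅ s s' ∧
    s'.reg o = ∑ i ∈ Finset.range m, if 2 ^ i ≤ s.reg x then 1 else 0) ?_ ?_ (by norm_num)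
      (by norm_num) (by norm_num) (by norm_num) (by norm_num) ?_ ?_).mono ?_
  · simp [h1]; omega
  · simp; omega
  · have a1 : o ≤ 10 := by omega
    have a2 : o ≤ 11 := by omega
    have a3 : o ≠ 10 := by omega
    have a4 : o ≠ 11 := by omega
    simp [Frame.refl, a1, a2, a3, a4]
  · rintro m hm s' ⟨hF, hs⟩ hm' hN h1'
    have e3 := hF.arr 3 (by simp)
    have ex := hF.reg x hxo
    have a1 : o ≤ 10 := by omega
    have a2 : o ≤ 11 := by omega
    have a3 : o ≤ 12 := by omega
    have a4 : o ≤ 35 := by omega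
    have b1 : o ≠ 10 := by omega
    have b2 : o ≠ 11 := by omega
    have b3 : o ≠ 12 := by omega
    have b4 : o ≠ 35 := by omega
    have c1 : x ≠ 12 := by omega
    have d1 : 1 ≠ o := by omega
    have d2 : 2 ≠ o := by omega
    have d3 : 10 ≠ o := by omega
    have key : 2 ^ m - s.reg x = 0 ↔ 2 ^ m ≤ s.reg x := Nat.sub_eq_zero_iff_le
    simp [hm', hN, h1', hF, e3, h3 m hm, ex, a1, a2, a3, a4, b1, b2, b3, b4, c1, d1, d2, d3, hs,
      Finset.sum_range_succ, -Finset.sum_boole]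
    refine ⟨fun h => ?_, fun h => ?_⟩
    · omega
    · omega
  · rintro t s' ⟨ht, hF, hs⟩
    exact ⟨by omega, hF, hs.trans hcount⟩

end Fragments

end IndepRelax

namespace IndepRelax

/-! ### Enumerating the cliques at a vertex by binary codes -/

section Decode

variable {n : ℕ}

open Classical in
/-- A set `S` of neighbours of `v` as a binary number; the digits belong to the neighbours of `v` in
the list, the least significant digit to the first of them. -/
noncomputable def code (G : SimpleGraph (Fin n)) (v : Fin n) (S : Finset (Fin n)) :
    List (Fin n) → ℕ
  | [] => 0
  | u :: l => if G.Adj v u then 2 * code G v S l + (if u ∈ S then 1 else 0) else code G v S l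

/-- There is one digit per neighbour, so the codes below 2^D reach all cliques at a vertex. -/
theorem code_lt (G : SimpleGraph (Fin n)) (v : Fin n) (S : Finset (Fin n)) {l : List (Fin n)}
    (hl : l.Nodup) : code G v S l < 2 ^ (l.toFinset ∩ nbrs G v).card := by
  classical
  induction l with
  | nil => simp [code]
  | cons u l ih =>
    obtain ⟨hu, hl⟩ := List.nodup_cons.1 hl
    have ih := ih hl
    rw [code, List.toFinset_cons]
    split_ifs with h
    all_goals first
      | rw [Finset.insert_inter_of_mem (mem_nbrs.2 h),
          Finset.card_insert_of_notMem (by simp [hu]), pow_succ]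
        omega
      | rwa [Finset.insert_inter_of_notMem fun h' => h (mem_nbrs.1 h')]

/-- The state of the greedy decoding of `c` to a clique of vertices with label `0` that contains `v`,
before it reaches the vertex `m`: the clique is `M`, and the digits that are left form `x`. -/
structure Decoding (G : SimpleGraph (Fin n)) (lab : Fin n → ℕ) (v : Fin n) (P c m : ℕ)
    (M : Finset (Fin n)) (x : ℕ) : Prop where
  mem : v ∈ M
  clique : G.IsClique (M : Set (Fin n))
  alive : ∀ u ∈ M, lab u = 0
  seen : ∀ u ∈ M, (u : ℕ) < m ∨ u = v
  bound : x < P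
  complete : ∀ S : Finset (Fin n), G.IsClique (S : Set (Fin n)) → v ∈ S → (∀ u ∈ S, lab u = 0) →
    code G v S (List.finRange n) = c →
    x = code G v S ((List.finRange n).drop m) ∧ M = S.filter fun u : Fin n => (u : ℕ) < m ∨ u = v

variable {G : SimpleGraph (Fin n)} {lab : Fin n → ℕ} {v : Fin n} {P c m : ℕ}
  {M : Finset (Fin n)} {x : ℕ}

theorem Decoding.init (hv : lab v = 0) (hc : c < P) : Decoding G lab v P c 0 {v} c where
  mem := Finset.mem_singleton_self v
  clique := by simp
  alive := by simpa using hv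
  seen := by simp
  bound := hc
  complete := by
    intro S _ hvS _ hS
    refine ⟨by simpa using hS.symm, ?_⟩
    ext u
    simp only [Finset.mem_singleton, Finset.mem_filter, Nat.not_lt_zero, false_or]
    exact ⟨fun h => ⟨h ▸ hvS, h⟩, fun h => h.2⟩

theorem drop_finRange (hm : m < n) :
    (List.finRange n).drop m = ⟨m, hm⟩ :: (List.finRange n).drop (m + 1) := by
  rw [List.drop_eq_getElem_cons (by simpa using hm)]
  simp

theorem filter_lt_succ (S : Finset (Fin n)) (hm : m < n) :
    (S.filter fun u : Fin n => (u : ℕ) < m + 1 ∨ u = v) =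
      (S.filter fun u : Fin n => (u : ℕ) < m ∨ u = v) ∪ S.filter fun u => u = ⟨m, hm⟩ := by
  ext u
  simp only [Finset.mem_filter, Finset.mem_union, Fin.ext_iff]
  constructor
  · rintro ⟨h, h1 | h1⟩
    · rcases Nat.lt_or_eq_of_le (Nat.lt_succ_iff.1 h1) with h2 | h2
      · exact Or.inl ⟨h, Or.inl h2⟩
      · exact Or.inr ⟨h, h2⟩
    · exact Or.inl ⟨h, Or.inr h1⟩
  · rintro (⟨h, h1⟩ | ⟨h, h1⟩)
    · exact ⟨h, h1.imp (fun h => by omega) id⟩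
    · exact ⟨h, Or.inl (by omega)⟩

theorem filter_lt_succ_of_notMem (S : Finset (Fin n)) (hm : m < n)
    (h : (⟨m, hm⟩ : Fin n) ∈ S → (⟨m, hm⟩ : Fin n) = v) :
    (S.filter fun u : Fin n => (u : ℕ) < m + 1 ∨ u = v) = S.filter fun u : Fin n => (u : ℕ) < m ∨ u = v := by
  rw [filter_lt_succ S hm, Finset.union_eq_left]
  intro u hu
  obtain ⟨h1, rfl⟩ := Finset.mem_filter.1 hu
  exact Finset.mem_filter.2 ⟨h1, Or.inr (h h1)⟩

theorem Decoding.skip (h : Decoding G lab v P c m M x) (hm : m < n) (hvm : ¬ G.Adj v ⟨m, hm⟩) :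
    Decoding G lab v P c (m + 1) M x where
  mem := h.mem
  clique := h.clique
  alive := h.alive
  seen u hu := (h.seen u hu).imp (fun h => by omega) id
  bound := h.bound
  complete := by
    intro S hS hvS hal hc
    obtain ⟨h1, h2⟩ := h.complete S hS hvS hal hc
    rw [drop_finRange hm, code, if_neg hvm] at h1
    refine ⟨h1, ?_⟩
    rw [filter_lt_succ_of_notMem S hm, h2]
    intro hmem
    by_contra hne
    exact hvm (hS hvS hmem (Ne.symm hne))

theorem Decoding.take (h : Decoding G lab v P c m M x) (hm : m < n) (hvm : G.Adj v ⟨m, hm⟩)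
    (hx : x % 2 = 1) (hlab : lab ⟨m, hm⟩ = 0) (hM : M ⊆ nbrs G ⟨m, hm⟩) :
    (⟨m, hm⟩ : Fin n) ∉ M ∧ Decoding G lab v P c (m + 1) (insert ⟨m, hm⟩ M) (x / 2) where
  left := fun h' => (mem_nbrs.1 (hM h')).ne rfl
  right :=
  { mem := Finset.mem_insert_of_mem h.mem
    clique := by
      rw [Finset.coe_insert]
      exact h.clique.insert fun b hb _ => mem_nbrs.1 (hM hb)
    alive := by
      intro u hu
      rcases Finset.mem_insert.1 hu with rfl | hu
      · exact hlab
      · exact h.alive u hu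
    seen := by
      intro u hu
      rcases Finset.mem_insert.1 hu with rfl | hu
      · exact Or.inl (Nat.lt_succ_self m)
      · exact (h.seen u hu).imp (fun h => by omega) id
    bound := lt_of_le_of_lt (Nat.div_le_self _ _) h.bound
    complete := by
      intro S hS hvS hal hc
      obtain ⟨h1, h2⟩ := h.complete S hS hvS hal hc
      rw [drop_finRange hm, code, if_pos hvm] at h1
      by_cases hmS : (⟨m, hm⟩ : Fin n) ∈ S
      · rw [if_pos hmS] at h1
        refine ⟨by omega, ?_⟩
        rw [filter_lt_succ S hm, ← h2, Finset.filter_eq', if_pos hmS, Finset.union_comm]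
        rfl
      · rw [if_neg hmS] at h1
        omega }

/-- Rejecting an invalid digit loses no clique. If S is an unlabelled clique with code c, then M is
its part seen so far; a member m of S would have digit 1, label 0 and be adjacent to all of M. -/
theorem Decoding.drop (h : Decoding G lab v P c m M x) (hm : m < n) (hvm : G.Adj v ⟨m, hm⟩)
    (hx : x % 2 = 0 ∨ lab ⟨m, hm⟩ ≠ 0 ∨ ¬ M ⊆ nbrs G ⟨m, hm⟩) :
    Decoding G lab v P c (m + 1) M (x / 2) where
  mem := h.mem
  clique := h.clique
  alive := h.alive
  seen u hu := (h.seen u hu).imp (fun h => by omega) id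
  bound := lt_of_le_of_lt (Nat.div_le_self _ _) h.bound
  complete := by
    intro S hS hvS hal hc
    obtain ⟨h1, h2⟩ := h.complete S hS hvS hal hc
    rw [drop_finRange hm, code, if_pos hvm] at h1
    have hmS : (⟨m, hm⟩ : Fin n) ∉ S := by
      intro hmS
      rw [if_pos hmS] at h1
      rcases hx with hx | hx | hx
      · omega
      · exact hx (hal _ hmS)
      · refine hx fun w hw => ?_
        rw [h2, Finset.mem_filter] at hw
        refine mem_nbrs.2 (hS hmS hw.1 ?_)
        rintro rfl
        rcases hw.2 with h' | h'
        · exact absurd h' (Nat.lt_irrefl m)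
        · exact hvm.ne h'.symm
    rw [if_neg hmS] at h1
    refine ⟨by omega, ?_⟩
    rw [filter_lt_succ_of_notMem S hm fun h' => absurd h' hmS, h2]

/-- Decodes `r_16` to a clique that contains the vertex `r_14` and consists of vertices with label `0`;
the clique is marked in `A_5`, and `r_19` is its size. -/
def Prog.decode : Prog :=
  .seq (.const 26 0) (.seq (.add 26 26 16) (.seq (.store 5 14 1) (.seq (.const 19 1) (.forLt 20 21 0
    (.seq (.load 22 2 14) (.seq (.add 22 22 20) (.seq (.load 22 0 22) (.ite 22
      (.seq (.load 23 6 26) (.seq (.add 24 23 23) (.seq (.sub 24 26 24) (.seq (.const 26 0)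
        (.seq (.add 26 26 23) (.ite 24
          (.seq (.load 25 4 20) (.ite 25 .skip (.seq (.adjSum 5 20) (.seq (.sub 30 19 30)
            (.ite 30 .skip (.seq (.store 5 20 1) (.add 19 19 1)))))))
          .skip))))))
      .skip))))))))

theorem wp_decode {s : State} (hR : Ready G s) (hv : s.reg 14 = v)
    (hc : s.reg 16 < s.reg 8) (hhalf : ∀ i < 2 * s.reg 8, s.arr 6 i = i / 2) (hmark : Marks 5 (∅ : Finset (Fin n)) s)
    (hlab : ∀ u : Fin n, s.arr 4 u = lab u) (hv0 : lab v = 0) :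
    WP .decode s fun t s' => t ≤ n * (9 * n + 30) + 10 ∧ Frame 19 {5} s s' ∧
      ∃ M x, Marks 5 M s' ∧ s'.reg 19 = M.card ∧ Decoding G lab v (s.reg 8) (s.reg 16) n M x := by
  rw [Prog.decode, wp_seq, wp_const, wp_seq, wp_add, wp_seq, wp_store, wp_seq, wp_const]
  refine (wp_forLt (N := n) (T := 9 * n + 25) (fun m s' => Frame 19 {5} s s' ∧
    ∃ M, Marks 5 M s' ∧ s'.reg 19 = M.card ∧
      Decoding G lab v (s.reg 8) (s.reg 16) m M (s'.reg 26)) ?_ ?_ (by norm_num)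
      (by norm_num) (by norm_num) (by norm_num) (by norm_num) ?_ ?_).mono ?_
  · simp [hR.one]
  · simp [hR.size]
  · refine ⟨by simp [Frame.refl], {v}, fun w => ?_, by simp, by simpa using Decoding.init hv0 hc⟩
    have := hmark w
    simp only [Finset.notMem_empty, if_false] at this
    simp [hv, hR.one, this, Fin.ext_iff]
  · rintro m hm s' ⟨hF, M, hM, h19, hD⟩ hm' hN h1'
    have hR' := hR.frame hF (by norm_num) (by simp) (by simp) (by simp)
    have e14 : s'.reg 14 = v := (hF.reg 14 (by norm_num)).trans hv
    have e6 := hF.arr 6 (by simp)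
    have e4 := hF.arr 4 (by simp)
    have erow := hR'.row v
    have eadj := hR'.adj v ⟨m, hm⟩
    have hx := hD.bound
    have ehalf : s'.arr 6 (s'.reg 26) = s'.reg 26 / 2 := by
      rw [e6]; exact hhalf _ (by omega)
    have hlm : s'.arr 4 m = lab ⟨m, hm⟩ := by
      rw [e4]; exact hlab ⟨m, hm⟩
    -- Division by 2 is a lookup in the table A_6, and parity follows by subtraction.
    have e24 : s'.reg 26 - (s'.reg 26 / 2 + s'.reg 26 / 2) = s'.reg 26 % 2 := by omega
    by_cases hadj : G.Adj v ⟨m, hm⟩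
    · simp only [hadj, if_true] at eadj
      simp [hm', hN, h1', e14, erow, eadj, ehalf, hlm, e24, hF]
      refine ⟨fun hx1 => ⟨fun hl => ?_, fun hl => ?_⟩, fun hx0 => ?_⟩
      · exact ⟨M, hM, h19, hD.drop hm hadj (Or.inr (Or.inl hl))⟩
      · refine (wp_adjSum_card (u := 20) (v := ⟨m, hm⟩) (M := M) (by norm_num) (hR'.frame (k := 19)
          (A := ∅) ?_ (by norm_num) (by simp) (by simp) (by simp)) ?_ ?_).mono ?_
        · simp [Frame.refl]
        · simp [hm']
        · simpa using hM
        rintro t s₂ ⟨ht, hF₂, h30⟩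
        have hF3 : Frame 19 {5} s s₂ :=
          Frame.trans (by simpa using hF) (hF₂.weaken (by norm_num) (by simp))
        have e0 := hF₂.reg 0 (by norm_num)
        have e1 := hF₂.reg 1 (by norm_num)
        have e18 := hF₂.reg 26 (by norm_num)
        have e19 := hF₂.reg 19 (by norm_num)
        have e20 := hF₂.reg 20 (by norm_num)
        have e5 := hF₂.arr 5 (by simp)
        simp at e0 e1 e18 e19 e20 e5
        have hM₂ : Marks 5 M s₂ := hM.congr e5
        rw [e0, e1, e18, e19, e20, hm', hN, h1', h19, h30]
        -- Register 30 now holds |M| - |M ∩ N(m)|, which is zero exactly if m is adjacent to all of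
        -- M.
        refine ⟨fun hne => ⟨by omega, rfl, rfl, rfl, hF3, M, by simpa using hM₂, rfl, ?_⟩,
          fun heq => ⟨by omega, rfl, rfl, rfl, hF3, insert ⟨m, hm⟩ M, ?_, ?_, ?_⟩⟩
        · refine hD.drop hm hadj (Or.inr (Or.inr fun hsub => hne ?_))
          rw [Finset.inter_eq_left.2 hsub, Nat.sub_self]
        all_goals
          have hsub : M ⊆ nbrs G ⟨m, hm⟩ := by
            rw [← Finset.inter_eq_left]
            exact Finset.eq_of_subset_of_card_le Finset.inter_subset_left (by omega)
          have htake := hD.take hm hadj hx1 hl hsub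
        · exact marks_insert (by simpa using hM₂) rfl rfl
        · rw [Finset.card_insert_of_notMem htake.1]
        · exact htake.2
      · exact ⟨M, hM, h19, hD.drop hm hadj (Or.inl hx0)⟩
    · simp only [hadj, if_false] at eadj
      simp [hm', hN, h1', e14, erow, eadj, hF]
      exact ⟨M, hM, h19, hD.skip hm hadj⟩
  · rintro t s' ⟨ht, hF, M, hM, h19, hD⟩
    have e : 9 * n + 25 + 3 ≤ 9 * n + 30 := by omega
    have := Nat.mul_le_mul_left n e
    exact ⟨by omega, hF, M, _, hM, h19, hD⟩

end Decode

end IndepRelax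

namespace IndepRelax

/-! ### Greedy removal of cliques, layer by layer -/

section Peeling

variable {n : ℕ} {G : SimpleGraph (Fin n)}

/-- `lab` arises from `lab₀` by giving the label `k + 1` to the vertices of `c` disjoint cliques of size
`2 ^ k` of unlabelled vertices. -/
structure Peeling (G : SimpleGraph (Fin n)) (lab₀ lab : Fin n → ℕ) (k c : ℕ) : Prop where
  old : ∀ u, lab₀ u ≠ 0 → lab u = lab₀ u
  new : ∀ u, lab₀ u = 0 → lab u = 0 ∨ lab u = k + 1
  cover : CliqueCover G (2 ^ k) (Finset.univ.filter fun u => lab u = k + 1) c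

theorem Peeling.refl {lab₀ : Fin n → ℕ} {k : ℕ} (h : ∀ u, lab₀ u ≠ k + 1) :
    Peeling G lab₀ lab₀ k 0 where
  old _ _ := rfl
  new _ h := Or.inl h
  cover := by
    rw [Finset.filter_false_of_mem fun u _ => h u]
    exact .empty

theorem Peeling.add {lab₀ lab : Fin n → ℕ} {k c : ℕ} (h : Peeling G lab₀ lab k c)
    {M : Finset (Fin n)} (hM : G.IsClique (M : Set (Fin n))) (hal : ∀ u ∈ M, lab u = 0)
    (hcard : M.card = 2 ^ k) :
    Peeling G lab₀ (fun u => if u ∈ M then k + 1 else lab u) k (c + 1) where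
  old u hu := by
    have := h.old u hu
    rw [if_neg fun hm => hu (by rw [← this, hal u hm]), this]
  new u hu := by
    by_cases hm : u ∈ M
    · exact Or.inr (if_pos hm)
    · rw [if_neg hm]; exact h.new u hu
  cover := by
    have : (Finset.univ.filter fun u => (if u ∈ M then k + 1 else lab u) = k + 1) =
        (Finset.univ.filter fun u => lab u = k + 1) ∪ M := by
      ext u
      by_cases hm : u ∈ M <;> simp [hm]
    rw [this]
    refine h.cover.add ?_ hM hcard
    rw [Finset.disjoint_left]
    intro u hu hm
    have := (Finset.mem_filter.1 hu).2
    rw [hal u hm] at this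
    omega

theorem Peeling.filter_eq {lab₀ lab : Fin n → ℕ} {k c : ℕ} (h : Peeling G lab₀ lab k c) {a : ℕ}
    (h0 : a ≠ 0) (hk : a ≠ k + 1) :
    (Finset.univ.filter fun u => lab u = a) = Finset.univ.filter fun u => lab₀ u = a := by
  ext u
  simp only [Finset.mem_filter, Finset.mem_univ, true_and]
  by_cases hu : lab₀ u = 0
  · rcases h.new u hu with h' | h' <;> omega
  · rw [h.old u hu]

/-- After `j` of `K` layers, from large cliques to small ones, have been labelled; `b` is the largest
number of cliques in a layer, and `l` is the label of such a layer. -/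
structure Layered (G : SimpleGraph (Fin n)) (K j : ℕ) (lab : Fin n → ℕ) (c : ℕ → ℕ) (b l : ℕ) :
    Prop where
  range : ∀ v, lab v = 0 ∨ (K - j < lab v ∧ lab v ≤ K)
  cover : ∀ k, K - j ≤ k → k < K →
    CliqueCover G (2 ^ k) (Finset.univ.filter fun v => lab v = k + 1) (c k)
  le : ∀ k, K - j ≤ k → k < K → c k ≤ b
  best : (l = 0 ∧ b = 0) ∨ ∃ k, l = k + 1 ∧ K - j ≤ k ∧ k < K ∧ c k = b
  free : ∀ k, K - j ≤ k → k + 1 < K →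
    G.CliqueFreeOn ((Finset.univ.filter fun v => lab v = k + 1 : Finset (Fin n)) : Set (Fin n))
      (2 ^ (k + 1))
  alive : 0 < j → G.CliqueFreeOn
    ((Finset.univ.filter fun v => lab v = 0 : Finset (Fin n)) : Set (Fin n)) (2 ^ (K - j))

theorem Layered.init (K : ℕ) : Layered G K 0 (fun _ => 0) (fun _ => 0) 0 0 where
  range _ := Or.inl rfl
  cover k hk hk' := by omega
  le k hk hk' := by omega
  best := Or.inl ⟨rfl, rfl⟩
  free k hk hk' := by omega
  alive h := by omega

theorem Layered.step {K j : ℕ} {lab lab' : Fin n → ℕ} {c : ℕ → ℕ} {b l cnt : ℕ}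
    (h : Layered G K j lab c b l) (hj : j < K) (hP : Peeling G lab lab' (K - j - 1) cnt)
    (hfree : G.CliqueFreeOn
      ((Finset.univ.filter fun v => lab' v = 0 : Finset (Fin n)) : Set (Fin n)) (2 ^ (K - j - 1))) :
    Layered G K (j + 1) lab' (Function.update c (K - j - 1) cnt) (if b < cnt then cnt else b)
      (if b < cnt then K - j else l) := by
  have e : K - (j + 1) = K - j - 1 := by omega
  refine ⟨fun v => ?_, fun k hk hk' => ?_, fun k hk hk' => ?_, ?_, fun k hk hk' => ?_, fun _ => ?_⟩
  · by_cases hv : lab v = 0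
    · rcases hP.new v hv with h' | h'
      · exact Or.inl h'
      · exact Or.inr (by omega)
    · rw [hP.old v hv]
      exact (h.range v).imp id (by omega)
  · by_cases hkk : k = K - j - 1
    · rw [hkk, Function.update_self]; exact hP.cover
    · rw [Function.update_of_ne hkk, hP.filter_eq (by omega) (by omega)]
      exact h.cover k (by omega) hk'
  · by_cases hkk : k = K - j - 1
    · rw [hkk, Function.update_self]; split_ifs <;> omega
    · rw [Function.update_of_ne hkk]
      have := h.le k (by omega) hk'
      split_ifs <;> omega
  · split_ifs with hb
    · exact Or.inr ⟨K - j - 1, by omega, by omega, by omega, Function.update_self ..⟩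
    · rcases h.best with h' | ⟨k, h1, h2, h3, h4⟩
      · exact Or.inl h'
      · exact Or.inr ⟨k, h1, by omega, h3, by rw [Function.update_of_ne (by omega)]; exact h4⟩
  · by_cases hkk : k = K - j - 1
    -- The new layer consists of vertices that had no label before, and among these the previous
    -- round left no clique of twice the size.
    · have hal := h.alive (by omega)
      have hK : K - j = k + 1 := by omega
      rw [hK] at hal
      refine SimpleGraph.CliqueFreeOn.subset G ?_ hal
      rw [Finset.coe_subset]
      intro v hv
      rw [Finset.mem_filter] at hv ⊢
      refine ⟨hv.1, ?_⟩
      by_contra hv0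
      have := hP.old v hv0
      have := h.range v
      omega
    · rw [hP.filter_eq (by omega) (by omega)]
      exact h.free k (by omega) hk'
  · rw [e]; exact hfree

/-- The state in which cliques with `2 ^ k` vertices are searched. -/
structure InLayer (G : SimpleGraph (Fin n)) (l P k : ℕ) (lab : Fin n → ℕ) (c : ℕ) (s : State) :
    Prop where
  ready : Ready G s
  unit : s.reg 3 = l
  bound : s.reg 8 = P
  label : s.reg 11 = k + 1
  size : s.reg 12 = 2 ^ k
  count : s.reg 18 = l * c
  half : ∀ i < 2 * P, s.arr 6 i = i / 2
  unmarked : Marks 5 (∅ : Finset (Fin n)) s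
  labels : ∀ u : Fin n, s.arr 4 u = lab u

/-- Gives the label `r_11` to the marked vertices if their number `r_19` equals `r_12`, and removes all
marks. -/
def Prog.record : Prog :=
  .seq (.sub 22 19 12) (.seq (.sub 23 12 19) (.seq (.add 22 22 23) (.seq (.const 23 0)
    (.seq (.ite 22 .skip (.add 18 18 3)) (.forLt 20 21 0 (.seq (.load 24 5 20) (.ite 24
      (.seq (.store 5 20 23) (.ite 22 .skip (.store 4 20 11))) .skip)))))))

theorem wp_record {s : State} (hR : Ready G s) {M : Finset (Fin n)} (hM : Marks 5 M s) :
    WP .record s fun t s' => t ≤ 8 * n + 10 ∧ Frame 18 {4, 5} s s' ∧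
      Marks 5 (∅ : Finset (Fin n)) s' ∧
      s'.reg 18 = (if s.reg 19 = s.reg 12 then s.reg 18 + s.reg 3 else s.reg 18) ∧
      ∀ u : Fin n, s'.arr 4 u = if s.reg 19 = s.reg 12 ∧ u ∈ M then s.reg 11 else s.arr 4 u := by
  set p : Prog := .forLt 20 21 0 (.seq (.load 24 5 20) (.ite 24
      (.seq (.store 5 20 23) (.ite 22 .skip (.store 4 20 11))) .skip)) with hp
  have key : ∀ s₁ : State, Frame 18 {4, 5} s s₁ → s₁.arr = s.arr → s₁.reg 23 = 0 →
      (s₁.reg 22 = 0 ↔ s.reg 19 = s.reg 12) → WP p s₁ fun t s' => t ≤ 8 * n + 3 ∧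
      Frame 18 {4, 5} s s' ∧ Marks 5 (∅ : Finset (Fin n)) s' ∧ s'.reg 18 = s₁.reg 18 ∧
      ∀ u : Fin n, s'.arr 4 u = if s.reg 19 = s.reg 12 ∧ u ∈ M then s.reg 11 else s.arr 4 u := by
    intro s₁ hF₁ ha h23 h22
    have hR₁ := hR.frame hF₁ (by norm_num) (by simp) (by simp) (by simp)
    refine (wp_forLt (N := n) (T := 5) (fun m s' => Frame 18 {4, 5} s s' ∧ s'.reg 23 = 0 ∧
      (s'.reg 22 = 0 ↔ s.reg 19 = s.reg 12) ∧ s'.reg 18 = s₁.reg 18 ∧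
      (∀ u : Fin n, s'.arr 5 u = if u < m then 0 else s.arr 5 u) ∧
      ∀ u : Fin n, s'.arr 4 u = if (s.reg 19 = s.reg 12 ∧ u ∈ M) ∧ u < m then s.reg 11
        else s.arr 4 u) hR₁.one hR₁.size (by norm_num) (by norm_num) (by norm_num) (by norm_num)
        (by norm_num) ?_ ?_).mono ?_
    · simp [hF₁, ha, h23, h22]
    · rintro m hm s' ⟨hF, h23, h22, h18, h5, h4⟩ hm' hN h1'
      have e11 := hF.reg 11 (by norm_num)
      have e5 := h5 ⟨m, hm⟩
      simp only [Nat.lt_irrefl, if_false] at e5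
      have hMm := hM ⟨m, hm⟩
      simp only at hMm
      have hlt : ∀ u : Fin n, (u : ℕ) < m + 1 ↔ (u : ℕ) < m ∨ (u : ℕ) = m := fun u => by omega
      have hfin : ∀ u : Fin n, (u : ℕ) = m → u = ⟨m, hm⟩ := fun u h => Fin.ext h
      by_cases hmem : (⟨m, hm⟩ : Fin n) ∈ M
      · rw [if_pos hmem] at hMm
        simp [hm', hN, h1', e5, hMm, h23, hF, e11]
        refine ⟨fun hne => ⟨h22, h18, fun u => ?_, fun u => ?_⟩, fun heq =>
          ⟨h22, h18, fun u => ?_, fun u => ?_⟩⟩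
        · rw [h5 u]; split_ifs <;> first | rfl | omega
        · have : ¬ s.reg 19 = s.reg 12 := fun h => hne (h22.2 h)
          rw [h4 u]; simp [this]
        · rw [h5 u]; split_ifs <;> first | rfl | omega
        · have hyes := h22.1 heq
          by_cases hu : (u : ℕ) = m
          · have hu' := hfin u hu
            simp [hu', hyes, hmem]
          · rw [h4 u]
            have : ((u : ℕ) ≤ m) ↔ (u : ℕ) < m := by omega
            simp [hu, this]
      · rw [if_neg hmem] at hMm
        simp [hm', hN, h1', e5, hMm, h23, hF, h22, h18]
        refine ⟨fun u => ?_, fun u => ?_⟩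
        · by_cases hu : (u : ℕ) = m
          · rw [h5 u, hfin u hu]; simp [hMm]
          · have : ((u : ℕ) ≤ m) ↔ (u : ℕ) < m := by omega
            rw [h5 u]; simp [this]
        · by_cases hu : (u : ℕ) = m
          · rw [h4 u, hfin u hu]; simp [hmem]
          · have : ((u : ℕ) ≤ m) ↔ (u : ℕ) < m := by omega
            rw [h4 u]; simp [this]
    · rintro t s' ⟨ht, hF, -, -, h18, h5, h4⟩
      refine ⟨by omega, hF, fun u => ?_, h18, fun u => ?_⟩
      · rw [h5 u]; simp
      · rw [h4 u]; simp
  -- Equality is tested by adding the two truncated differences.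
  have hzero : s.reg 19 - s.reg 12 + (s.reg 12 - s.reg 19) = 0 ↔ s.reg 19 = s.reg 12 := by omega
  rw [Prog.record, ← hp]
  by_cases heq : s.reg 19 = s.reg 12
  · simp [heq]
    refine (key _ ?_ ?_ ?_ ?_).mono ?_
    · simp [Frame.refl]
    · rfl
    · simp
    · simp [heq]
    · rintro t s' ⟨ht, hF, h5, h18, h4⟩
      simp [heq] at h18 h4
      exact ⟨by omega, hF, h5, h18, h4⟩
  · simp [heq]
    refine ⟨fun _ => ?_, fun h1 h2 => by omega⟩
    refine (key _ ?_ ?_ ?_ ?_).mono ?_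
    · simp [Frame.refl]
    · rfl
    · simp
    · simp; omega
    · rintro t s' ⟨ht, hF, h5, h18, h4⟩
      simp [heq] at h18 h4
      exact ⟨by omega, hF, h5, h18, h4⟩

end Peeling

end IndepRelax

namespace IndepRelax

/-! ### The program that computes the layers -/

section Cover

variable {n : ℕ} {G : SimpleGraph (Fin n)}

/-- One attempt to find a clique of size `r_12`: the one with code `r_16` at the vertex `r_14`. -/
def Prog.tryClique : Prog :=
  .seq (.load 19 4 14) (.ite 19 .skip (.seq .decode .record))

/-- `S` is a clique with `r` vertices that contains `v` and has only vertices with label `0`. -/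
structure FreeClique (G : SimpleGraph (Fin n)) (lab : Fin n → ℕ) (r : ℕ) (v : Fin n)
    (S : Finset (Fin n)) : Prop where
  clique : G.IsClique (S : Set (Fin n))
  mem : v ∈ S
  card : S.card = r
  alive : ∀ u ∈ S, lab u = 0

theorem FreeClique.anti {lab lab' : Fin n → ℕ} {r : ℕ} {v : Fin n} {S : Finset (Fin n)}
    (h : FreeClique G lab' r v S) (hl : ∀ u, lab' u = 0 → lab u = 0) : FreeClique G lab r v S :=
  ⟨h.clique, h.mem, h.card, fun u hu => hl u (h.alive u hu)⟩

theorem InLayer.frame {l P k c k' : ℕ} {lab : Fin n → ℕ} {s s' : State}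
    (h : InLayer G l P k lab c s) (hF : Frame k' {4, 5} s s') (hk' : 13 ≤ k') {lab' : Fin n → ℕ}
    {c' : ℕ} (hc : s'.reg 18 = l * c') (hm : Marks 5 (∅ : Finset (Fin n)) s')
    (hlab : ∀ u : Fin n, s'.arr 4 u = lab' u) : InLayer G l P k lab' c' s' where
  ready := h.ready.frame hF (by omega) (by simp) (by simp) (by simp)
  unit := (hF.reg 3 (by omega)).trans h.unit
  bound := (hF.reg 8 (by omega)).trans h.bound
  label := (hF.reg 11 (by omega)).trans h.label
  size := (hF.reg 12 (by omega)).trans h.size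
  count := hc
  half := by rw [hF.arr 6 (by simp)]; exact h.half
  unmarked := hm
  labels := hlab

theorem InLayer.setReg {l P k c i x : ℕ} {lab : Fin n → ℕ} {s : State}
    (h : InLayer G l P k lab c s) (hi : 13 ≤ i) (hi' : i ≠ 18) :
    InLayer G l P k lab c (s.setReg i x) :=
  h.frame (k' := 13) ((Frame.refl _ _ _).setReg hi) le_rfl
    (by rw [reg_setReg, if_neg hi'.symm]; exact h.count) h.unmarked h.labels

/-- After the attempt no unlabelled clique of size 2^k at v has this code. If v was labelled before
or is labelled now, none contains v; otherwise the decoded clique has another size, while such a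
clique would have been decoded exactly. -/
theorem wp_tryClique {l P k c : ℕ} {lab₀ lab : Fin n → ℕ} {s : State} {v : Fin n}
    (h : InLayer G l P k lab c s) (hv : s.reg 14 = v) (hcP : s.reg 16 < P)
    (hP : Peeling G lab₀ lab k c) :
    WP .tryClique s fun t s' => t ≤ n * (9 * n + 30) + 8 * n + 25 ∧ Frame 18 {4, 5} s s' ∧
      ∃ lab' c', InLayer G l P k lab' c' s' ∧ Peeling G lab₀ lab' k c' ∧
        (∀ u, lab' u = 0 → lab u = 0) ∧
        ∀ S, FreeClique G lab' (2 ^ k) v S → code G v S (List.finRange n) ≠ s.reg 16 := by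
  have hlabv := h.labels v
  rw [Prog.tryClique, wp_seq, wp_load, wp_ite]
  simp only [reg_setReg, if_true, hv, hlabv]
  constructor
  · intro hne
    rw [wp_skip]
    refine ⟨by omega, by simp [Frame.refl], lab, c, ?_, hP, fun _ h => h, fun S hS => ?_⟩
    · exact (h.setReg (by norm_num) (by norm_num)).setReg (by norm_num) (by norm_num)
    · exact absurd (hS.alive v hS.mem) hne
  · intro h0
    set s₁ := s.setReg 19 (lab v) with hs₁
    have h1 : InLayer G l P k lab c s₁ := h.setReg (by norm_num) (by norm_num)
    have e16 : s₁.reg 16 = s.reg 16 := by simp [hs₁]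
    rw [wp_seq]
    refine (wp_decode (v := v) (lab := lab) h1.ready (by simp [hs₁, hv])
      (by rw [h1.bound, e16]; exact hcP) (by rw [h1.bound]; exact h1.half) h1.unmarked h1.labels
      h0).mono ?_
    rintro t₂ s₂ ⟨ht₂, hF₂, M, x, hM, h19, hD⟩
    rw [e16] at hD
    have hR₂ := h1.ready.frame hF₂ (by norm_num) (by simp) (by simp) (by simp)
    refine (wp_record hR₂ hM).mono ?_
    rintro t₃ s₃ ⟨ht₃, hF₃, hm₃, h18, h4⟩
    have hF13 : Frame 18 {4, 5} s₁ s₃ := (hF₂.weaken (by norm_num) (by simp)).trans hF₃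
    have hF03 : Frame 18 {4, 5} s s₃ := Frame.trans (by simp [hs₁, Frame.refl]) hF13
    have e12 : s₂.reg 12 = 2 ^ k := (hF₂.reg 12 (by norm_num)).trans h1.size
    have e11 : s₂.reg 11 = k + 1 := (hF₂.reg 11 (by norm_num)).trans h1.label
    have e3 : s₂.reg 3 = l := (hF₂.reg 3 (by norm_num)).trans h1.unit
    have e18 : s₂.reg 18 = l * c := (hF₂.reg 18 (by norm_num)).trans h1.count
    have e4 : s₂.arr 4 = s₁.arr 4 := hF₂.arr 4 (by simp)
    rw [h19, e12, e18, e3] at h18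
    rw [h19, e12, e11, e4] at h4
    refine ⟨by omega, hF03, ?_⟩
    have hfull : ∀ S : Finset (Fin n), G.IsClique (S : Set (Fin n)) → v ∈ S → (∀ u ∈ S, lab u = 0) →
        code G v S (List.finRange n) = s.reg 16 → M = S := by
      intro S hS hvS hal hc
      rw [(hD.complete S hS hvS hal hc).2, Finset.filter_true_of_mem fun u _ => Or.inl u.2]
    by_cases hcard : M.card = 2 ^ k
    · rw [if_pos hcard] at h18
      refine ⟨fun u => if u ∈ M then k + 1 else lab u, c + 1,
        h1.frame hF13 (by norm_num) (by rw [h18]; ring) hm₃ fun u => ?_,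
        hP.add hD.clique hD.alive hcard, fun u hu => ?_, fun S hS => ?_⟩
      · rw [h4 u, h1.labels u]; simp [hcard]
      · by_contra hne
        simp only at hu
        split_ifs at hu
        exact hne hu
      · have := hS.alive v hS.mem
        simp only [hD.mem, if_true] at this
        omega
    · rw [if_neg hcard] at h18
      refine ⟨lab, c, h1.frame hF13 (by norm_num) h18 hm₃ fun u => ?_, hP, fun _ h => h,
        fun S hS hcode => ?_⟩
      · rw [h4 u, h1.labels u]; simp [hcard]
      · rw [hfull S hS.clique hS.mem hS.alive hcode] at hcard
        exact hcard hS.card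

/-- Removes the cliques of size `r_12` that contain the vertex `r_14`. -/
def Prog.peelVertex : Prog := .forLt 16 17 8 .tryClique

/-- The surviving cliques at v have codes at least m after m attempts. Unlabelled vertices only
disappear, so earlier exclusions persist. -/
theorem wp_peelVertex {l P k c : ℕ} {lab₀ lab : Fin n → ℕ} {s : State} {v : Fin n}
    (h : InLayer G l P k lab c s) (hv : s.reg 14 = v) (hvP : 2 ^ (nbrs G v).card ≤ P)
    (hP : Peeling G lab₀ lab k c) :
    WP .peelVertex s fun t s' => t ≤ P * (n * (9 * n + 30) + 8 * n + 28) + 3 ∧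
      Frame 16 {4, 5} s s' ∧
      ∃ lab' c', InLayer G l P k lab' c' s' ∧ Peeling G lab₀ lab' k c' ∧
        (∀ u, lab' u = 0 → lab u = 0) ∧ ∀ S, ¬ FreeClique G lab' (2 ^ k) v S := by
  refine (wp_forLt (N := P) (T := n * (9 * n + 30) + 8 * n + 25) (fun m s' =>
    Frame 16 {4, 5} s s' ∧ ∃ lab' c', InLayer G l P k lab' c' s' ∧ Peeling G lab₀ lab' k c' ∧
        (∀ u, lab' u = 0 → lab u = 0) ∧
        ∀ S, FreeClique G lab' (2 ^ k) v S → m ≤ code G v S (List.finRange n))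
      h.ready.one h.bound (by norm_num) (by norm_num) (by norm_num) (by norm_num) (by norm_num)
      ?_ ?_).mono ?_
  · refine ⟨by simp [Frame.refl], lab, c, ?_, hP, fun _ h => h, fun _ _ => Nat.zero_le _⟩
    exact (h.setReg (by norm_num) (by norm_num)).setReg (by norm_num) (by norm_num)
  · rintro m hm s' ⟨hF, lab₁, c₁, hL, hP₁, hal, hS⟩ hm' hN h1'
    refine (wp_tryClique hL ((hF.reg 14 (by norm_num)).trans hv) (by omega) hP₁).mono ?_
    rintro t s'' ⟨ht, hF', lab₂, c₂, hL₂, hP₂, hal₂, hS₂⟩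
    refine ⟨ht, (hF'.reg 16 (by norm_num)).trans hm', (hF'.reg 8 (by norm_num)).trans hN,
      (hF'.reg 1 (by norm_num)).trans h1', ?_, lab₂, c₂, ?_, hP₂, fun u hu => hal u (hal₂ u hu),
      fun S hSf => ?_⟩
    · simpa using hF.trans (hF'.weaken (by norm_num) subset_rfl)
    · exact (hL₂.setReg (by norm_num) (by norm_num)).setReg (by norm_num) (by norm_num)
    · have h1 := hS S (hSf.anti hal₂)
      have h2 := hS₂ S hSf
      rw [hm'] at h2
      omega
  · rintro t s' ⟨ht, hF, lab', c', hL, hP', hal, hS⟩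
    refine ⟨ht, hF, lab', c', hL, hP', hal, fun S hSf => ?_⟩
    have h1 := hS S hSf
    have h2 := code_lt G v S (List.nodup_finRange n)
    have h3 : (2 : ℕ) ^ ((List.finRange n).toFinset ∩ nbrs G v).card ≤ 2 ^ (nbrs G v).card :=
      Nat.pow_le_pow_right (by norm_num) (Finset.card_le_card Finset.inter_subset_right)
    omega

/-- Removes the cliques of size `r_12`. -/
def Prog.peelVertices : Prog := .forLt 14 15 0 .peelVertex

theorem wp_peelVertices {l P k : ℕ} {lab₀ : Fin n → ℕ} {s : State}
    (h : InLayer G l P k lab₀ 0 s) (hvP : ∀ v, 2 ^ (nbrs G v).card ≤ P)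
    (hlab₀ : ∀ u, lab₀ u ≠ k + 1) :
    WP .peelVertices s fun t s' => t ≤ n * (P * (n * (9 * n + 30) + 8 * n + 28) + 6) + 3 ∧
      Frame 14 {4, 5} s s' ∧
      ∃ lab' c', InLayer G l P k lab' c' s' ∧ Peeling G lab₀ lab' k c' ∧
        G.CliqueFreeOn ((Finset.univ.filter fun v => lab' v = 0 : Finset (Fin n)) : Set (Fin n))
          (2 ^ k) := by
  refine (wp_forLt (N := n) (T := P * (n * (9 * n + 30) + 8 * n + 28) + 3) (fun m s' =>
    Frame 14 {4, 5} s s' ∧ ∃ lab' c', InLayer G l P k lab' c' s' ∧ Peeling G lab₀ lab' k c' ∧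
        ∀ v : Fin n, v < m → ∀ S, ¬ FreeClique G lab' (2 ^ k) v S)
      h.ready.one h.ready.size (by norm_num) (by norm_num) (by norm_num) (by norm_num)
      (by norm_num) ?_ ?_).mono ?_
  · refine ⟨by simp [Frame.refl], lab₀, 0, ?_, .refl hlab₀, fun v hv => absurd hv (Nat.not_lt_zero _)⟩
    exact (h.setReg (by norm_num) (by norm_num)).setReg (by norm_num) (by norm_num)
  · rintro m hm s' ⟨hF, lab₁, c₁, hL, hP₁, hS⟩ hm' hN h1'
    refine (wp_peelVertex (v := ⟨m, hm⟩) hL hm' (hvP _) hP₁).mono ?_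
    rintro t s'' ⟨ht, hF', lab₂, c₂, hL₂, hP₂, hal₂, hS₂⟩
    refine ⟨ht, (hF'.reg 14 (by norm_num)).trans hm', (hF'.reg 0 (by norm_num)).trans hN,
      (hF'.reg 1 (by norm_num)).trans h1', ?_, lab₂, c₂, ?_, hP₂, fun v hv S hSf => ?_⟩
    · simpa using hF.trans (hF'.weaken (by norm_num) subset_rfl)
    · exact (hL₂.setReg (by norm_num) (by norm_num)).setReg (by norm_num) (by norm_num)
    · rcases Nat.lt_or_eq_of_le (Nat.lt_succ_iff.1 hv) with h' | h'
      · exact hS v h' S (hSf.anti hal₂)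
      · obtain rfl : v = ⟨m, hm⟩ := Fin.ext h'
        exact hS₂ S hSf
  · rintro t s' ⟨ht, hF, lab', c', hL, hP', hS⟩
    refine ⟨ht, hF, lab', c', hL, hP', fun S hSal hScl => ?_⟩
    have hpos : 0 < S.card := by rw [hScl.card_eq]; positivity
    obtain ⟨v, hv⟩ := Finset.card_pos.1 hpos
    exact hS v v.2 S ⟨hScl.isClique, hv, hScl.card_eq, fun u hu => by
      simpa using hSal (Finset.mem_coe.2 hu)⟩

/-- Labels the vertices by clique sizes; `r_5` and `r_6` describe a layer with the most cliques. -/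
def Prog.peel : Prog :=
  .seq (.const 5 0) (.seq (.const 6 0) (.forLt 9 10 4
    (.seq (.sub 11 4 9) (.seq (.sub 12 11 1) (.seq (.load 12 3 12) (.seq (.const 18 0)
      (.seq .peelVertices (.seq (.sub 19 18 5) (.ite 19
        (.seq (.const 5 0) (.seq (.add 5 5 18) (.seq (.const 6 0) (.add 6 6 11)))) .skip)))))))))

theorem wp_peel {s : State} {D K l : ℕ} (hR : Ready G s) (hl : s.reg 3 = l)
    (hl0 : 0 < l) (hK : s.reg 4 = K) (hKD : K ≤ D) (hP : s.reg 8 = 2 ^ D)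
    (hdeg : ∀ v, (nbrs G v).card ≤ D) (hpow : ∀ i < D, s.arr 3 i = 2 ^ i)
    (hhalf : ∀ i < 2 * 2 ^ D, s.arr 6 i = i / 2) (hmark : Marks 5 (∅ : Finset (Fin n)) s)
    (hlab : ∀ u : Fin n, s.arr 4 u = 0) :
    WP .peel s fun t s' =>
      t ≤ K * (n * (2 ^ D * (n * (9 * n + 30) + 8 * n + 28) + 6) + 20) + 5 ∧
      Frame 5 {4, 5} s s' ∧ ∃ lab c b, (∀ u : Fin n, s'.arr 4 u = lab u) ∧ s'.reg 5 = l * b ∧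
        Layered G K K lab c b (s'.reg 6) := by
  rw [Prog.peel, wp_seq, wp_const, wp_seq, wp_const]
  refine (wp_forLt (N := K) (T := n * (2 ^ D * (n * (9 * n + 30) + 8 * n + 28) + 6) + 17)
    (fun m s' => Frame 5 {4, 5} s s' ∧ s'.reg 8 = 2 ^ D ∧
      Marks 5 (∅ : Finset (Fin n)) s' ∧ ∃ lab c b, (∀ u : Fin n, s'.arr 4 u = lab u) ∧ s'.reg 5 = l * b ∧
        Layered G K m lab c b (s'.reg 6)) ?_ ?_ (by norm_num) (by norm_num) (by norm_num)
      (by norm_num) (by norm_num) ?_ ?_).mono ?_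
  · simpa using hR.one
  · simpa using hK
  · refine ⟨by simp [Frame.refl], by simpa using hP, by simpa using hmark, fun _ => 0, fun _ => 0, 0, ?_, ?_, ?_⟩
    · simpa using hlab
    · simp
    · simpa using Layered.init K
  · rintro m hm s' ⟨hF, h8, hM, lab, c, b, h4, h5, hL⟩ hm' hN h1'
    have hR' := hR.frame hF (by norm_num) (by simp) (by simp) (by simp)
    have e3 : s'.reg 3 = l := (hF.reg 3 (by norm_num)).trans hl
    have ea3 := hF.arr 3 (by simp)
    have ea6 := hF.arr 6 (by simp)
    obtain ⟨k, hk⟩ : ∃ k, K - m = k + 1 := ⟨K - m - 1, by omega⟩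
    have hk1 : K - m - 1 = k := by omega
    simp only [wp_seq, wp_sub, wp_load, wp_const, reg_setReg, arr_setReg, hm', hN, h1', hk,
      ea3, Nat.reduceEqDiff, if_false, if_true, Nat.add_sub_cancel,
      hpow k (by omega)]
    set s₁ := (((s'.setReg 11 (k + 1)).setReg 12 k).setReg 12 (2 ^ k)).setReg 18 0 with hs₁
    have hF₁ : Frame 10 ∅ s' s₁ := by simp [hs₁, Frame.refl]
    have hI : InLayer G l (2 ^ D) k lab 0 s₁ :=
      { ready := hR'.frame hF₁ (by norm_num) (by simp) (by simp) (by simp)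
        unit := (hF₁.reg 3 (by norm_num)).trans e3
        bound := (hF₁.reg 8 (by norm_num)).trans h8
        label := by simp [hs₁]
        size := by simp [hs₁]
        count := by simp [hs₁]
        half := by rw [hF₁.arr 6 (by simp), ea6]; exact hhalf
        unmarked := hM
        labels := h4 }
    refine (wp_peelVertices hI (fun v => Nat.pow_le_pow_right (by norm_num) (hdeg v))
      fun u => by have := hL.range u; omega).mono ?_
    rintro t s₂ ⟨ht, hF₂, lab', c', hI₂, hP₂, hfree⟩
    have hstep := hL.step hm (by rw [hk1]; exact hP₂) (by rw [hk1]; exact hfree)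
    have hF02 : Frame 10 {4, 5} s' s₂ :=
      (hF₁.weaken le_rfl (by simp)).trans (hF₂.weaken (by norm_num) subset_rfl)
    have hFs : Frame 5 {4, 5} s s₂ := hF.trans (hF02.weaken (by norm_num) subset_rfl)
    have f5 : s₂.reg 5 = l * b := (hF02.reg 5 (by norm_num)).trans h5
    have f9 : s₂.reg 9 = m := (hF02.reg 9 (by norm_num)).trans hm'
    have f4 : s₂.reg 4 = K := (hF02.reg 4 (by norm_num)).trans hN
    have f1 : s₂.reg 1 = 1 := (hF02.reg 1 (by norm_num)).trans h1'
    have f8 : s₂.reg 8 = 2 ^ D := (hF02.reg 8 (by norm_num)).trans h8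
    have f6 : s₂.reg 6 = s'.reg 6 := hF02.reg 6 (by norm_num)
    -- The registers hold the numbers of cliques multiplied by l > 0, which avoids a later
    -- multiplication and does not affect comparisons.
    have hiff : l * c' - l * b = 0 ↔ ¬ b < c' := by
      rw [Nat.sub_eq_zero_iff_le, Nat.mul_le_mul_left_iff hl0, not_lt]
    rw [hk] at hstep
    have h18 := hI₂.count
    have h11 := hI₂.label
    have hm₂ := hI₂.unmarked
    have hl₂ := hI₂.labels
    by_cases hbc : b < c'
    · have hne : ¬ l * c' - l * b = 0 := fun h => hiff.1 h hbc
      simp only [if_pos hbc] at hstep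
      simp [h18, f5, f9, f4, f1, f8, hne, hFs, h11, hm₂, -mul_eq_mul_left_iff]
      exact ⟨by omega, lab', hl₂, _, c', rfl, hstep⟩
    · have heq : l * c' - l * b = 0 := hiff.2 hbc
      simp only [if_neg hbc] at hstep
      simp [h18, f5, f9, f4, f1, f8, heq, hFs, f6, hm₂, -mul_eq_mul_left_iff]
      exact ⟨by omega, lab', hl₂, _, b, rfl, hstep⟩
  · rintro t s' ⟨ht, hF, -, -, h⟩
    have e : n * (2 ^ D * (n * (9 * n + 30) + 8 * n + 28) + 6) + 17 + 3 =
      n * (2 ^ D * (n * (9 * n + 30) + 8 * n + 28) + 6) + 20 := by ring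
    rw [e] at ht
    exact ⟨by omega, hF, h⟩

end Cover

end IndepRelax

namespace IndepRelax

/-! ### The deterministic phase and its result -/

section Setup

/-- The program reads no random bits. -/
def Prog.FlipFree : Prog → Prop
  | .flip _ => False
  | .seq p q => p.FlipFree ∧ q.FlipFree
  | .ite _ p q => p.FlipFree ∧ q.FlipFree
  | .loop _ p => p.FlipFree
  | _ => True

/-- `s` with the random bits `ω`. -/
def State.withCoins (s : State) (ω : ℕ → Bool) : State := { s with coins := ω }

/-- The setup runs identically for all random bits, so its result can be fixed before integrating
over them. -/
theorem Exec.withCoins {p : Prog} {s s' : State} {t : ℕ} (h : Exec p s t s') (hp : p.FlipFree)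
    (ω : ℕ → Bool) : Exec p (s.withCoins ω) t (s'.withCoins ω) := by
  induction h with
  | const s i k => exact .const _ _ _
  | add s i j k => exact .add (s.withCoins ω) i j k
  | sub s i j k => exact .sub (s.withCoins ω) i j k
  | load s i a j => exact .load (s.withCoins ω) i a j
  | store s a i j => exact .store (s.withCoins ω) a i j
  | flip s i => exact hp.elim
  | seq _ _ ih1 ih2 => exact .seq (ih1 hp.1) (ih2 hp.2)
  | ite_true hi _ ih => exact .ite_true hi (ih hp.1)
  | ite_false hi _ ih => exact .ite_false hi (ih hp.2)
  | loop_done hi => exact .loop_done hi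
  | loop_step hi _ _ ih1 ih2 => exact .loop_step hi (ih1 hp) (ih2 hp)

/-- `r_7 := 1024 * r_2 * r_4` -/
def Prog.scale : Prog :=
  .seq (.const 7 0) (.seq (.forLt 10 11 4 (.add 7 7 2))
    (.seq (.add 7 7 7) (.seq (.add 7 7 7) (.seq (.add 7 7 7) (.seq (.add 7 7 7) (.seq (.add 7 7 7)
    (.seq (.add 7 7 7) (.seq (.add 7 7 7) (.seq (.add 7 7 7)
    (.seq (.add 7 7 7) (.add 7 7 7)))))))))))

theorem wp_scale {s : State} (h1 : s.reg 1 = 1) :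
    WP .scale s fun t s' => t ≤ 4 * s.reg 4 + 14 ∧ Frame 7 ∅ s s' ∧
      s'.reg 7 = 1024 * s.reg 2 * s.reg 4 := by
  rw [Prog.scale, wp_seq, wp_const, wp_seq]
  refine (wp_forLt (N := s.reg 4) (T := 1) (fun m s' => Frame 7 ∅ s s' ∧ s'.reg 7 = s.reg 2 * m)
    ?_ ?_ (by norm_num) (by norm_num) (by norm_num) (by norm_num) (by norm_num) ?_ ?_).mono ?_
  · simpa using h1
  · simp
  · simp [Frame.refl]
  · rintro m hm s' ⟨hF, h7⟩ hm' hN h1'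
    have e2 := hF.reg 2 (by norm_num)
    simp [hm', hN, h1', h7, hF, e2]
    ring
  · rintro t s' ⟨ht, hF, h7⟩
    simp [hF, h7]
    exact ⟨by omega, by ring⟩

/-- Computes the parameters and a labelling of the vertices by clique sizes. -/
def Prog.setup : Prog :=
  .seq .rows (.seq .degree (.seq .powers (.seq (.countPow 3 2) (.seq (.countPow 4 3)
    (.seq (.sub 4 4 1) (.seq .powers (.seq .halves (.seq .peel .scale))))))))

theorem flipFree_setup : Prog.setup.FlipFree := by
  simp [Prog.setup, Prog.rows, Prog.degree, Prog.powers, Prog.countPow, Prog.halves, Prog.peel,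
    Prog.scale, Prog.peelVertices, Prog.peelVertex, Prog.tryClique, Prog.record, Prog.decode,
    Prog.adjSum, Prog.skip, Prog.forLt, Prog.FlipFree]

variable {n : ℕ}

/-- The state holds the labels `lab`, the label `l` of the layer that is sampled, and the numbers
`B` and `Z` that define the stopping rule. -/
structure Sampling (G : SimpleGraph (Fin n)) (lab : Fin n → ℕ) (l B Z : ℕ) (s : State) : Prop where
  ready : Ready G s
  labels : ∀ u : Fin n, s.arr 4 u = lab u
  layer : s.reg 6 = l
  target : s.reg 5 = B
  weight : s.reg 7 = Z

theorem setup_time_le {n D K : ℕ} (hKD : K ≤ D) :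
    (6 * n + 5) + (n * (9 * n + 9) + 4) + 2 * (5 * D + 4) + 2 * (7 * D + 4) + 1 +
      (7 * 2 ^ D + 4) + (K * (n * (2 ^ D * (n * (9 * n + 30) + 8 * n + 28) + 6) + 20) + 5) +
      (4 * K + 14) ≤ 250 * ((n + 1) ^ 3 * (2 ^ D) ^ 2) := by
  have hD : D ≤ 2 ^ D := Nat.lt_two_pow_self.le
  set P := 2 ^ D
  have hP : 1 ≤ P := Nat.one_le_two_pow
  have key : ∀ a b, a ≤ (n + 1) ^ 3 → b ≤ P ^ 2 → a * b ≤ (n + 1) ^ 3 * P ^ 2 :=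
    fun a b ha hb => Nat.mul_le_mul ha hb
  have a0 : 1 ≤ (n + 1) ^ 3 := Nat.one_le_pow _ _ (by omega)
  have a1 : n ≤ (n + 1) ^ 3 := by nlinarith [sq_nonneg n]
  have a2 : n ^ 2 ≤ (n + 1) ^ 3 := by nlinarith [sq_nonneg n, Nat.zero_le (n ^ 3)]
  have a3 : n ^ 3 ≤ (n + 1) ^ 3 := Nat.pow_le_pow_left (by omega) 3
  have b0 : 1 ≤ P ^ 2 := Nat.one_le_pow _ _ hP
  have b1 : P ≤ P ^ 2 := by nlinarith
  have b3 : K * P ≤ P ^ 2 := by nlinarith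
  have b2 : K ≤ P ^ 2 := (hKD.trans hD).trans b1
  have b4 : D ≤ P ^ 2 := hD.trans b1
  have := key _ _ a0 b0
  have := key _ _ a1 b0
  have := key _ _ a2 b0
  have := key _ _ a0 b1
  have := key _ _ a0 b2
  have := key _ _ a0 b4
  have := key _ _ a1 b2
  have := key _ _ a1 b3
  have := key _ _ a2 b3
  have := key _ _ a3 b3
  generalize (n + 1) ^ 3 * P ^ 2 = Q at *
  nlinarith

theorem layers_le (D : ℕ) (hD : D ≠ 0) : layers D ≤ D ∧ Nat.log 2 D + 1 < 2 ^ D := by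
  have h1 : Nat.log 2 D < D := Nat.log_lt_self 2 hD
  have h2 : Nat.log 2 D + 1 < 2 ^ D := lt_of_le_of_lt h1 Nat.lt_two_pow_self
  exact ⟨(Nat.log_le_self 2 _).trans h1, h2⟩

theorem wp_setup (G : SimpleGraph (Fin n)) (ω : ℕ → Bool) :
    WP .setup (initState G ω) fun t s' => ∃ D lab c b l, 16 ≤ D ∧
      (∀ v, (nbrs G v).card ≤ D) ∧ (D = 16 ∨ ∃ v, D = (nbrs G v).card) ∧
      t ≤ 250 * ((n + 1) ^ 3 * (2 ^ D) ^ 2) ∧ Layered G (layers D) (layers D) lab c b l ∧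
      Sampling G lab l ((Nat.log 2 D + 1) * b) (1024 * D * layers D) s' ∧
      Marks 1 (∅ : Finset (Fin n)) s' := by
  rw [Prog.setup, wp_seq]
  refine (wp_rows G ω).mono ?_
  rintro t₁ s₁ ⟨ht₁, hR₁, hz, -⟩
  rw [wp_seq]
  refine (wp_degree hR₁).mono ?_
  rintro t₂ s₂ ⟨ht₂, hF₂, h16, hdeg, hex⟩
  set D := s₂.reg 2 with hD
  have hR₂ := hR₁.frame hF₂ le_rfl (by simp) (by simp) (by simp)
  obtain ⟨hKD, hlD⟩ := layers_le D (by omega)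
  have hDD : D < 2 ^ D := Nat.lt_two_pow_self
  rw [wp_seq]
  refine (wp_powers hR₂.one).mono ?_
  rintro t₃ s₃ ⟨ht₃, hF₃, -, hp₃⟩
  have hR₃ := hR₂.frame hF₃ (by norm_num) (by simp) (by simp) (by simp)
  have e23 : s₃.reg 2 = D := hF₃.reg 2 (by norm_num)
  rw [wp_seq]
  refine (wp_countPow (by norm_num) (by norm_num) (by norm_num) hR₃.one (by rw [e23]; exact hp₃)
    (by rw [e23]; omega) (by rw [e23]; exact hDD)).mono ?_
  rintro t₄ s₄ ⟨ht₄, hF₄, h3₄⟩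
  have hR₄ := hR₃.frame hF₄ (by norm_num) (by simp) (by simp) (by simp)
  have e24 : s₄.reg 2 = D := (hF₄.reg 2 (by norm_num)).trans e23
  rw [e23] at h3₄ ht₄
  rw [wp_seq]
  refine (wp_countPow (by norm_num) (by norm_num) (by norm_num) hR₄.one
    (by rw [e24, hF₄.arr 3 (by simp)]; exact hp₃) (by omega) (by rw [h3₄, e24]; exact hlD)).mono ?_
  rintro t₅ s₅ ⟨ht₅, hF₅, h4₅⟩
  have hR₅ := hR₄.frame hF₅ (by norm_num) (by simp) (by simp) (by simp)
  have e25 : s₅.reg 2 = D := (hF₅.reg 2 (by norm_num)).trans e24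
  have e35 : s₅.reg 3 = Nat.log 2 D + 1 := (hF₅.reg 3 (by norm_num)).trans h3₄
  rw [h3₄] at h4₅
  rw [e24] at ht₅
  rw [wp_seq, wp_sub, hR₅.one, h4₅, Nat.add_sub_cancel, wp_seq]
  set s₆ := s₅.setReg 4 (Nat.log 2 (Nat.log 2 D + 1)) with hs₆
  have hF₆ : Frame 4 ∅ s₅ s₆ := by simp [hs₆, Frame.refl]
  have hR₆ := hR₅.frame hF₆ (by norm_num) (by simp) (by simp) (by simp)
  have e26 : s₆.reg 2 = D := (hF₆.reg 2 (by norm_num)).trans e25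
  -- The second run re-establishes r_8 = 2^D, because the frames of the two logarithm computations
  -- do not cover that register.
  refine (wp_powers hR₆.one).mono ?_
  rintro t₇ s₇ ⟨ht₇, hF₇, h8₇, hp₇⟩
  have hR₇ := hR₆.frame hF₇ (by norm_num) (by simp) (by simp) (by simp)
  rw [e26] at h8₇ hp₇ ht₇
  rw [wp_seq]
  refine (wp_halves hR₇.one).mono ?_
  rintro t₈ s₈ ⟨ht₈, hF₈, hh⟩
  have hR₈ := hR₇.frame hF₈ (by norm_num) (by simp) (by simp) (by simp)
  rw [h8₇] at hh ht₈
  have e28 : s₈.reg 2 = D := (hF₈.reg 2 (by norm_num)).trans ((hF₇.reg 2 (by norm_num)).trans e26)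
  have e38 : s₈.reg 3 = Nat.log 2 D + 1 := (hF₈.reg 3 (by norm_num)).trans
    ((hF₇.reg 3 (by norm_num)).trans ((hF₆.reg 3 (by norm_num)).trans e35))
  have e48 : s₈.reg 4 = layers D := (hF₈.reg 4 (by norm_num)).trans
    ((hF₇.reg 4 (by norm_num)).trans (by simp [hs₆, layers]))
  have harr : ∀ a, a ≠ 0 → a ≠ 2 → a ≠ 3 → a ≠ 6 → a ≠ 7 → s₈.arr a = fun _ => 0 := by
    intro a h0 h2 h3 h6 h7
    rw [hF₈.arr a (by simpa using h6), hF₇.arr a (by simpa using h3), hF₆.arr a (by simp),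
      hF₅.arr a (by simp), hF₄.arr a (by simp), hF₃.arr a (by simpa using h3), hF₂.arr a (by simp)]
    exact hz a h0 h2 h7
  rw [wp_seq]
  refine (wp_peel hR₈ e38 (Nat.succ_pos _) e48 hKD
    ((hF₈.reg 8 (by norm_num)).trans h8₇) hdeg (by rw [hF₈.arr 3 (by simp)]; exact hp₇) hh
    (fun w => by simp [harr 5]) (fun u => by simp [harr 4])).mono ?_
  rintro t₉ s₉ ⟨ht₉, hF₉, lab, c, b, h4, h5, hL⟩
  have hR₉ := hR₈.frame hF₉ (by norm_num) (by simp) (by simp) (by simp)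
  have e29 : s₉.reg 2 = D := (hF₉.reg 2 (by norm_num)).trans e28
  have e49 : s₉.reg 4 = layers D := (hF₉.reg 4 (by norm_num)).trans e48
  refine (wp_scale hR₉.one).mono ?_
  rintro t s ⟨ht, hF, h7⟩
  rw [e29, e49] at h7
  rw [e49] at ht
  refine ⟨D, lab, c, b, s₉.reg 6, h16, hdeg, hex, ?_, hL,
    ⟨hR₉.frame hF (by norm_num) (by simp) (by simp) (by simp), ?_, hF.reg 6 (by norm_num), ?_, h7⟩,
    fun w => ?_⟩
  · refine le_trans ?_ (setup_time_le hKD)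
    omega
  · rw [hF.arr 4 (by simp)]; exact h4
  · exact (hF.reg 5 (by norm_num)).trans h5
  · rw [hF.arr 1 (by simp), hF₉.arr 1 (by simp), harr 1] <;> simp

variable {G : SimpleGraph (Fin n)} {D b l : ℕ} {lab : Fin n → ℕ} {c : ℕ → ℕ}

theorem Layered.layerCover (h : Layered G (layers D) (layers D) lab c b l) (hD : 0 < layers D) :
    LayerCover G D lab c b where
  lab_pos v := by
    by_contra hv
    have hv : lab v = 0 := by omega
    have := h.alive hD
    -- The last round removes cliques of size 1, so no vertex remains without a label.
    rw [Nat.sub_self, pow_zero] at this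
    exact this (t := {v}) (by simpa using hv) (by simp)
  lab_le v := by have := h.range v; omega
  cover k hk := h.cover k (by omega) hk
  le k hk := h.le k (by omega) hk

/-- The layer that is sampled satisfies the hypotheses of `layer_gap`. -/
theorem Layered.exists_best (h : Layered G (layers D) (layers D) lab c b l) (hD : 0 < layers D) :
    ∃ r, 0 < r ∧ (Finset.univ.filter fun v => lab v = l).card = r * b ∧
      (Nat.log 2 D + 1 ≤ 4 * r ∨ G.CliqueFreeOn
        ((Finset.univ.filter fun v => lab v = l : Finset (Fin n)) : Set (Fin n)) (2 * r)) := by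
  rcases h.best with ⟨rfl, rfl⟩ | ⟨k, rfl, -, hk, rfl⟩
  · have : (Finset.univ.filter fun v => lab v = 0) = ∅ :=
      Finset.filter_false_of_mem fun v _ => ((h.layerCover hD).lab_pos v).ne'
    rw [this]
    refine ⟨1, one_pos, by simp, Or.inr fun t ht hc => ?_⟩
    have ht : t = ∅ := by simpa using ht
    have := hc.card_eq
    rw [ht] at this
    simp at this
  · refine ⟨2 ^ k, by positivity, (h.cover k (by omega) hk).card_eq, ?_⟩
    by_cases hk' : k + 1 < layers D
    · right
      rw [← pow_succ']
      exact h.free k (by omega) hk'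
    -- In the layer of largest cliques r = 2^(K-1), and l < 2^(K+1) = 4 r.
    · left
      have h1 : Nat.log 2 D + 1 < 2 ^ (layers D + 1) := Nat.lt_pow_succ_log_self (by norm_num) _
      have h2 : layers D = k + 1 := by omega
      rw [h2, pow_succ, pow_succ] at h1
      omega

end Setup

end IndepRelax

namespace IndepRelax

/-! ### The Glauber dynamics as a program -/

section Sampler

@[simp]
theorem reg_dropCoin (s : State) : s.dropCoin.reg = s.reg := rfl

@[simp]
theorem arr_dropCoin (s : State) : s.dropCoin.arr = s.arr := rfl

@[simp]
theorem reg_withCoins (s : State) (ω : ℕ → Bool) : (s.withCoins ω).reg = s.reg := rfl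

variable {n : ℕ}

/-- Heat-bath update at the vertex `r_10`; if the vertex is occupied afterwards, `r_7` is added to
`r_13`. -/
def Prog.update : Prog :=
  .seq (.flip 16) (.seq (.store 1 10 12) (.ite 16
    (.seq (.load 17 4 10) (.seq (.sub 18 17 6) (.seq (.sub 19 6 17) (.seq (.add 18 18 19)
      (.ite 18 .skip (.seq (.adjSum 1 10) (.ite 30 .skip
        (.seq (.store 1 10 1) (.add 13 13 7)))))))))
    .skip))

theorem Sampling.frame {G : SimpleGraph (Fin n)} {lab : Fin n → ℕ} {l B Z k : ℕ} {s s' : State}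
    (h : Sampling G lab l B Z s) (hF : Frame k {1} s s') (hk : 8 ≤ k) : Sampling G lab l B Z s' where
  ready := h.ready.frame hF (by omega) (by simp) (by simp) (by simp)
  labels := by rw [hF.arr 4 (by simp)]; exact h.labels
  layer := (hF.reg 6 (by omega)).trans h.layer
  target := (hF.reg 5 (by omega)).trans h.target
  weight := (hF.reg 7 (by omega)).trans h.weight

theorem Sampling.withCoins {G : SimpleGraph (Fin n)} {lab : Fin n → ℕ} {l B Z : ℕ} {s : State}
    (h : Sampling G lab l B Z s) (ω : ℕ → Bool) : Sampling G lab l B Z (s.withCoins ω) :=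
  ⟨⟨h.ready.size, h.ready.one, h.ready.adj, h.ready.row, h.ready.ones⟩, h.labels, h.layer, h.target,
    h.weight⟩

/-- The vertex is vacated first. It is occupied again if the bit is 1, its label is l and no
occupied neighbour exists. -/
theorem wp_update {G : SimpleGraph (Fin n)} {lab : Fin n → ℕ} {l B Z : ℕ} {s : State} {v : Fin n}
    {W : Finset (Fin n)} (h : Sampling G lab l B Z s) (hv : s.reg 10 = v) (h0 : s.reg 12 = 0)
    (hW : Marks 1 W s) :
    WP .update s fun t s' => t ≤ 9 * n + 20 ∧
      Frame 13 {1} (s.withCoins fun k => s.coins (k + 1)) s' ∧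
      Marks 1 (coinStep G (Finset.univ.filter fun u => lab u = l) v (s.coins 0) W) s' ∧
      s'.reg 13 = s.reg 13 +
        if v ∈ coinStep G (Finset.univ.filter fun u => lab u = l) v (s.coins 0) W then Z else 0 := by
  have h1 := h.ready.one
  have h6 := h.layer
  have h7 := h.weight
  have h4 := h.labels v
  have hF : Frame 13 {1} (s.withCoins fun k => s.coins (k + 1)) s.dropCoin :=
    ⟨fun _ _ => rfl, fun _ _ => rfl, rfl⟩
  have hM : Marks 1 (W.erase v) (s.dropCoin.setArr 1 v 0) :=
    marks_erase (s := s.dropCoin) hW rfl rfl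
  rw [Prog.update, wp_seq, wp_flip, wp_seq, wp_store]
  simp only [reg_setReg, reg_dropCoin, Nat.reduceEqDiff, if_false, hv, h0]
  set s₁ := (s.dropCoin.setReg 16 (s.coins 0).toNat).setArr 1 v 0 with hs₁
  have hF₁ : Frame 13 {1} (s.withCoins fun k => s.coins (k + 1)) s₁ := by simp [hs₁, hF]
  have hM₁ : Marks 1 (W.erase v) s₁ := hM
  have hR₁ : Ready G s₁ := ((h.withCoins _).frame hF₁ (by norm_num)).ready
  by_cases hb : s.coins 0 = true
  swap
  · have hc : coinStep G (Finset.univ.filter fun u => lab u = l) v (s.coins 0) W = W.erase v := by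
      simp [coinStep, hb]
    rw [hc]
    simp [hs₁, hb, hF, -arr_setArr]
    exact hM
  by_cases hl : lab v = l
  swap
  · have hc : coinStep G (Finset.univ.filter fun u => lab u = l) v (s.coins 0) W = W.erase v := by
      simp [coinStep, hl]
    have hne : ¬ (lab v - l = 0 ∧ l - lab v = 0) := by omega
    rw [hc]
    simp [hs₁, hb, hv, h6, h4, hF]
    exact ⟨fun _ => hM, fun _ _ => by omega⟩
  simp only [wp_ite, wp_seq, wp_load, wp_sub, wp_add]
  have e16 : s₁.reg 16 = 1 := by simp [hs₁, hb]
  have e10 : s₁.reg 10 = v := by simp [hs₁, hv]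
  have e6 : s₁.reg 6 = l := by simp [hs₁, h6]
  have e4 : s₁.arr 4 v = l := by simp [hs₁, h4, hl]
  have e7 : s₁.reg 7 = Z := by simp [hs₁, h7]
  have e1 : s₁.reg 1 = 1 := by simp [hs₁, h1]
  have e13 : s₁.reg 13 = s.reg 13 := by simp [hs₁]
  clear_value s₁
  simp [e16, e10, e6, e4]
  set s₂ := (((s₁.setReg 17 l).setReg 18 0).setReg 19 0).setReg 18 0 with hs₂
  have hF₂ : Frame 13 {1} s₁ s₂ := by simp [hs₂, Frame.refl]
  have hR₂ : Ready G s₂ := hR₁.frame hF₂ (by norm_num) (by simp) (by simp) (by simp)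
  refine (wp_adjSum_card (v := v) (M := W.erase v) (by norm_num) hR₂ (by simp [hs₂, e10])
    hM₁).mono ?_
  rintro t s₃ ⟨ht, hF₃, h30⟩
  have hF₃' : Frame 13 {1} (s.withCoins fun k => s.coins (k + 1)) s₃ :=
    hF₁.trans (hF₂.trans (hF₃.weaken (by norm_num) (by simp)))
  have hM₃ : Marks 1 (W.erase v) s₃ := Marks.congr (s := s₁) hM₁ (hF₃.arr 1 (by simp))
  have f10 : s₃.reg 10 = v := (hF₃.reg 10 (by norm_num)).trans (by simp [hs₂, e10])
  have f1 : s₃.reg 1 = 1 := (hF₃.reg 1 (by norm_num)).trans (by simp [hs₂, e1])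
  have f7 : s₃.reg 7 = Z := (hF₃.reg 7 (by norm_num)).trans (by simp [hs₂, e7])
  have f13 : s₃.reg 13 = s.reg 13 := (hF₃.reg 13 (by norm_num)).trans (by simp [hs₂, e13])
  have hcard : s₃.reg 30 = 0 ↔ ∀ u ∈ W, ¬ G.Adj v u := by
    rw [h30, Finset.card_eq_zero, Finset.eq_empty_iff_forall_notMem]
    simp only [Finset.mem_inter, Finset.mem_erase, mem_nbrs]
    exact ⟨fun h u hu hvu => h u ⟨⟨hvu.ne', hu⟩, hvu⟩, fun h u hu => h u hu.1.2 hu.2⟩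
  by_cases hf : ∀ u ∈ W, ¬ G.Adj v u
  · have hc : coinStep G (Finset.univ.filter fun u => lab u = l) v (s.coins 0) W = insert v W := by
      rw [coinStep, if_pos ⟨hb, by simp [hl], hf⟩]
    have hz := hcard.2 hf
    have hM₄ : Marks 1 (insert v W) (s₃.setArr 1 v 1) := by
      have := marks_insert hM₃ (v := v) (p := v) (q := 1) rfl rfl
      rwa [show insert v (W.erase v) = insert v W by
        ext u; by_cases hu : u = v <;> simp [hu]] at this
    rw [hc]
    simp [hz, f10, f1, f7, f13, hF₃', hM₄]
    omega
  · have hc : coinStep G (Finset.univ.filter fun u => lab u = l) v (s.coins 0) W = W.erase v := by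
      rw [coinStep, if_neg fun h => hf h.2.2]
    have hz : ¬ s₃.reg 30 = 0 := fun h => hf (hcard.1 h)
    rw [hc]
    simp [hz, f13, hF₃', hM₃]
    omega

/-- One sweep of updates over all vertices, followed by the evaluation of the stopping rule. -/
def Prog.round : Prog :=
  .seq (.const 12 0) (.seq (.const 13 0) (.seq (.forLt 10 11 0 .update) (.sub 9 5 13)))

theorem sweep_append {V : Type*} [DecidableEq V] (G : SimpleGraph V) (U : Finset V) (l l' : List V)
    (W : Finset V) (ω : ℕ → Bool) :
    sweep G U (l ++ l') W ω = sweep G U l' (sweep G U l W ω).1 (sweep G U l W ω).2 := by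
  induction l generalizing W ω with
  | nil => rfl
  | cons v l ih => exact ih _ _

/-- An update changes only its own vertex, so counting each vertex right after its update gives the
size of the set after the sweep. -/
theorem card_filter_lt_coinStep {G : SimpleGraph (Fin n)} {U W : Finset (Fin n)} {b : Bool} {m : ℕ}
    (hm : m < n) :
    ((coinStep G U ⟨m, hm⟩ b W).filter fun u : Fin n => (u : ℕ) < m + 1).card =
      (W.filter fun u : Fin n => (u : ℕ) < m).card +
        if ⟨m, hm⟩ ∈ coinStep G U ⟨m, hm⟩ b W then 1 else 0 := by
  have key : ∀ X : Finset (Fin n), (∀ u, u ≠ ⟨m, hm⟩ → (u ∈ X ↔ u ∈ W)) →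
      (X.filter fun u : Fin n => (u : ℕ) < m + 1).card =
      (W.filter fun u : Fin n => (u : ℕ) < m).card + if ⟨m, hm⟩ ∈ X then 1 else 0 := by
    intro X hX
    have hlt : ∀ u : Fin n, (u : ℕ) < m → u ≠ ⟨m, hm⟩ := by rintro u hu rfl; simp at hu
    split_ifs with hmem
    · have : (X.filter fun u : Fin n => (u : ℕ) < m + 1) =
          insert ⟨m, hm⟩ (W.filter fun u : Fin n => (u : ℕ) < m) := by
        ext u
        by_cases hu : u = ⟨m, hm⟩
        · simp [hu, hmem]
        · have : (u : ℕ) ≠ m := fun h => hu (Fin.ext h)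
          have h' : (u : ℕ) < m + 1 ↔ (u : ℕ) < m := by omega
          simp only [Finset.mem_filter, Finset.mem_insert, hX u hu, hu, h', false_or]
      rw [this, Finset.card_insert_of_notMem (by simp)]
    · rw [add_zero]
      congr 1
      ext u
      by_cases hu : u = ⟨m, hm⟩
      · simp [hu, hmem]
      · have : (u : ℕ) ≠ m := fun h => hu (Fin.ext h)
        have h' : (u : ℕ) < m + 1 ↔ (u : ℕ) < m := by omega
        simp only [Finset.mem_filter, hX u hu, h']
  refine key _ fun u hu => ?_
  unfold coinStep
  split_ifs <;> simp [hu]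

theorem wp_round {G : SimpleGraph (Fin n)} {lab : Fin n → ℕ} {l B Z : ℕ} {s : State}
    {W : Finset (Fin n)} (h : Sampling G lab l B Z s) (hW : Marks 1 W s) :
    WP .round s fun t s' => t ≤ n * (9 * n + 23) + 6 ∧
      ∃ W', (W', s'.coins) = sweep G (Finset.univ.filter fun u => lab u = l) (List.finRange n) W
        s.coins ∧ Sampling G lab l B Z s' ∧ Marks 1 W' s' ∧ s'.reg 9 = B - Z * W'.card := by
  set U := Finset.univ.filter fun u => lab u = l with hU
  rw [Prog.round, wp_seq, wp_const, wp_seq, wp_const, wp_seq]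
  refine (wp_forLt (N := n) (T := 9 * n + 20) (fun m s' => Sampling G lab l B Z s' ∧
    s'.reg 12 = 0 ∧ ∃ W', (W', s'.coins) = sweep G U ((List.finRange n).take m) W s.coins ∧
      Marks 1 W' s' ∧ s'.reg 13 = Z * (W'.filter fun u : Fin n => (u : ℕ) < m).card)
    ?_ ?_ (by norm_num) (by norm_num) (by norm_num) (by norm_num) (by norm_num) ?_ ?_).mono ?_
  · simpa using h.ready.one
  · simpa using h.ready.size
  · refine ⟨h.frame (k := 8) (by simp [Frame.refl]) le_rfl, by simp, W, by simp [sweep], hW, by simp⟩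
  · rintro m hm s' ⟨hS, h12, W', hsw, hM, h13⟩ hm' hN h1'
    refine (wp_update (v := ⟨m, hm⟩) hS hm' h12 hM).mono ?_
    rintro t s'' ⟨ht, hF, hM', h13'⟩
    refine ⟨ht, (hF.reg 10 (by norm_num)).trans hm', (hF.reg 0 (by norm_num)).trans hN,
      (hF.reg 1 (by norm_num)).trans h1', (hS.withCoins fun k => s'.coins (k + 1)).frame (k := 8) ?_ le_rfl, ?_,
      coinStep G U ⟨m, hm⟩ (s'.coins 0) W', ?_, hM', ?_⟩
    · simpa using hF.weaken (by norm_num) subset_rfl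
    · simpa using (hF.reg 12 (by norm_num)).trans h12
    · rw [List.take_succ_eq_append_getElem (by simpa using hm), sweep_append, ← hsw,
        List.getElem_finRange]
      simp only [sweep, coins_setReg]
      rw [hF.coins]
      rfl
    · simp only [reg_setReg, Nat.reduceEqDiff, if_false]
      rw [h13', h13, card_filter_lt_coinStep hm]
      split_ifs <;> ring
  · rintro t s' ⟨ht, hS, -, W', hsw, hM, h13⟩
    rw [List.take_of_length_le (by simp)] at hsw
    rw [Finset.filter_true_of_mem fun u _ => u.2] at h13
    rw [wp_sub, h13, hS.target]
    have e : n * (9 * n + 20 + 3) = n * (9 * n + 23) := rfl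
    refine ⟨by omega, W', hsw, hS.frame (k := 8) (by simp [Frame.refl]) le_rfl, hM, by simp⟩

/-- Repeats sweeps until the stopping rule is satisfied. -/
def Prog.sampler : Prog := .loop 9 .round

variable {G : SimpleGraph (Fin n)} {lab : Fin n → ℕ} {l B Z : ℕ}

theorem survives_eq_zero_or_one {V : Type*} [DecidableEq V] (G : SimpleGraph V) (U : Finset V)
    (L : List V) (Stop : Finset V → Prop) (t : ℕ) (W : Finset V) (ω : ℕ → Bool) :
    survives G U L Stop t W ω = 0 ∨ survives G U L Stop t W ω = 1 := by
  induction t generalizing W ω with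
  | zero => unfold survives; split_ifs <;> simp
  | succ t ih =>
    unfold survives
    split_ifs
    · exact Or.inl rfl
    · exact ih _ _

/-- Register 9 is the truncated difference B - Z |W|, which vanishes exactly when the stopping rule
holds. Each survival indicator pays for one round and its test. -/
theorem exec_sampler_of_survives_eq_zero (m : ℕ) {s : State} {W : Finset (Fin n)}
    (h : Sampling G lab l B Z s) (hW : Marks 1 W s) (h9 : s.reg 9 = B - Z * W.card)
    (hm : survives G (Finset.univ.filter fun u => lab u = l) (List.finRange n)
      (fun W => B ≤ Z * W.card) m W s.coins = 0) :
    ∃ t s', Exec .sampler s t s' ∧ (t : ℝ≥0∞) ≤ 1 + ((n * (9 * n + 23) + 7 : ℕ) : ℝ≥0∞) *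
      ∑ i ∈ Finset.range m, survives G (Finset.univ.filter fun u => lab u = l) (List.finRange n)
        (fun W => B ≤ Z * W.card) i W s.coins := by
  induction m generalizing s W with
  | zero =>
    have hs : B ≤ Z * W.card := by
      by_contra hs
      simp [survives, hs] at hm
    exact ⟨1, s, .loop_done (by omega), by simp⟩
  | succ m ih =>
    by_cases hs : B ≤ Z * W.card
    · exact ⟨1, s, .loop_done (by omega), by simp⟩
    obtain ⟨t₁, s₁, he₁, ht₁, W₁, hsw, hS₁, hM₁, h9₁⟩ := wp_round h hW
    have hsurv : ∀ i, survives G (Finset.univ.filter fun u => lab u = l) (List.finRange n)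
        (fun W => B ≤ Z * W.card) (i + 1) W s.coins =
        survives G (Finset.univ.filter fun u => lab u = l) (List.finRange n)
          (fun W => B ≤ Z * W.card) i W₁ s₁.coins := by
      intro i
      rw [survives, if_neg hs, ← hsw]
    rw [hsurv] at hm
    obtain ⟨t₂, s₂, he₂, ht₂⟩ := ih hS₁ hM₁ h9₁ hm
    refine ⟨1 + t₁ + t₂, s₂, .loop_step (by omega) he₁ he₂, ?_⟩
    rw [Finset.sum_range_succ', Finset.sum_congr rfl fun i _ => hsurv i]
    have h0 : survives G (Finset.univ.filter fun u => lab u = l) (List.finRange n)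
        (fun W => B ≤ Z * W.card) 0 W s.coins = 1 := by rw [survives, if_neg hs]
    have h1 : ((1 + t₁ : ℕ) : ℝ≥0∞) ≤ ((n * (9 * n + 23) + 7 : ℕ) : ℝ≥0∞) := by
      exact_mod_cast (by omega : 1 + t₁ ≤ n * (9 * n + 23) + 7)
    rw [h0, mul_add, mul_one, ← add_assoc, add_comm (1 + t₁), Nat.cast_add t₂]
    exact add_le_add ht₂ h1

theorem sampler_correct {s s' : State} {t : ℕ} {W : Finset (Fin n)} (he : Exec .sampler s t s')
    (h : Sampling G lab l B Z s) (hW : Marks 1 W s) (h9 : s.reg 9 = B - Z * W.card)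
    (hI : W ∈ indepIn G (Finset.univ.filter fun u => lab u = l)) :
    ∃ W' ∈ indepIn G (Finset.univ.filter fun u => lab u = l), B ≤ Z * W'.card ∧ Marks 1 W' s' := by
  generalize hp : Prog.sampler = p at he
  induction he generalizing W with
  | const | add | sub | load | store | flip | seq | ite_true | ite_false => cases hp
  | loop_done hi =>
    cases hp
    exact ⟨W, hI, by omega, hW⟩
  | loop_step hi he₁ he₂ _ ih =>
    cases hp
    obtain ⟨t₁, s₁, he', -, W₁, hsw, hS₁, hM₁, h9₁⟩ := wp_round h hW
    obtain ⟨rfl, rfl⟩ := he₁.det he'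
    refine ih hS₁ hM₁ h9₁ ?_ rfl
    have e := congrArg Prod.fst hsw
    simp only at e
    rw [e]
    exact sweep_mem hI _ _

end Sampler

end IndepRelax

namespace IndepRelax

/-! ### The complete algorithm, its expected time and the conclusion -/

section Algorithm

open MeasureTheory

/-- Finds an independent set whose size is certified by a clique cover. -/
def Prog.certify : Prog := .seq .setup (.seq (.const 9 0) (.seq (.add 9 9 5) .sampler))

variable {n : ℕ} {G : SimpleGraph (Fin n)}

theorem runTime_le {p : Prog} {s s' : State} {t : ℕ} (h : Exec p s t s') : runTime p s ≤ t :=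
  iInf₂_le t ⟨s', h⟩

theorem runTime_sampler_le {s₀ s : State} {t₀ : ℕ} (h₀ : Exec .setup s₀ t₀ s) {lab : Fin n → ℕ}
    {l B Z : ℕ} (h : Sampling G lab l B Z s) (hW : Marks 1 (∅ : Finset (Fin n)) s) :
    runTime .certify s₀ ≤ ((t₀ + 3 : ℕ) : ℝ≥0∞) + ((n * (9 * n + 23) + 7 : ℕ) : ℝ≥0∞) *
      ∑' i, survives G (Finset.univ.filter fun u => lab u = l) (List.finRange n)
        (fun W => B ≤ Z * W.card) i ∅ s.coins := by
  by_cases hm : ∃ m, survives G (Finset.univ.filter fun u => lab u = l) (List.finRange n)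
      (fun W => B ≤ Z * W.card) m ∅ s.coins = 0
  · obtain ⟨m, hm⟩ := hm
    set s₁ := (s.setReg 9 0).setReg 9 B with hs₁
    have hS₁ : Sampling G lab l B Z s₁ := h.frame (k := 8) (by simp [hs₁, Frame.refl]) le_rfl
    obtain ⟨t, s', he, ht⟩ := exec_sampler_of_survives_eq_zero m hS₁ hW (by simp [hs₁]) hm
    have h2 : Exec (.add 9 9 5) (s.setReg 9 0) 1 s₁ := by
      have := Exec.add (s.setReg 9 0) 9 9 5
      simpa [h.target] using this
    refine (runTime_le (.seq h₀ (.seq (.const _ _ _) (.seq h2 he)))).trans ?_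
    have e : ((t₀ + (1 + (1 + t)) : ℕ) : ℝ≥0∞) = ((t₀ + 2 : ℕ) : ℝ≥0∞) + t := by push_cast; ring
    have e' : ((t₀ + 3 : ℕ) : ℝ≥0∞) = ((t₀ + 2 : ℕ) : ℝ≥0∞) + 1 := by push_cast; ring
    rw [e, e', add_assoc]
    refine add_le_add le_rfl (ht.trans (add_le_add le_rfl (mul_le_mul_right ?_ _)))
    exact ENNReal.sum_le_tsum _
  -- If the chain never stops, every indicator is 1 and the right side is infinite.
  · have h1 : ∀ i, survives G (Finset.univ.filter fun u => lab u = l) (List.finRange n)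
        (fun W => B ≤ Z * W.card) i ∅ s.coins = 1 := fun i =>
      (survives_eq_zero_or_one ..).resolve_left fun h0 => hm ⟨i, h0⟩
    rw [tsum_congr h1, ENNReal.tsum_const_eq_top_of_ne_zero one_ne_zero, ENNReal.mul_top (by simp)]
    simp

theorem time_bound {n D t : ℕ} (ht : t ≤ 250 * ((n + 1) ^ 3 * (2 ^ D) ^ 2)) :
    (t + 3) + (n * (9 * n + 23) + 7) * (2 ^ (D + 6) * (D * (D + 1)) * (4 * n * n) * n +
      2 * (2 ^ (D + 6) * (D * (D + 1)) * (4 * n * n))) ≤ 50000 * ((n + 1) ^ 5 * (2 ^ D) ^ 3) := by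
  have hD : D + 1 ≤ 2 ^ D := Nat.lt_two_pow_self
  rw [pow_add]
  set P := 2 ^ D
  have hP : 1 ≤ P := Nat.one_le_two_pow
  set N := n + 1 with hN
  have hn : n ≤ N := by omega
  have hN1 : 1 ≤ N := by omega
  have a1 : n * (9 * n + 23) + 7 ≤ 23 * N ^ 2 := by rw [hN]; nlinarith
  have a2 : D * (D + 1) ≤ P * P := Nat.mul_le_mul (by omega) hD
  have a3 : 4 * n * n ≤ 4 * N ^ 2 := by nlinarith
  have a4 : P * 2 ^ 6 * (D * (D + 1)) * (4 * n * n) ≤ P * 2 ^ 6 * (P * P) * (4 * N ^ 2) := by gcongr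
  have a5 : P * 2 ^ 6 * (D * (D + 1)) * (4 * n * n) * n + 2 * (P * 2 ^ 6 * (D * (D + 1)) * (4 * n * n))
      ≤ 2 * ((P * 2 ^ 6 * (P * P) * (4 * N ^ 2)) * N) := by
    calc _ = P * 2 ^ 6 * (D * (D + 1)) * (4 * n * n) * (n + 2) := by ring
      _ ≤ (P * 2 ^ 6 * (P * P) * (4 * N ^ 2)) * (2 * N) := Nat.mul_le_mul a4 (by omega)
      _ = _ := by ring
  have a6 := Nat.mul_le_mul a1 a5
  have a7 : N ^ 3 * P ^ 2 ≤ N ^ 5 * P ^ 3 :=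
    Nat.mul_le_mul (Nat.pow_le_pow_right hN1 (by norm_num)) (Nat.pow_le_pow_right hP (by norm_num))
  have a8 : 1 ≤ N ^ 5 * P ^ 3 := Nat.one_le_iff_ne_zero.2 (by positivity)
  have a9 : 23 * N ^ 2 * (2 * ((P * 2 ^ 6 * (P * P) * (4 * N ^ 2)) * N)) =
      11776 * (N ^ 5 * P ^ 3) := by ring
  omega

/-- Every output of the algorithm is certified, and its expected running time is bounded. -/
theorem certify_spec (G : SimpleGraph (Fin n)) :
    ∃ D, 16 ≤ D ∧ (D = 16 ∨ ∃ v, D = (nbrs G v).card) ∧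
      (∀ ω t s, Exec .certify (initState G ω) t s → Certified G D (s.output n)) ∧
      expectedTime .certify G ≤ ((50000 * ((n + 1) ^ 5 * (2 ^ D) ^ 3) : ℕ) : ℝ≥0∞) := by
  obtain ⟨t₀, s₀, he₀, D, lab, c, b, l, h16, hdeg, hex, ht₀, hL, hS₀, hW₀⟩ :=
    wp_setup G fun _ => false
  have hK : 0 < layers D := by have := two_le_layers h16; omega
  have hS : ∀ ω, Exec .setup (initState G ω) t₀ (s₀.withCoins ω) := fun ω =>
    he₀.withCoins flipFree_setup ω
  refine ⟨D, h16, hex, fun ω t s he => ?_, ?_⟩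
  · cases he with
    | seq h1 h2 =>
      obtain ⟨rfl, rfl⟩ := h1.det (hS ω)
      cases h2 with
      | seq h3 h4 =>
        cases h3
        cases h4 with
        | seq h5 h6 =>
          cases h5
          obtain ⟨W, hW, hWle, hM⟩ := sampler_correct h6
            (((hS₀.withCoins ω)).frame (k := 8) (by simp [Frame.refl]) le_rfl) (W := ∅)
            (by exact hW₀) (by simp [hS₀.target]) (empty_mem_indepIn _ _)
          have hout : s.output n = W := by
            ext v
            have := hM v
            by_cases hv : v ∈ W <;> simp [State.output, this, hv]
          rw [hout]
          exact ⟨(mem_indepIn.1 hW).2, lab, c, b, hL.layerCover hK, hWle⟩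
  · obtain ⟨r, hr, hcard, hfree⟩ := hL.exists_best hK
    set U := Finset.univ.filter fun u => lab u = l with hU
    set Stop : Finset (Fin n) → Prop :=
      fun W => (Nat.log 2 D + 1) * b ≤ 1024 * D * layers D * W.card with hStop
    set κ := 2 ^ (D + 6) * (D * (D + 1)) with hκ
    have hsum : ∫⁻ ω, ∑' i, survives G U (List.finRange n) Stop i ∅ ω ∂coinLaw ≤
        ((κ * (4 * n * n) * n + 2 * (κ * (4 * n * n)) : ℕ) : ℝ≥0∞) := by
      -- For n = 0 the parameter M would be 0; there the stopping rule holds at once because b = 0.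
      rcases Nat.eq_zero_or_pos n with rfl | hn
      · have hb : b = 0 := by
          have : U = ∅ := Subsingleton.elim _ _
          rw [this, Finset.card_empty] at hcard
          rcases Nat.mul_eq_zero.1 hcard.symm with h | h
          · omega
          · exact h
        have : ∀ i ω, survives G U (List.finRange 0) Stop i ∅ ω = 0 := by
          intro i ω
          cases i <;> simp [survives, hStop, hb]
        simp only [this, tsum_zero, lintegral_zero]
        exact zero_le
      · have := lintegral_tsum_survives_le (U := U) (Stop := Stop) (l := List.finRange n)
          (κ := κ) List.mem_finRange (layer_gap h16 hdeg hr hcard hfree) rfl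
          (by simp only [List.length_finRange, Fintype.card_fin]; positivity)
          (empty_mem_indepIn G U)
        simpa using this
    calc expectedTime .certify G
        ≤ ∫⁻ ω, (((t₀ + 3 : ℕ) : ℝ≥0∞) + ((n * (9 * n + 23) + 7 : ℕ) : ℝ≥0∞) *
            ∑' i, survives G U (List.finRange n) Stop i ∅ ω) ∂coinLaw :=
          lintegral_mono fun ω => runTime_sampler_le (hS ω) (hS₀.withCoins ω) (by exact hW₀)
      _ = ((t₀ + 3 : ℕ) : ℝ≥0∞) + ((n * (9 * n + 23) + 7 : ℕ) : ℝ≥0∞) *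
            ∫⁻ ω, ∑' i, survives G U (List.finRange n) Stop i ∅ ω ∂coinLaw := by
          rw [lintegral_add_left measurable_const, lintegral_const, measure_univ, mul_one,
            lintegral_const_mul' _ _ (ENNReal.natCast_ne_top _)]
      _ ≤ ((t₀ + 3 : ℕ) : ℝ≥0∞) + ((n * (9 * n + 23) + 7 : ℕ) : ℝ≥0∞) *
            ((κ * (4 * n * n) * n + 2 * (κ * (4 * n * n)) : ℕ) : ℝ≥0∞) := by gcongr
      _ ≤ _ := by exact_mod_cast time_bound ht₀

/-- If no run halted, the expected time would be infinite. This supplies the independent set for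
both integrality gaps. -/
theorem exists_exec_certify (G : SimpleGraph (Fin n)) :
    ∃ ω t s, Exec .certify (initState G ω) t s := by
  obtain ⟨D, -, -, -, hT⟩ := certify_spec G
  by_contra! h
  have : ∀ ω, runTime .certify (initState G ω) = ⊤ := fun ω =>
    iInf₂_eq_top.2 fun t ⟨s, he⟩ => absurd he (h ω t s)
  refine ENNReal.natCast_ne_top _ (top_le_iff.1 (le_trans (le_of_eq ?_) hT))
  simp [expectedTime, this]

/-- The same constants have to bound the ratio and the running time. The exponent of log log d can
be raised from 2 to 5 since log log d ≥ log log 3 > 0. -/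
theorem exists_softRatio_le (C m : ℕ) :
    ∃ C' : ℕ, m ≤ C' ∧ ∀ d : ℕ, 3 ≤ d → softRatio C 2 d ≤ softRatio C' 5 d := by
  set a := Real.log (Real.log 3) with ha
  have ha0 : 0 < a := log_log_three_pos
  refine ⟨max m ⌈C / a ^ 3⌉₊, le_max_left _ _, fun d hd => ?_⟩
  have hd3 : (3 : ℝ) ≤ d := by exact_mod_cast hd
  have h3 : 0 < Real.log 3 := Real.log_pos (by norm_num)
  have hlog : Real.log 3 ≤ Real.log d := Real.log_le_log (by norm_num) hd3
  have hx : a ≤ Real.log (Real.log d) := Real.log_le_log h3 hlog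
  have hC : (C : ℝ) / a ^ 3 ≤ (max m ⌈C / a ^ 3⌉₊ : ℕ) :=
    (Nat.le_ceil _).trans (by exact_mod_cast le_max_right _ _)
  unfold softRatio
  set x := Real.log (Real.log d)
  have hd0 : 0 ≤ d / Real.log d := by
    have : 0 < Real.log d := h3.trans_le hlog
    positivity
  refine mul_le_mul_of_nonneg_right ?_ hd0
  calc (C : ℝ) * x ^ 2 = C / a ^ 3 * (a ^ 3 * x ^ 2) := by field_simp
    _ ≤ (max m ⌈C / a ^ 3⌉₊ : ℕ) * (x ^ 3 * x ^ 2) := by gcongr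
    _ = _ := by ring

theorem degree_bound {d D : ℕ} [DecidableRel G.Adj] (hG : G.maxDegree ≤ d)
    (hD : D = 16 ∨ ∃ v, D = (nbrs G v).card) : D ≤ max 16 d := by
  rcases hD with rfl | ⟨v, rfl⟩
  · exact le_max_left _ _
  · have : nbrs G v = G.neighborFinset v := by ext; simp [mem_nbrs]
    rw [this, SimpleGraph.card_neighborFinset_eq_degree]
    exact ((G.degree_le_maxDegree v).trans hG).trans (le_max_right _ _)

end Algorithm

end IndepRelax

open IndepRelax in
theorem corollary4 :
    HasSoftGap (fun d _ G => cliqueLPValue G (Real.log d)) ∧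
    HasSoftGap (fun d _ G => saValue G ⌊Real.log d⌋₊) ∧
    ∃ (P : Prog) (C c : ℕ), ∀ d : ℕ, 3 ≤ d →
      ∀ (n : ℕ) (G : SimpleGraph (Fin n)) [DecidableRel G.Adj], G.maxDegree ≤ d →
        (∀ (ω : ℕ → Bool) (t : ℕ) (s : State), Exec P (initState G ω) t s →
          G.IsIndepSet (s.output n : Set (Fin n)) ∧
          saValue G d ≤ softRatio C c d * (s.output n).card ∧
          (G.indepNum : ℝ) ≤ softRatio C c d * (s.output n).card) ∧
        expectedTime P G ≤ ((C * (n + 1) ^ c * 2 ^ (c * d) : ℕ) : ℝ≥0∞) := by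
  obtain ⟨C, hC⟩ := exists_softRatio_bound
  have hgap : ∀ d : ℕ, 3 ≤ d → ∀ (n : ℕ) (G : SimpleGraph (Fin n)) [DecidableRel G.Adj],
      G.maxDegree ≤ d → ∃ (D : ℕ) (I : Finset (Fin n)), 16 ≤ D ∧ D ≤ max 16 d ∧ Certified G D I := by
    intro d _ n G _ hG
    obtain ⟨D, h16, hex, hcert, -⟩ := certify_spec G
    obtain ⟨ω, t, s, he⟩ := exists_exec_certify G
    exact ⟨D, s.output n, h16, degree_bound hG hex, hcert ω t s he⟩
  have hmono : ∀ d : ℕ, 3 ≤ d → ∀ (n : ℕ) (G : SimpleGraph (Fin n)) (D : ℕ) (I : Finset (Fin n)),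
      Certified G D I → softRatio C 2 d * I.card ≤ softRatio C 2 d * G.indepNum := by
    intro d hd n G D I hI
    refine mul_le_mul_of_nonneg_left ?_ (softRatio_nonneg C hd)
    exact_mod_cast hI.1.card_le_indepNum
  refine ⟨⟨C, 2, fun d hd n G _ hG => ?_⟩, ⟨C, 2, fun d hd n G _ hG => ?_⟩, ?_⟩
  · obtain ⟨D, I, h16, hDd, hI⟩ := hgap d hd n G hG
    exact (hI.cliqueLPValue_le hd h16 hDd (hC d D hd h16 hDd)).trans (hmono d hd n G D I hI)
  · obtain ⟨D, I, h16, hDd, hI⟩ := hgap d hd n G hG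
    exact (hI.saValue_le hd h16 hDd (hC d D hd h16 hDd) le_rfl).trans (hmono d hd n G D I hI)
  -- The time bound contains (2^D)^3 with D ≤ max 16 d, and 3 D ≤ 48 + 5 d.
  obtain ⟨C', hC', hle⟩ := exists_softRatio_le C (50000 * 2 ^ 48)
  refine ⟨.certify, C', 5, fun d hd n G _ hG => ?_⟩
  obtain ⟨D, h16, hex, hcert, hT⟩ := certify_spec G
  have hDd := degree_bound hG hex
  have hb := hC d D hd h16 hDd
  refine ⟨fun ω t s he => ?_, hT.trans ?_⟩
  · have hI := hcert ω t s he
    have hlog : ⌊Real.log d⌋₊ ≤ d :=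
      Nat.floor_le_of_le ((Real.log_le_sub_one_of_pos (by positivity)).trans (by linarith))
    have hm : softRatio C 2 d * (s.output n).card ≤ softRatio C' 5 d * (s.output n).card :=
      mul_le_mul_of_nonneg_right (hle d hd) (by positivity)
    exact ⟨hI.1, (hI.saValue_le hd h16 hDd hb hlog).trans hm, (hI.indepNum_le h16 hDd hb).trans hm⟩
  · have h1 : (2 ^ D) ^ 3 ≤ 2 ^ 48 * 2 ^ (5 * d) := by
      rw [← pow_mul, ← pow_add]
      exact Nat.pow_le_pow_right (by norm_num) (by omega)
    have h2 : 50000 * ((n + 1) ^ 5 * (2 ^ D) ^ 3) ≤ C' * (n + 1) ^ 5 * 2 ^ (5 * d) :=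
      calc _ ≤ 50000 * ((n + 1) ^ 5 * (2 ^ 48 * 2 ^ (5 * d))) := by gcongr
        _ = 50000 * 2 ^ 48 * ((n + 1) ^ 5 * 2 ^ (5 * d)) := by ring
        _ ≤ C' * ((n + 1) ^ 5 * 2 ^ (5 * d)) := Nat.mul_le_mul_right _ hC'
        _ = _ := by ring
    exact_mod_cast h2
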